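/- An empty pentagon in a finite point set $P$ in the plane is a set $X\subseteq P$ of five points in strictly convex position (that is, $\operatorname{conv}(X\setminus\{x\})\neq\operatorname{conv}(X)$ for every $x\in X$) such that $P\cap\operatorname{conv}(X)=X$. (1) For every integer $\ell\ge 0$, every finite set $P$ of at least $328\ell^2$ points in the plane contains an empty pentagon or $\ell$ distinct collinear points. (2) For every integer $\ell\ge 1$, the $(\ell-1)\times(\ell-1)$ square grid $\{0,\dots,\ell-2\}\times\{0,\dots,\ell-2\}$ has $(\ell-1)^2$ points and contains neither an empty pentagon nor $\ell$ collinear points. (3) Consequently the quadratic bound is optimal up to a constant factor: there is a constant $c>0$ such that for all integers $\ell,N\ge 0$, if every finite set of at least $N$ points in the plane contains an empty pentagon or $\ell$ collinear points, then $N\ge c\,\ell^2$. -/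

import Mathlib

/-- The Euclidean plane. -/
abbrev Plane : Type := EuclideanSpace ℝ (Fin 2)

/-- `x` is a corner of `X`: a point of `X` whose removal changes the convex hull. -/
def IsCornerOf (X : Set Plane) (x : Plane) : Prop :=
  x ∈ X ∧ convexHull ℝ (X \ {x}) ≠ convexHull ℝ X

/-- `X` is in strictly convex position: every point of `X` is a corner of `X`. -/
def StrictlyConvexPosition (X : Set Plane) : Prop :=
  ∀ x ∈ X, IsCornerOf X x

/-- A strictly convex `k`-gon: a set of `k` points in strictly convex position. -/
def IsStrictlyConvexGon (k : ℕ) (X : Finset Plane) : Prop :=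
  X.card = k ∧ StrictlyConvexPosition (X : Set Plane)

/-- `X` is an empty `k`-gon of the point set `P`: a subset of `P` that is a strictly convex
`k`-gon and whose convex hull contains no other point of `P`. -/
def IsEmptyGon (k : ℕ) (P X : Finset Plane) : Prop :=
  X ⊆ P ∧ IsStrictlyConvexGon k X ∧
    (P : Set Plane) ∩ convexHull ℝ (X : Set Plane) = (X : Set Plane)

/-- `P` contains an empty pentagon. -/
def ContainsEmptyPentagon (P : Finset Plane) : Prop :=
  ∃ X : Finset Plane, IsEmptyGon 5 P X

/-- `P` contains `ℓ` (distinct) collinear points. -/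
def ContainsCollinear (ℓ : ℕ) (P : Finset Plane) : Prop :=
  ∃ S : Finset Plane, S ⊆ P ∧ S.card = ℓ ∧ Collinear ℝ (S : Set Plane)

open Classical in
/-- The `m × m` square grid `{0, …, m - 1} × {0, …, m - 1}`. -/
noncomputable def squareGrid (m : ℕ) : Finset Plane :=
  (Finset.range m ×ˢ Finset.range m).image fun p : ℕ × ℕ => !₂[(p.1 : ℝ), (p.2 : ℝ)]

/-! Let `P` have no empty pentagon and at most `M` points on a line, with `M = ℓ - 1 ≥ 2`. Peel `P`
into convex layers and fix a point `z` of the last one. Orientations carry a scale `e` whose sign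
chooses the sense of rotation, so a one-sided argument is given once and its mirror image is the
instance `-e`.

The main tool is `NoPent.wedge`: outside an edge of an empty convex quadrilateral, between the lines
of the two neighbouring edges, there is no point of `P`, because a nearest such point would complete
an empty pentagon. Seen from `z`, consecutive points of layer `i + 1` bound a window, and a window
contains at most one point of layer `i` (`Win.unique`). A point `p` in the window `q q'` has an apex
`d` such that `p q' d q` is empty and all remaining points of the cone at `p` lie in the opposite
cone at `d` (`exists_cone_apex`). The apex is on layer `i + 2` (`Win.apex_bd`).

Certain alignments with `z` reproduce themselves in every deeper layer along the same ray
(`Sig.step`, `Delta.step`). They use up collinear points, so they occur only within a number of last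
layers linear in `M`. In the other layers, sending a point to the end of its window injects each
layer into the next. Layer sizes therefore grow inwards, and the irregularities, summed over all
these layers, are bounded by a multiple of the largest layer size `N`.

At a regular point `p` whose apex is not on the side of `q'`, the points `p`, `q'` and the end of
the window of `q'` are collinear, and `q'` inherits the condition (`Clean.collinear`, `Clean.sign`,
`XS.step`). Each point off the alignments satisfies the condition for one of the two orientations
(`XS.or`). The outer layers thus split into straight chains of at most `M` points whose ends are
irregular, which gives at most `20 M N` points (`card_upper_layers`).

The bound `N ≤ 14 (M - 1)` is `card_bd_le`. In a minimal counterexample each corner of the hull has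
a persistent alignment on one of its two sides, since otherwise deleting a side would not reduce the
number of boundary points. These alignments reach the layer next to the last, where among any five
boundary points two share a supporting line (`exists_cos`). This relation travels back outwards
(`Cos.outward`), so four alignments control the boundary up to a bounded number of lines each. The
final estimate adds the outer layers and the `3 M + 20` last ones.

For the grid, two of five points agree modulo 2 in both coordinates, and their midpoint is a grid
point that spoils emptiness or strict convexity. -/

set_option linter.unusedVariables false
set_option linter.unusedSimpArgs false

open scoped Classical

/-! ### Orientation calculus -/

/-- Twice the signed area of the triangle `a b c`, scaled by `e`. -/
def ori (e : ℝ) (a b c : ℝ × ℝ) : ℝ :=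
  e * ((b.1 - a.1) * (c.2 - a.2) - (b.2 - a.2) * (c.1 - a.1))

theorem ori_rot (e : ℝ) (a b c : ℝ × ℝ) : ori e b c a = ori e a b c := by
  unfold ori; ring

theorem ori_swap (e : ℝ) (a b c : ℝ × ℝ) : ori e b a c = -ori e a b c := by
  unfold ori; ring

theorem ori_swap' (e : ℝ) (a b c : ℝ × ℝ) : ori e a c b = -ori e a b c := by
  unfold ori; ring

theorem ori_neg (e : ℝ) (a b c : ℝ × ℝ) : ori (-e) a b c = -ori e a b c := by
  unfold ori; ring

theorem ori_neg' (e : ℝ) (a b c : ℝ × ℝ) : ori (-e) a b c = ori e b a c := by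
  unfold ori; ring

theorem ori_base (e : ℝ) (z a b c : ℝ × ℝ) :
    ori e a b c = ori e z a b + ori e z b c + ori e z c a := by
  unfold ori; ring

theorem ori_gp (e : ℝ) (p a b c d : ℝ × ℝ) :
    ori e p a b * ori e p c d - ori e p a c * ori e p b d + ori e p a d * ori e p b c = 0 := by
  unfold ori; ring

theorem rotP {e : ℝ} {a b c : ℝ × ℝ} (h : 0 < ori e a b c) : 0 < ori e b c a := by
  rwa [ori_rot]

theorem rotP' {e : ℝ} {a b c : ℝ × ℝ} (h : 0 < ori e a b c) : 0 < ori e c a b := rotP (rotP h)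

theorem rotN {e : ℝ} {a b c : ℝ × ℝ} (h : 0 ≤ ori e a b c) : 0 ≤ ori e b c a := by
  rwa [ori_rot]

theorem rotN' {e : ℝ} {a b c : ℝ × ℝ} (h : 0 ≤ ori e a b c) : 0 ≤ ori e c a b := rotN (rotN h)

theorem ori_bary (e : ℝ) (a b c u v x : ℝ × ℝ) : ori e a b c * ori e u v x =
    ori e b c x * ori e u v a + ori e c a x * ori e u v b + ori e a b x * ori e u v c := by
  unfold ori; ring

theorem tri_nonneg {e : ℝ} {a b c u v x : ℝ × ℝ} (h : 0 < ori e a b c) (h1 : 0 ≤ ori e a b x)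
    (h2 : 0 ≤ ori e b c x) (h3 : 0 ≤ ori e c a x) (ha : 0 ≤ ori e u v a) (hb : 0 ≤ ori e u v b)
    (hc : 0 ≤ ori e u v c) : 0 ≤ ori e u v x := by
  have := ori_bary e a b c u v x
  have h3 : 0 ≤ ori e a b c * ori e u v x := by rw [this]; positivity
  exact nonneg_of_mul_nonneg_right h3 h

@[simp] theorem ori_left (e : ℝ) (a b : ℝ × ℝ) : ori e a a b = 0 := by unfold ori; ring
@[simp] theorem ori_right (e : ℝ) (a b : ℝ × ℝ) : ori e a b b = 0 := by unfold ori; ring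
@[simp] theorem ori_mid (e : ℝ) (a b : ℝ × ℝ) : ori e a b a = 0 := by unfold ori; ring

/-- Two non-parallel lines meet in at most one point. -/
theorem eq_of_ori_eq_zero {e : ℝ} {a b c x : ℝ × ℝ} (h : ori e a b c ≠ 0)
    (h1 : ori e a b x = 0) (h2 : ori e a c x = 0) : x = a := by
  have k1 : ori e a b c * (x.1 - a.1) = 0 := by
    have : ori e a b c * (x.1 - a.1) = (b.1 - a.1) * - ori e a c x + (c.1 - a.1) * ori e a b x := by
      unfold ori; ring
    rw [this, h1, h2]; ring
  have k2 : ori e a b c * (x.2 - a.2) = 0 := by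
    have : ori e a b c * (x.2 - a.2) = (b.2 - a.2) * - ori e a c x + (c.2 - a.2) * ori e a b x := by
      unfold ori; ring
    rw [this, h1, h2]; ring
  ext
  · have := (mul_eq_zero.1 k1).resolve_left h; linarith
  · have := (mul_eq_zero.1 k2).resolve_left h; linarith

/-! ### Empty polygons, wedges and apexes -/

/-- Every strictly convex pentagon spanned by `P` contains another point of `P`. -/
def NoPent (P : Finset (ℝ × ℝ)) : Prop :=
  ∀ e : ℝ, ∀ a ∈ P, ∀ b ∈ P, ∀ c ∈ P, ∀ d ∈ P, ∀ f ∈ P,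
    0 < ori e a b c → 0 < ori e a b d → 0 < ori e a b f → 0 < ori e a c d → 0 < ori e a c f →
    0 < ori e a d f → 0 < ori e b c d → 0 < ori e b c f → 0 < ori e b d f → 0 < ori e c d f →
    ∃ x ∈ P, x ≠ a ∧ x ≠ b ∧ x ≠ c ∧ x ≠ d ∧ x ≠ f ∧ 0 ≤ ori e a b x ∧ 0 ≤ ori e b c x ∧
      0 ≤ ori e c d x ∧ 0 ≤ ori e d f x ∧ 0 ≤ ori e f a x

/-- `a b c d` is a strictly convex quadrilateral in counterclockwise order (if `0 < e`) whose
closed hull contains no other point of `P`. -/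
structure QE (P : Finset (ℝ × ℝ)) (e : ℝ) (a b c d : ℝ × ℝ) : Prop where
  ha : a ∈ P
  hb : b ∈ P
  hc : c ∈ P
  hd : d ∈ P
  abc : 0 < ori e a b c
  bcd : 0 < ori e b c d
  cda : 0 < ori e c d a
  dab : 0 < ori e d a b
  empty : ∀ x ∈ P, 0 ≤ ori e a b x → 0 ≤ ori e b c x → 0 ≤ ori e c d x → 0 ≤ ori e d a x →
    x = a ∨ x = b ∨ x = c ∨ x = d

/-- `a b c` is a counterclockwise triangle (if `0 < e`) containing no other point of `P`. -/
structure TE (P : Finset (ℝ × ℝ)) (e : ℝ) (a b c : ℝ × ℝ) : Prop where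
  ha : a ∈ P
  hb : b ∈ P
  hc : c ∈ P
  abc : 0 < ori e a b c
  empty : ∀ x ∈ P, 0 ≤ ori e a b x → 0 ≤ ori e b c x → 0 ≤ ori e c a x → x = a ∨ x = b ∨ x = c

theorem QE.rot {P : Finset (ℝ × ℝ)} {e : ℝ} {a b c d : ℝ × ℝ} (h : QE P e a b c d) :
    QE P e b c d a :=
  ⟨h.hb, h.hc, h.hd, h.ha, h.bcd, h.cda, h.dab, h.abc, fun x hx h1 h2 h3 h4 => by
    have := h.empty x hx h4 h1 h2 h3; tauto⟩

theorem QE.mirror {P : Finset (ℝ × ℝ)} {e : ℝ} {a b c d : ℝ × ℝ} (h : QE P e a b c d) :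
    QE P (-e) d c b a := by
  refine ⟨h.hd, h.hc, h.hb, h.ha, ?_, ?_, ?_, ?_, fun x hx h1 h2 h3 h4 => ?_⟩
  · rw [ori_neg']; exact rotP h.bcd
  · rw [ori_neg']; exact rotP h.abc
  · rw [ori_neg']; exact rotP h.dab
  · rw [ori_neg']; exact rotP h.cda
  · rw [ori_neg'] at h1 h2 h3 h4
    have := h.empty x hx h3 h2 h1 h4; tauto

theorem TE.rot {P : Finset (ℝ × ℝ)} {e : ℝ} {a b c : ℝ × ℝ} (h : TE P e a b c) : TE P e b c a :=
  ⟨h.hb, h.hc, h.ha, by rw [ori_rot]; exact h.abc, fun x hx h1 h2 h3 => by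
    have := h.empty x hx h3 h1 h2; tauto⟩

/-- Two empty triangles sharing a diagonal of a convex quadrilateral. -/
theorem QE.of_TE {P : Finset (ℝ × ℝ)} {e : ℝ} {a b c d : ℝ × ℝ} (h1 : TE P e a b c)
    (h2 : TE P e a c d) (hb : 0 < ori e b c d) (hd : 0 < ori e d a b) : QE P e a b c d := by
  refine ⟨h1.ha, h1.hb, h1.hc, h2.hc, h1.abc, hb, rotP h2.abc, hd,
    fun x hx k1 k2 k3 k4 => ?_⟩
  rcases le_total 0 (ori e c a x) with h | h
  · have := h1.empty x hx k1 k2 h; tauto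
  · have := h2.empty x hx (by rw [ori_swap]; linarith) k3 k4; tauto

/-- Take `u` nearest to the line `c d`. Then `a b c u d` is strictly convex. Since the quadrilateral
is empty, the extra point in this pentagon lies in the triangle `c u d`, which contradicts the
choice of `u`. -/
theorem NoPent.wedge {P : Finset (ℝ × ℝ)} (hP : NoPent P) {e : ℝ} {a b c d u : ℝ × ℝ}
    (h : QE P e a b c d) (hu : u ∈ P) (h1 : 0 < ori e b c u) (h2 : 0 < ori e c u d)
    (h3 : 0 < ori e u d a) : False := by
  have hne : (P.filter fun u => 0 < ori e b c u ∧ 0 < ori e c u d ∧ 0 < ori e u d a).Nonempty :=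
    ⟨u, by simp [*]⟩
  obtain ⟨u, hu', hmin⟩ := Finset.exists_min_image _ (fun u => ori e c u d) hne
  simp only [Finset.mem_filter] at hu' hmin
  clear hne h1 h2 h3 hu
  obtain ⟨hu, h1, h2, h3⟩ := hu'
  have abc := h.abc
  have bcd := h.bcd
  have cda := h.cda
  have dab := h.dab
  have acu : 0 < ori e a c u := by unfold ori at *; nlinarith
  have bud : 0 < ori e b u d := by unfold ori at *; nlinarith
  have abu : 0 < ori e a b u := by
    have := ori_gp e a b c d u
    have t1 : ori e a u d = ori e u d a := by unfold ori; ring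
    have t2 : ori e a c d = ori e c d a := by unfold ori; ring
    have t3 : ori e a b d = ori e d a b := by unfold ori; ring
    have t4 : ori e a d u = - ori e a u d := by unfold ori; ring
    rw [t4, t1, t2, t3] at this
    by_contra hn
    nlinarith [mul_pos abc h3, mul_pos dab acu]
  obtain ⟨x, hx, xa, xb, xc, xu, xd, k1, k2, k3, k4, k5⟩ := hP e a h.ha b h.hb c h.hc u hu d h.hd
    abc abu (rotP dab) acu (rotP' cda) (rotP' h3) h1 bcd bud h2
  have cdx : ori e c d x < 0 := by
    by_contra hn
    have := h.empty x hx k1 k2 (not_lt.1 hn) k5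
    tauto
  have bcx : 0 < ori e b c x := by
    have := ori_gp e c b d u x
    rcases k2.lt_or_eq with h | h
    · exact h
    · exfalso
      unfold ori at *; nlinarith
  have dax : 0 < ori e x d a := by
    have k5' := rotN' k5
    rcases k5'.lt_or_eq with h | h
    · exact h
    · exfalso
      unfold ori at *; nlinarith
  have hle := hmin x ⟨hx, bcx, by rw [ori_swap']; linarith, dax⟩
  have hsum : ori e c u d = ori e c u x + ori e u d x + ori e c x d := by unfold ori; ring
  refine xu (eq_of_ori_eq_zero (e := e) (a := u) (b := c) (c := d) ?_ ?_ ?_)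
  · have : ori e u c d = - ori e c u d := by unfold ori; ring
    rw [this]; linarith
  · have : ori e u c x = - ori e c u x := by unfold ori; ring
    rw [this]; linarith
  · linarith

/-- The apex of the cone at `p` spanned by the empty triangle `p q' q`: `d` is a point of `P` in the
open cone beyond `q q'` such that `p q' d q` is empty, and the points of `P` in the open cone beyond
`q q'` all lie in the opposite cone at `d`. -/
structure IsD (P : Finset (ℝ × ℝ)) (e : ℝ) (p q q' d : ℝ × ℝ) : Prop where
  qe : QE P e p q' d q
  h1 : 0 < ori e p q' d
  h2 : 0 < ori e p d q
  h3 : 0 < ori e q q' d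
  far : ∀ u ∈ P, 0 < ori e p q' u → 0 < ori e p u q → 0 < ori e q q' u →
    0 ≤ ori e q d u ∧ 0 ≤ ori e d q' u

/-- The candidate nearest to the line `q q'` makes `p q' d q` empty. A point of the cone outside the
opposite cone at `d` would then lie in a wedge of this quadrilateral at one of the two edges that
meet in `d`. -/
theorem exists_cone_apex {P : Finset (ℝ × ℝ)} (hP : NoPent P) {e : ℝ} {p q' q z : ℝ × ℝ}
    (h : TE P e p q' q) (hz : z ∈ P) (h1 : 0 < ori e p q' z) (h2 : 0 < ori e p z q)
    (h3 : 0 < ori e q q' z) : ∃ d, IsD P e p q q' d := by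
  have hne : (P.filter fun u => 0 < ori e p q' u ∧ 0 < ori e p u q ∧ 0 < ori e q q' u).Nonempty :=
    ⟨z, by simp [*]⟩
  obtain ⟨d, hd', hmin⟩ := Finset.exists_min_image _ (fun u => ori e q q' u) hne
  simp only [Finset.mem_filter] at hd' hmin
  clear hne h1 h2 h3 hz
  obtain ⟨hd, h1, h2, h3⟩ := hd'
  have hpqq := h.abc
  have hqe : QE P e p q' d q := by
    refine ⟨h.ha, h.hb, hd, h.hc, h1, rotP h3, rotP h2, rotP' hpqq, fun x hx k1 k2 k3 k4 => ?_⟩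
    rcases le_or_gt (ori e q q' x) 0 with k | k
    · have := h.empty x hx k1 (by rw [ori_swap]; linarith) k4
      tauto
    · have hsum : ori e q q' d = ori e q q' x + ori e q' d x + ori e d q x := by unfold ori; ring
      have l1 : 0 < ori e p q' x := by
        unfold ori at *; nlinarith
      have l2 : 0 < ori e p x q := by
        unfold ori at *; nlinarith
      have := hmin x ⟨hx, l1, l2, k⟩
      right; right; left
      refine eq_of_ori_eq_zero (e := e) (a := d) (b := q) (c := q') ?_ ?_ ?_
      · exact (rotP' h3).ne'
      · linarith
      · rw [ori_swap]; linarith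
  refine ⟨d, hqe, h1, h2, h3, fun u hu k1 k2 k3 => ?_⟩
  -- Quantified over the whole configuration, so that the other inequality is the mirrored instance.
  have main : ∀ e p q' q d, QE P e p q' d q → 0 < ori e p q' u → 0 < ori e p u q →
      0 < ori e q q' u → 0 ≤ ori e d q' u := by
    intro e p q' q d hqe k1 k2 k3
    by_contra hn
    push Not at hn
    rcases le_or_gt (ori e q d u) 0 with k | k
    · have := hqe.empty u hu k1.le (by rw [ori_swap]; linarith) (by rw [ori_swap]; linarith)
        (rotN' k2.le)
      rcases this with rfl | rfl | rfl | rfl <;> simp at *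
    · exact hP.wedge hqe hu (by rw [ori_swap]; linarith) (rotP k) (rotP k2)
  refine ⟨?_, main e p q' q d hqe k1 k2 k3⟩
  have := main (-e) p q q' d hqe.mirror.rot.rot.rot (by rw [ori_neg']; exact rotP' k2) (by rw [ori_neg']; exact rotP' k1) (by rw [ori_neg']; exact k3)
  rw [ori_neg'] at this; exact this

/-! ### Convex layers -/

/-- The linear functional `v` applied to `x - a`. -/
def dt (v a x : ℝ × ℝ) : ℝ := v.1 * (x.1 - a.1) + v.2 * (x.2 - a.2)

/-- The points of `Q` on the boundary of its convex hull. -/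
noncomputable def bd (Q : Finset (ℝ × ℝ)) : Finset (ℝ × ℝ) :=
  Q.filter fun a => ∃ v : ℝ × ℝ, v ≠ 0 ∧ ∀ x ∈ Q, 0 ≤ dt v a x

/-- `z` is in the interior of the convex hull of `Q`. -/
def Surr (Q : Finset (ℝ × ℝ)) (z : ℝ × ℝ) : Prop :=
  ∀ v : ℝ × ℝ, v ≠ 0 → ∃ x ∈ Q, dt v z x < 0

/-- What remains of `P` after peeling off `i` convex layers. -/
noncomputable def lay (P : Finset (ℝ × ℝ)) : ℕ → Finset (ℝ × ℝ)
  | 0 => P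
  | i + 1 => lay P i \ bd (lay P i)

theorem bd_subset (Q : Finset (ℝ × ℝ)) : bd Q ⊆ Q := Finset.filter_subset _ _

theorem mem_of_bd {Q : Finset (ℝ × ℝ)} {a : ℝ × ℝ} (h : a ∈ bd Q) : a ∈ Q := bd_subset Q h

theorem Surr.mono {Q R : Finset (ℝ × ℝ)} {z : ℝ × ℝ} (h : Surr Q z) (hQR : Q ⊆ R) : Surr R z :=
  fun v hv => by
    obtain ⟨x, hx, h⟩ := h v hv
    exact ⟨x, hQR hx, h⟩

theorem surr_of_mem_sdiff {Q : Finset (ℝ × ℝ)} {z : ℝ × ℝ} (h : z ∈ Q \ bd Q) : Surr Q z := by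
  intro v hv
  by_contra hn
  push Not at hn
  rw [Finset.mem_sdiff] at h
  exact h.2 (Finset.mem_filter.2 ⟨h.1, v, hv, hn⟩)

theorem not_bd_of_surr {Q : Finset (ℝ × ℝ)} {z : ℝ × ℝ} (h : Surr Q z) : z ∉ bd Q := by
  intro hz
  obtain ⟨-, v, hv, hx⟩ := Finset.mem_filter.1 hz
  obtain ⟨x, hxQ, hlt⟩ := h v hv
  linarith [hx x hxQ]

theorem lay_succ_subset (P : Finset (ℝ × ℝ)) (i : ℕ) : lay P (i + 1) ⊆ lay P i :=
  Finset.sdiff_subset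

theorem lay_anti (P : Finset (ℝ × ℝ)) {i j : ℕ} (h : i ≤ j) : lay P j ⊆ lay P i := by
  induction h with
  | refl => exact Finset.Subset.refl _
  | step _ ih => exact (lay_succ_subset P _).trans ih

theorem lay_subset (P : Finset (ℝ × ℝ)) (i : ℕ) : lay P i ⊆ P := lay_anti P (Nat.zero_le i)

theorem surr_of_lay_succ {P : Finset (ℝ × ℝ)} {i : ℕ} {z : ℝ × ℝ} (h : z ∈ lay P (i + 1)) :
    Surr (lay P i) z := surr_of_mem_sdiff h

theorem surr_of_lay {P : Finset (ℝ × ℝ)} {i j : ℕ} (hij : i < j) {z : ℝ × ℝ} (h : z ∈ lay P j) :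
    Surr (lay P i) z := surr_of_lay_succ (lay_anti P hij h)

theorem lay_cases {P : Finset (ℝ × ℝ)} {i : ℕ} {x : ℝ × ℝ} (h : x ∈ lay P i) :
    x ∈ bd (lay P i) ∨ x ∈ lay P (i + 1) := by
  by_cases hx : x ∈ bd (lay P i)
  · exact Or.inl hx
  · exact Or.inr (Finset.mem_sdiff.2 ⟨h, hx⟩)

theorem exists_support {Q : Finset (ℝ × ℝ)} {a : ℝ × ℝ} (h : a ∈ bd Q) :
    ∃ v : ℝ × ℝ, (∀ x ∈ Q, 0 ≤ dt v a x) ∧ ∀ z, Surr Q z → 0 < dt v a z := by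
  obtain ⟨-, v, hv, hx⟩ := Finset.mem_filter.1 h
  refine ⟨v, hx, fun z hz => ?_⟩
  obtain ⟨x, hxQ, hlt⟩ := hz v hv
  have := hx x hxQ
  unfold dt at *; linarith

/-- A boundary point of `Q` is not a convex combination of points of `Q` and interior points in
which an interior point has positive weight. -/
theorem bd_not_comb {Q : Finset (ℝ × ℝ)} {e : ℝ} {a x y w : ℝ × ℝ} (ha : a ∈ bd Q)
    (hx : x ∈ Q ∨ Surr Q x) (hy : y ∈ Q ∨ Surr Q y) (hw : Surr Q w)
    (h1 : 0 ≤ ori e a y w) (h2 : 0 ≤ ori e x a w) (h3 : 0 < ori e x y a) : False := by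
  obtain ⟨v, hv, hs⟩ := exists_support ha
  have kx : 0 ≤ dt v a x := hx.elim (hv x) fun h => (hs x h).le
  have ky : 0 ≤ dt v a y := hy.elim (hv y) fun h => (hs y h).le
  have kw := hs w hw
  have : ori e a y w * dt v a x + ori e x a w * dt v a y + ori e x y a * dt v a w = 0 := by
    unfold ori dt; ring
  nlinarith [mul_nonneg h1 kx, mul_nonneg h2 ky, mul_pos h3 kw]

/-- Layer by layer: the corners are interior to what remained one step earlier, and a boundary point
is no convex combination of interior points. -/
theorem mem_lay_of_triangle {P : Finset (ℝ × ℝ)} {e : ℝ} {i : ℕ} {a b c x : ℝ × ℝ}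
    (ha : a ∈ lay P i) (hb : b ∈ lay P i) (hc : c ∈ lay P i) (hx : x ∈ P)
    (h : 0 < ori e a b c) (h1 : 0 ≤ ori e a b x) (h2 : 0 ≤ ori e b c x) (h3 : 0 ≤ ori e c a x) :
    x ∈ lay P i := by
  induction i with
  | zero => exact hx
  | succ i ih =>
    have hxi := ih (lay_succ_subset P i ha) (lay_succ_subset P i hb) (lay_succ_subset P i hc)
    refine Finset.mem_sdiff.2 ⟨hxi, fun hxb => ?_⟩
    have sa := surr_of_lay_succ ha
    have sb := surr_of_lay_succ hb
    have sc := surr_of_lay_succ hc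
    have hsum : ori e a b c = ori e a b x + ori e b c x + ori e c a x := by unfold ori; ring
    have h1' := rotN h1
    have h2' := rotN h2
    have h3' := rotN h3
    rcases h1.lt_or_eq with k | k
    · exact bd_not_comb hxb (.inr sa) (.inr sb) sc (rotN h2') h3' k
    rcases h2.lt_or_eq with k | k
    · exact bd_not_comb hxb (.inr sb) (.inr sc) sa (rotN h3') h1' k
    · exact bd_not_comb hxb (.inr sc) (.inr sa) sb (rotN h1') h2' (by linarith)

/-! ### The boundary in angular order around a centre -/

/-- `a` and `b` are consecutive points of `bd Q` as seen from `z`. -/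
structure Ed (Q : Finset (ℝ × ℝ)) (e : ℝ) (z a b : ℝ × ℝ) : Prop where
  ha : a ∈ bd Q
  hb : b ∈ bd Q
  pos : 0 < ori e z a b
  next : ∀ c ∈ bd Q, 0 < ori e z a c → ori e z c b ≤ 0

theorem Ed.mirror {Q : Finset (ℝ × ℝ)} {e : ℝ} {z a b : ℝ × ℝ} (h : Ed Q e z a b) :
    Ed Q (-e) z b a := by
  refine ⟨h.hb, h.ha, ?_, fun c hc hp => ?_⟩
  · have := h.pos
    unfold ori at *; linarith
  · have := h.next c hc
    by_contra hn
    have := this (by unfold ori at *; linarith)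
    unfold ori at *; linarith

theorem ne_of_ori_pos {e : ℝ} {z a b : ℝ × ℝ} (h : 0 < ori e z a b) : e ≠ 0 := by
  rintro rfl; simp [ori] at h

theorem exists_bd_neg {Q : Finset (ℝ × ℝ)} {z v : ℝ × ℝ} (hz : Surr Q z) (hv : v ≠ 0) :
    ∃ a ∈ bd Q, dt v z a < 0 := by
  obtain ⟨x, hx, hlt⟩ := hz v hv
  obtain ⟨a, ha, hmin⟩ := Finset.exists_min_image Q (fun x => dt v z x) ⟨x, hx⟩
  refine ⟨a, Finset.mem_filter.2 ⟨ha, v, hv, fun y hy => ?_⟩, (hmin x hx).trans_lt hlt⟩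
  have := hmin y hy
  unfold dt at *; linarith

theorem exists_bd_left {Q : Finset (ℝ × ℝ)} {e : ℝ} {z p : ℝ × ℝ} (hz : Surr Q z) (he : e ≠ 0)
    (hp : p ≠ z) : ∃ a ∈ bd Q, 0 < ori e z p a := by
  obtain ⟨a, ha, h⟩ := exists_bd_neg (v := (e * (p.2 - z.2), -e * (p.1 - z.1))) hz (by
    intro h
    simp only [Prod.mk_eq_zero, mul_eq_zero, neg_eq_zero, he, false_or, sub_eq_zero] at h
    exact hp (Prod.ext h.2 h.1))
  exact ⟨a, ha, by unfold dt at h; unfold ori; simp only at h; linarith⟩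

theorem exists_next {Q : Finset (ℝ × ℝ)} {e : ℝ} {z p : ℝ × ℝ} (hz : Surr Q z) (he : e ≠ 0)
    (hp : p ≠ z) : ∃ b ∈ bd Q, 0 < ori e z p b ∧ ∀ c ∈ bd Q, 0 < ori e z p c → ori e z c b ≤ 0 := by
  obtain ⟨a, ha, hpos⟩ := exists_bd_left hz he hp
  -- Up to a positive factor the quotient is the cotangent of the angle from the ray `z p`, so its
  -- maximum belongs to the smallest angle.
  obtain ⟨b, hb, hmax⟩ := Finset.exists_max_image ((bd Q).filter fun a => 0 < ori e z p a)
    (fun a => ((p.1 - z.1) * (a.1 - z.1) + (p.2 - z.2) * (a.2 - z.2)) / ori e z p a)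
    ⟨a, by simp [ha, hpos]⟩
  simp only [Finset.mem_filter] at hb hmax
  refine ⟨b, hb.1, hb.2, fun c hc hcp => ?_⟩
  have := hmax c ⟨hc, hcp⟩
  rw [div_le_div_iff₀ hcp hb.2] at this
  have key : ori e z c b * ((p.1 - z.1) ^ 2 + (p.2 - z.2) ^ 2) =
    ((p.1 - z.1) * (c.1 - z.1) + (p.2 - z.2) * (c.2 - z.2)) * ori e z p b -
    ((p.1 - z.1) * (b.1 - z.1) + (p.2 - z.2) * (b.2 - z.2)) * ori e z p c := by
    unfold ori; ring
  have hpz : 0 < (p.1 - z.1) ^ 2 + (p.2 - z.2) ^ 2 := by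
    by_contra hn
    have h1 : p.1 - z.1 = 0 := by nlinarith
    have h2 : p.2 - z.2 = 0 := by nlinarith
    exact hp (Prod.ext (by linarith) (by linarith))
  by_contra hn
  push Not at hn
  nlinarith [mul_pos hn hpz]

/-- `c` is on the open ray from `z` through `p`. -/
def Ray (z p c : ℝ × ℝ) : Prop := ∃ s : ℝ, 0 < s ∧ c = (z.1 + s * (p.1 - z.1), z.2 + s * (p.2 - z.2))

theorem Ray.symm {z p c : ℝ × ℝ} (h : Ray z p c) : Ray z c p := by
  obtain ⟨s, hs, rfl⟩ := h
  refine ⟨s⁻¹, inv_pos.2 hs, ?_⟩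
  ext <;> simp <;> field_simp <;> ring

theorem Ray.refl (z p : ℝ × ℝ) : Ray z p p := ⟨1, one_pos, by simp⟩

theorem Ray.trans {z a b c : ℝ × ℝ} (h : Ray z a b) (h' : Ray z b c) : Ray z a c := by
  obtain ⟨s, hs, rfl⟩ := h
  obtain ⟨t, ht, rfl⟩ := h'
  refine ⟨t * s, mul_pos ht hs, ?_⟩
  ext <;> simp <;> ring

theorem Ray.ori {z p c : ℝ × ℝ} (h : Ray z p c) :
    ∃ s : ℝ, 0 < s ∧ ∀ e x, ori e z c x = s * ori e z p x := by
  obtain ⟨s, hs, rfl⟩ := h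
  exact ⟨s, hs, fun e x => by unfold _root_.ori; simp only; ring⟩

theorem Ray.ori_eq {z p c : ℝ × ℝ} (h : Ray z p c) (e : ℝ) : _root_.ori e z p c = 0 := by
  obtain ⟨s, hs, rfl⟩ := h
  unfold _root_.ori; simp only; ring

theorem Ray.pos {e : ℝ} {z p c x : ℝ × ℝ} (h : Ray z p c) (hx : 0 < _root_.ori e z p x) :
    0 < _root_.ori e z c x := by
  obtain ⟨s, hs, h⟩ := h.ori
  rw [h]; positivity

theorem Ray.pos' {e : ℝ} {z p c x : ℝ × ℝ} (h : Ray z p c) (hx : 0 < _root_.ori e z x p) :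
    0 < _root_.ori e z x c := by
  have := h.pos (e := -e) (x := x) (by unfold _root_.ori at *; linarith)
  unfold _root_.ori at *; linarith

theorem ray_of_ori_eq_zero {e : ℝ} {z p c x : ℝ × ℝ} (h : ori e z p c = 0) (h1 : 0 < ori e z p x)
    (h2 : 0 < ori e z c x) : Ray z p c := by
  refine ⟨ori e z c x / ori e z p x, div_pos h2 h1, ?_⟩
  ext
  · field_simp
    have : ori e z p x * (c.1 - z.1) - ori e z c x * (p.1 - z.1) = ori e z p c * (x.1 - z.1) := by
      unfold ori; ring
    rw [h] at this; linarith
  · field_simp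
    have : ori e z p x * (c.2 - z.2) - ori e z c x * (p.2 - z.2) = ori e z p c * (x.2 - z.2) := by
      unfold ori; ring
    rw [h] at this; linarith

/-- Of two boundary points on a ray, the nearer one would lie strictly between the farther one and
the interior point `z`. -/
theorem bd_ray_unique {Q : Finset (ℝ × ℝ)} {z a b : ℝ × ℝ} (hz : Surr Q z) (ha : a ∈ bd Q)
    (hb : b ∈ bd Q) (h : Ray z a b) : a = b := by
  have main : ∀ a ∈ bd Q, ∀ b ∈ bd Q, ∀ s : ℝ, 1 < s →
      b = (z.1 + s * (a.1 - z.1), z.2 + s * (a.2 - z.2)) → False := by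
    rintro a ha b hb s hs rfl
    obtain ⟨v, hv, hsu⟩ := exists_support ha
    have h1 := hv _ (mem_of_bd hb)
    have h2 := hsu z hz
    have : dt v a (z.1 + s * (a.1 - z.1), z.2 + s * (a.2 - z.2)) = - (s - 1) * dt v a z := by
      unfold dt; simp only; ring
    rw [this] at h1
    nlinarith [mul_pos (sub_pos.2 hs) h2]
  obtain ⟨s, hs, hb'⟩ := h
  rcases lt_trichotomy s 1 with k | k | k
  · exfalso
    refine main b hb a ha s⁻¹ ((one_lt_inv₀ hs).2 k) ?_
    rw [hb']
    ext <;> simp <;> field_simp <;> ring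
  · rw [hb', k]; ext <;> simp
  · exact (main a ha b hb s k hb').elim

theorem Ed.exists {Q : Finset (ℝ × ℝ)} {e : ℝ} {z a : ℝ × ℝ} (hz : Surr Q z) (he : e ≠ 0)
    (ha : a ∈ bd Q) : ∃ b, Ed Q e z a b := by
  obtain ⟨b, hb, h1, h2⟩ := exists_next hz he (p := a) (by rintro rfl; exact not_bd_of_surr hz ha)
  exact ⟨b, ha, hb, h1, h2⟩

theorem Ed.exists' {Q : Finset (ℝ × ℝ)} {e : ℝ} {z a : ℝ × ℝ} (hz : Surr Q z) (he : e ≠ 0)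
    (ha : a ∈ bd Q) : ∃ b, Ed Q e z b a := by
  obtain ⟨b, hb⟩ := Ed.exists hz (neg_ne_zero.2 he) ha
  exact ⟨b, by simpa using hb.mirror⟩

/-- A direction either points to a boundary point or into an open window between two consecutive
ones. -/
theorem ray_or_window {Q : Finset (ℝ × ℝ)} {e : ℝ} {z p : ℝ × ℝ} (hz : Surr Q z) (he : e ≠ 0)
    (hp : p ≠ z) : (∃ c ∈ bd Q, Ray z p c) ∨
      ∃ a b, Ed Q e z a b ∧ 0 < ori e z a p ∧ 0 < ori e z p b := by
  by_cases hr : ∃ c ∈ bd Q, Ray z p c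
  · exact Or.inl hr
  right
  obtain ⟨b, hb, pb, hbn⟩ := exists_next hz he hp
  obtain ⟨a, ha, pa, han⟩ := exists_next hz (neg_ne_zero.2 he) hp
  have ap : 0 < ori e z a p := by unfold ori at *; linarith
  have han : ∀ c ∈ bd Q, 0 < ori e z c p → ori e z a c ≤ 0 := fun c hc h => by
    have := han c hc (by unfold ori at *; linarith)
    unfold ori at *; linarith
  -- If the gap from `a` to `b` were a half turn or more, a boundary point clockwise of `b` would
  -- beat `a` or `b` as a neighbour of `p`, or be on the ray of `p`.
  have key : 0 < ori e z a b := by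
    by_contra hn
    obtain ⟨c, hc, hcb⟩ := exists_bd_left (e := -e) hz (neg_ne_zero.2 he) (p := b)
      (by rintro rfl; exact not_bd_of_surr hz hb)
    have hcb : 0 < ori e z c b := by unfold ori at *; linarith
    rcases lt_trichotomy (ori e z p c) 0 with h | h | h
    · have := han c hc (by unfold ori at *; linarith)
      have gp := ori_gp e z a p b c
      have h1 : ori e z b c < 0 := by rw [ori_swap']; linarith
      nlinarith [mul_pos_of_neg_of_neg (neg_lt_zero.2 ap) h1, mul_nonneg (neg_nonneg.2 (not_lt.1 hn)) (neg_nonneg.2 h.le), mul_nonneg (neg_nonneg.2 this) pb.le]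
    · exact hr ⟨c, hc, ray_of_ori_eq_zero h pb hcb⟩
    · linarith [hbn c hc h]
  refine ⟨a, b, ⟨ha, hb, key, fun c hc hac => ?_⟩, ap, pb⟩
  rcases lt_or_ge 0 (ori e z p c) with h | h
  · exact hbn c hc h
  · rcases h.lt_or_eq with h | h
    · linarith [han c hc (by rw [ori_swap']; linarith)]
    · by_contra hn
      push Not at hn
      exact hr ⟨c, hc, ray_of_ori_eq_zero h pb hn⟩

/-- A point of `Q` farthest beyond the line `a b` is on the boundary, hence not in the open window.
Then `a` or `b` is a convex combination of that point, the other end and `z`, with positive weight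
on `z`. -/
theorem Ed.ori_nonneg {Q : Finset (ℝ × ℝ)} {e : ℝ} {z a b x : ℝ × ℝ} (h : Ed Q e z a b)
    (hz : Surr Q z) (hx : x ∈ Q) : 0 ≤ ori e a b x := by
  obtain ⟨y, hy, hmin⟩ := Finset.exists_min_image Q (fun x => ori e a b x) ⟨x, hx⟩
  refine le_trans ?_ (hmin x hx)
  by_contra hn
  push Not at hn
  have hyb : y ∈ bd Q := by
    refine Finset.mem_filter.2 ⟨hy, (-e * (b.2 - a.2), e * (b.1 - a.1)), ?_, fun u hu => ?_⟩
    · have he := ne_of_ori_pos h.pos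
      have hp := h.pos
      intro h0
      simp only [Prod.mk_eq_zero, mul_eq_zero, neg_eq_zero, he, false_or, sub_eq_zero] at h0
      have : b = a := Prod.ext h0.2 h0.1
      subst this; simp at hp
    · have := hmin u hu
      unfold dt; unfold ori at *; simp only; linarith
  have pos := h.pos
  rcases lt_or_ge 0 (ori e z a y) with k | k
  · have h1 := h.next y hyb k
    refine bd_not_comb (e := e) h.hb (.inl (mem_of_bd h.ha)) (.inl hy) hz ?_ ?_ ?_ <;>
    unfold ori at * <;> linarith
  · refine bd_not_comb (e := e) h.ha (.inl hy) (.inl (mem_of_bd h.hb)) hz ?_ ?_ ?_ <;>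
    unfold ori at * <;> linarith

theorem Ed.ori_pos {Q : Finset (ℝ × ℝ)} {e : ℝ} {z a b w : ℝ × ℝ} (h : Ed Q e z a b)
    (hz : Surr Q z) (hw : Surr Q w) : 0 < ori e a b w := by
  obtain ⟨x, hx, hlt⟩ := hw (-e * (b.2 - a.2), e * (b.1 - a.1)) (by
    have he := ne_of_ori_pos h.pos
    have hp := h.pos
    intro h0
    simp only [Prod.mk_eq_zero, mul_eq_zero, neg_eq_zero, he, false_or, sub_eq_zero] at h0
    have : b = a := Prod.ext h0.2 h0.1
    subst this; simp at hp)
  have := h.ori_nonneg hz hx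
  unfold dt at hlt; unfold ori at *; simp only at hlt; linarith

/-- A point of `Q` on the line of an edge and in its window. -/
theorem Ed.not_between {Q : Finset (ℝ × ℝ)} {e : ℝ} {z a b x : ℝ × ℝ} (h : Ed Q e z a b)
    (hz : Surr Q z) (hx : x ∈ Q) (h0 : ori e a b x = 0) (h1 : 0 < ori e z a x)
    (h2 : 0 < ori e z x b) : False := by
  have hxb : x ∈ bd Q := by
    by_contra hn
    have := h.ori_pos hz (surr_of_mem_sdiff (Finset.mem_sdiff.2 ⟨hx, hn⟩))
    linarith
  linarith [h.next x hxb h1]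

/-- On the line of an edge, the points of `Q` in the closed window are the ends. -/
theorem Ed.eq_or_eq {Q : Finset (ℝ × ℝ)} {e : ℝ} {z a b x : ℝ × ℝ} (h : Ed Q e z a b)
    (hz : Surr Q z) (hx : x ∈ Q) (h0 : ori e a b x = 0) (h1 : 0 ≤ ori e z a x)
    (h2 : 0 ≤ ori e z x b) : x = a ∨ x = b := by
  have pos := h.pos
  rcases h1.lt_or_eq with k1 | k1
  · rcases h2.lt_or_eq with k2 | k2
    · exact (h.not_between hz hx h0 k1 k2).elim
    · right
      refine eq_of_ori_eq_zero (e := e) (a := b) (b := a) (c := z) ?_ ?_ ?_ <;>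
      unfold ori at * <;> linarith
  · left
    refine eq_of_ori_eq_zero (e := e) (a := a) (b := b) (c := z) ?_ ?_ ?_ <;>
    unfold ori at * <;> linarith

/-! ### Windows between consecutive layers -/

section

variable {P : Finset (ℝ × ℝ)} {e : ℝ} {i : ℕ} {z p p' q q' : ℝ × ℝ}

theorem bd_lay_subset (hp : p ∈ bd (lay P i)) : p ∈ P := lay_subset P i (mem_of_bd hp)

/-- `p` is a point of layer `i` in the open window between consecutive points `q`, `q'` of layer
`i + 1`. -/
structure Win (P : Finset (ℝ × ℝ)) (e : ℝ) (z : ℝ × ℝ) (i : ℕ) (p q q' : ℝ × ℝ) : Prop where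
  hp : p ∈ bd (lay P i)
  ed : Ed (lay P (i + 1)) e z q q'
  h1 : 0 < ori e z q p
  h2 : 0 < ori e z p q'

theorem Win.mirror (h : Win P e z i p q q') : Win P (-e) z i p q' q :=
  ⟨h.hp, h.ed.mirror, by have := h.h2; unfold ori at *; linarith,
    by have := h.h1; unfold ori at *; linarith⟩

theorem bd_beyond (hz : Surr (lay P (i + 1)) z) (hp : p ∈ bd (lay P i)) (hq : q ∈ lay P (i + 1))
    (hq' : q' ∈ lay P (i + 1)) (h1 : 0 < ori e z q p) (h2 : 0 < ori e z p q') :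
    ori e q q' p < 0 := by
  by_contra hn
  push Not at hn
  have sz : Surr (lay P i) z := hz.mono (lay_succ_subset P i)
  refine bd_not_comb (e := e) hp (.inr (surr_of_lay_succ hq')) (.inr sz) (surr_of_lay_succ hq)
    ?_ ?_ ?_ <;> unfold ori at * <;> linarith

theorem Win.beyond (hz : Surr (lay P (i + 1)) z) (h : Win P e z i p q q') : 0 < ori e p q' q := by
  have := bd_beyond hz h.hp (mem_of_bd h.ed.ha) (mem_of_bd h.ed.hb) h.h1 h.h2
  unfold ori at *; linarith

/-- A further point of the triangle belongs to what remains after `i` peelings. On the boundary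
there, it would be a combination with weight on the interior points `q`, `q'`; deeper, it is
confined to the segment `q q'`, which contains no further point. -/
theorem Win.te (hz : Surr (lay P (i + 1)) z) (h : Win P e z i p q q') : TE P e p q' q := by
  have hb := h.beyond hz
  have hq := mem_of_bd h.ed.ha
  have hq' := mem_of_bd h.ed.hb
  refine ⟨bd_lay_subset h.hp, lay_subset P _ hq', lay_subset P _ hq, hb, fun x hx k1 k2 k3 => ?_⟩
  have hxi : x ∈ lay P i := mem_lay_of_triangle (mem_of_bd h.hp) (lay_succ_subset P i hq')
    (lay_succ_subset P i hq) hx hb k1 k2 k3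
  have w1 := h.h1
  have w2 := h.h2
  have pos := h.ed.pos
  have hsum : ori e p q' q = ori e p q' x + ori e q' q x + ori e q p x := by unfold ori; ring
  rcases lay_cases hxi with hxb | hx1
  · have s1 := surr_of_lay_succ hq
    have s2 := surr_of_lay_succ hq'
    left
    rcases k1.lt_or_eq with l1 | l1
    · exact (bd_not_comb (e := e) hxb (.inl (mem_of_bd h.hp)) (.inr s2) s1 (rotN' k2)
        (rotN k3) l1).elim
    rcases k3.lt_or_eq with l3 | l3
    · exact (bd_not_comb (e := e) hxb (.inr s1) (.inl (mem_of_bd h.hp)) s2 (rotN' k1)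
        (rotN k2) l3).elim
    refine eq_of_ori_eq_zero (e := e) (a := p) (b := q') (c := q) hb.ne' l1.symm ?_
    rw [ori_swap]; linarith
  · right
    have h0 := h.ed.ori_nonneg hz hx1
    have h0 : ori e q q' x = 0 := by
      have : ori e q' q x = - ori e q q' x := by unfold ori; ring
      linarith
    have := h.ed.eq_or_eq hz hx1 h0 ?_ ?_
    · tauto
    · exact tri_nonneg hb k1 k2 k3 w1.le pos.le (by simp)
    · exact rotN (tri_nonneg (u := q') (v := z) hb k1 k2 k3 (rotP' w2).le (by simp) (rotP' pos).le)

theorem Win.exists_apex (hP : NoPent P) (hzP : z ∈ P) (hz : Surr (lay P (i + 1)) z)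
    (h : Win P e z i p q q') : ∃ d, IsD P e p q q' d := by
  refine exists_cone_apex hP (h.te hz) hzP ?_ ?_ ?_
  · exact rotP h.h2
  · exact rotP' h.h1
  · exact rotP h.ed.pos

theorem IsD.unique {d d' : ℝ × ℝ} (h : IsD P e p q q' d) (h' : IsD P e p q q' d') : d = d' := by
  have a1 := h.far d' h'.qe.hc h'.h1 h'.h2 h'.h3
  have a2 := h'.far d h.qe.hc h.h1 h.h2 h.h3
  have p1 := h'.h3
  refine eq_of_ori_eq_zero (e := e) (a := d') (b := q) (c := q') ?_ ?_ ?_ <;>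
  unfold ori at * <;> linarith

theorem IsD.mirror {d : ℝ × ℝ} (h : IsD P e p q q' d) : IsD P (-e) p q' q d := by
  have a1 := h.h1
  have a2 := h.h2
  have a3 := h.h3
  refine ⟨h.qe.mirror.rot.rot.rot, ?_, ?_, ?_, fun u hu k1 k2 k3 => ?_⟩
  · unfold ori at *; linarith
  · unfold ori at *; linarith
  · unfold ori at *; linarith
  · have := h.far u hu (by unfold ori at *; linarith) (by unfold ori at *; linarith)
      (by unfold ori at *; linarith)
    constructor <;> unfold ori at * <;> linarith

/-- The centre is in the opposite cone at the apex. -/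
theorem Win.center {d : ℝ × ℝ} (h : Win P e z i p q q') (hzP : z ∈ P) (hd : IsD P e p q q' d) :
    0 ≤ ori e z q d ∧ 0 ≤ ori e z d q' := by
  have := hd.far z hzP (rotP h.h2) (rotP' h.h1) (rotP h.ed.pos)
  exact ⟨rotN' this.1, rotN' this.2⟩

/-- By `Win.center` the apex lies in the triangle `z q q'`, and off the side `q q'`, so `z` has
positive weight in it. -/
theorem Win.apex_mem {d : ℝ × ℝ} (h : Win P e z i p q q') (hzl : z ∈ lay P (i + 1))
    (hz : Surr (lay P (i + 1)) z) (hd : IsD P e p q q' d) : d ∈ lay P (i + 2) := by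
  obtain ⟨c1, c2⟩ := h.center (lay_subset P _ hzl) hd
  have pos := h.ed.pos
  have h3 := hd.h3
  have hm : d ∈ lay P (i + 1) := mem_lay_of_triangle (e := e) (mem_of_bd h.ed.ha)
    (mem_of_bd h.ed.hb) hzl hd.qe.hc (rotP pos) h3.le (rotN' c2) c1
  refine Finset.mem_sdiff.2 ⟨hm, fun hb => ?_⟩
  exact bd_not_comb (e := e) hb (.inl (mem_of_bd h.ed.ha)) (.inl (mem_of_bd h.ed.hb)) hz
    (rotN c2) (rotN c1) h3

/-- Consecutive points of layer `i` and consecutive points of layer `i + 1`, the former beyond the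
line of the latter. -/
theorem Ed.te_inner (hz : Surr (lay P (i + 1)) z) (h : Ed (lay P i) e z p p')
    (h' : Ed (lay P (i + 1)) e z q q') (h1 : 0 < ori e q' q p) (h2 : 0 < ori e q' q p') :
    TE P e p p' q := by
  have sz : Surr (lay P i) z := hz.mono (lay_succ_subset P i)
  have hq := mem_of_bd h'.ha
  have sq := surr_of_lay_succ hq
  have hppq := h.ori_pos sz sq
  have hp := mem_of_bd h.ha
  have hp' := mem_of_bd h.hb
  refine ⟨lay_subset P _ hp, lay_subset P _ hp', lay_subset P _ hq, hppq, fun x hx k1 k2 k3 => ?_⟩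
  have hxi : x ∈ lay P i := mem_lay_of_triangle hp hp' (lay_succ_subset P i hq) hx hppq k1 k2 k3
  have hsum : ori e p p' q = ori e p p' x + ori e p' q x + ori e q p x := by unfold ori; ring
  rcases lay_cases hxi with hxb | hx1
  · rcases k1.lt_or_eq with l1 | l1
    · exact (bd_not_comb (e := e) hxb (.inl hp) (.inl hp') sq (rotN' k2) (rotN k3) l1).elim
    · have pos := h.pos
      have zq : 0 < ori e p p' z := rotP pos
      have := h.eq_or_eq sz hxi l1.symm ?_ ?_
      · tauto
      · have hb := ori_bary e p p' q z p x
        rw [← l1] at hb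
        simp only [ori_mid, ori_right, zero_mul, mul_zero, zero_add, add_zero] at hb
        exact nonneg_of_mul_nonneg_right (hb ▸ mul_nonneg k3 pos.le) hppq
      · rw [← ori_rot e z x p', ← ori_rot e x p' z]
        have hb := ori_bary e p p' q p' z x
        rw [← l1] at hb
        simp only [ori_mid, ori_right, zero_mul, mul_zero, zero_add, add_zero] at hb
        exact nonneg_of_mul_nonneg_right (hb ▸ mul_nonneg k2 (rotP' pos).le) hppq
  · right; right
    have h0 := h'.ori_nonneg hz hx1
    have e1 : ori e p p' q * ori e q' q x = ori e p' q x * ori e q' q p + ori e q p x * ori e q' q p' := by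
      unfold ori; ring
    have e2 : ori e q' q x = - ori e q q' x := by unfold ori; ring
    have k2' : ori e p' q x = 0 := by
      rw [e2] at e1
      nlinarith [mul_nonneg hppq.le h0, mul_nonneg k2 h1.le, mul_nonneg k3 h2.le]
    have k3' : ori e q p x = 0 := by
      rw [e2] at e1
      nlinarith [mul_nonneg hppq.le h0, mul_nonneg k2 h1.le, mul_nonneg k3 h2.le]
    refine eq_of_ori_eq_zero (e := e) (a := q) (b := p) (c := p') ?_ k3' ?_
    · exact (rotP' hppq).ne'
    · rw [ori_swap]; linarith

/-- The diagonal `q p'` cuts this piece of the strip between two layers into two triangles, both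
empty. -/
theorem Ed.qe_strip (hz : Surr (lay P (i + 1)) z) (h : Ed (lay P i) e z p p')
    (h' : Ed (lay P (i + 1)) e z q q') (h1 : 0 < ori e q' q p) (h2 : 0 < ori e q' q p') :
    QE P e q p p' q' := by
  have sz : Surr (lay P i) z := hz.mono (lay_succ_subset P i)
  have hq := mem_of_bd h'.ha
  have hq' := mem_of_bd h'.hb
  have sq := surr_of_lay_succ hq
  have sq' := surr_of_lay_succ hq'
  have hp := mem_of_bd h.ha
  have hp' := mem_of_bd h.hb
  have a1 := h.ori_pos sz sq
  have a2 := h.ori_pos sz sq'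
  refine QE.of_TE (h.te_inner hz h' h1 h2).rot.rot ?_ (by exact a2) (rotP' (rotP' (rotP' h1))) 
  refine ⟨lay_subset P _ hq, lay_subset P _ hp', lay_subset P _ hq', rotP h2, fun x hx k1 k2 k3 => ?_⟩
  have hxi : x ∈ lay P i := mem_lay_of_triangle (lay_succ_subset P i hq) hp'
    (lay_succ_subset P i hq') hx (rotP h2) k1 k2 k3
  have hsum : ori e q p' q' = ori e q p' x + ori e p' q' x + ori e q' q x := by unfold ori; ring
  have hT := rotP h2
  rcases lay_cases hxi with hxb | hx1
  · right; left
    rcases k1.lt_or_eq with l1 | l1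
    · exact (bd_not_comb (e := e) hxb (.inr sq) (.inl hp') sq' (rotN' k2) (rotN k3) l1).elim
    rcases k2.lt_or_eq with l3 | l3
    · exact (bd_not_comb (e := e) hxb (.inl hp') (.inr sq') sq (rotN' k3) (rotN k1) l3).elim
    refine eq_of_ori_eq_zero (e := e) (a := p') (b := q') (c := q) (rotP hT).ne' l3.symm ?_
    rw [ori_swap]; linarith
  · have h0 := h'.ori_nonneg hz hx1
    have h0 : ori e q q' x = 0 := by
      have : ori e q' q x = - ori e q q' x := by unfold ori; ring
      linarith
    have pos := h'.pos
    have k30 : ori e q' q x = 0 := by rw [ori_swap, h0, neg_zero]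
    have := h'.eq_or_eq hz hx1 h0 ?_ ?_
    · tauto
    · have hb := ori_bary e q p' q' z q x
      rw [k30] at hb
      simp only [ori_mid, ori_right, zero_mul, mul_zero, zero_add, add_zero] at hb
      exact nonneg_of_mul_nonneg_right (hb ▸ mul_nonneg k1 pos.le) hT
    · rw [← ori_rot e z x q', ← ori_rot e x q' z]
      have hb := ori_bary e q p' q' q' z x
      rw [k30] at hb
      simp only [ori_mid, ori_right, zero_mul, mul_zero, zero_add, add_zero] at hb
      exact nonneg_of_mul_nonneg_right (hb ▸ mul_nonneg k2 (rotP' pos).le) hT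

/-- Otherwise two consecutive points of layer `i` share the window. They span an empty quadrilateral
with `q` and `q'`, and `z` lies in its wedge beyond `q q'`. -/
theorem Win.unique (hP : NoPent P) (hzP : z ∈ P) (hz : Surr (lay P (i + 1)) z)
    (h : Win P e z i p q q') (h' : Win P e z i p' q q') : p = p' := by
  have sz : Surr (lay P i) z := hz.mono (lay_succ_subset P i)
  have main : ∀ p p', Win P e z i p q q' → Win P e z i p' q q' → 0 < ori e z p p' → False := by
    intro p p' h h' hpp
    obtain ⟨b, hb⟩ := Ed.exists sz (ne_of_ori_pos hpp) h.hp
    have k1 := hb.next p' h'.hp hpp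
    have pos := h.ed.pos
    have hq1 := h.h1
    have hq2 := h.h2
    have hq3 := h'.h1
    have hq4 := h'.h2
    have hbp := hb.pos
    have gp1 := ori_gp e z q p b p'
    have gp2 := ori_gp e z p b p' q'
    have k1' : ori e z b p' = - ori e z p' b := by unfold ori; ring
    have wq : 0 < ori e z q b := by
      by_contra hn
      nlinarith [mul_pos hbp hq3, mul_nonneg (neg_nonneg.2 k1) hq1.le, mul_nonneg (neg_nonneg.2 (not_lt.1 hn)) hpp.le]
    have wq' : 0 < ori e z b q' := by
      by_contra hn
      nlinarith [mul_pos hbp hq4, mul_nonneg (neg_nonneg.2 k1) hq2.le, mul_nonneg (neg_nonneg.2 (not_lt.1 hn)) hpp.le]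
    have wb : Win P e z i b q q' := ⟨hb.hb, h.ed, wq, wq'⟩
    have hqe := hb.qe_strip hz h.ed (rotP (h.beyond hz)) (rotP (wb.beyond hz))
    exact hP.wedge hqe.rot hzP (rotP wq') (rotP' h.ed.pos) (rotP' (rotP' (rotP' hq1)))
  rcases lt_trichotomy (ori e z p p') 0 with k | k | k
  · exact (main p' p h' h (by rw [ori_swap']; linarith)).elim
  · exact bd_ray_unique sz h.hp h'.hp (ray_of_ori_eq_zero k h.h2 h'.h2)
  · exact (main p p' h h' k).elim

end

/-! ### Alignments on rays from the centre -/

section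

variable {P : Finset (ℝ × ℝ)} {e : ℝ} {i k : ℕ} {z p p' q q' d x c x' c' y : ℝ × ℝ}

/-- The angle between `d q` and `d p`, restricted to the side of `q q'` containing `d`, is part of
the empty quadrilateral. -/
theorem QE.near_corner {r : ℝ × ℝ} (h : QE P e p q' d q) (h1 : 0 < ori e q q' d)
    (h2 : ori e q q' p < 0) (hr : r ∈ P) (h3 : 0 < ori e q q' r) (h4 : ori e d r q ≤ 0)
    (h5 : 0 < ori e d r p) : r = p ∨ r = q' ∨ r = d ∨ r = q := by
  have dqp := h.cda
  have b := ori_bary e d q p q q' r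
  simp only [ori_mid, mul_zero, add_zero] at b
  have h4 : 0 ≤ ori e d q r := by rw [ori_swap']; linarith
  have h6 : 0 ≤ ori e q p r := by
    by_contra hn
    nlinarith [mul_pos dqp h3, mul_nonneg h4 (neg_pos.2 h2).le, mul_pos (neg_pos.2 (not_le.1 hn)) h1]
  have h5' : 0 ≤ ori e p d r := rotN' h5.le
  refine h.empty r hr (tri_nonneg dqp h4 h6 h5' h.abc.le ?_ (by simp)) (tri_nonneg dqp h4 h6 h5' (by simp) ?_ ?_) h4 h6
  · exact rotN h.dab.le
  · exact h.bcd.le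
  · exact rotN h.abc.le

theorem not_bd_of_lay {j : ℕ} {a : ℝ × ℝ} (hij : i < j) (ha : a ∈ lay P j) : a ∉ bd (lay P i) :=
  not_bd_of_surr (surr_of_lay hij ha)

/-- The apex over a point of layer `i` lies in layer `i + 2`. -/
theorem Win.apex_bd (hP : NoPent P) (hz : z ∈ lay P (i + 3)) (h : Win P e z i p q q')
    (hd : IsD P e p q q' d) : d ∈ bd (lay P (i + 2)) := by
  have sz1 : Surr (lay P (i + 1)) z := surr_of_lay (by omega) hz
  have hd2 := h.apex_mem (lay_anti P (by omega) hz) sz1 hd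
  by_contra hdb
  have hd3 : d ∈ lay P (i + 3) := Finset.mem_sdiff.2 ⟨hd2, hdb⟩
  have sd2 : Surr (lay P (i + 2)) d := surr_of_lay (by omega) hd3
  have sd1 : Surr (lay P (i + 1)) d := surr_of_lay (by omega) hd3
  have he := ne_of_ori_pos h.h1
  have dqp := hd.qe.cda
  have dpq' : 0 < ori e d p q' := rotP' hd.qe.abc
  have hpb : ori e q q' p < 0 := by
    have := h.beyond sz1
    unfold ori at *; linarith
  have hpd : p ≠ d := by rintro rfl; simp at dqp
  have vert : ∀ r ∈ bd (lay P (i + 2)), r ≠ d → ¬ (r = p ∨ r = q' ∨ r = d ∨ r = q) := by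
    intro r hr hrd
    have hr2 := mem_of_bd hr
    rintro (rfl | rfl | rfl | rfl)
    · exact not_bd_of_lay (by omega) hr2 h.hp
    · exact not_bd_of_lay (by omega) hr2 h.ed.hb
    · exact hrd rfl
    · exact not_bd_of_lay (by omega) hr2 h.ed.ha
  have line : ∀ r ∈ bd (lay P (i + 2)), 0 < ori e q q' r := fun r hr =>
    h.ed.ori_pos sz1 (surr_of_lay_succ (mem_of_bd hr))
  -- If `d` were deeper, it could serve as a centre itself. In direction `p` there is then a point
  -- of layer `i + 2`, which emptiness excludes, or a window of that layer.
  rcases ray_or_window sd2 he hpd with ⟨r, hr, s, hs, hrs⟩ | ⟨r, r', hrr, hrp, hpr⟩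
  · have hl := line r hr
    have hlin : ori e q q' r = (1 - s) * ori e q q' d + s * ori e q q' p := by
      rw [hrs]; unfold ori; simp only; ring
    have hs1 : s < 1 := by
      by_contra hn
      nlinarith [hd.h3]
    have lin : ∀ a b, ori e a b r = (1 - s) * ori e a b d + s * ori e a b p := by
      intro a b; rw [hrs]; unfold ori; simp only; ring
    refine vert r hr ?_ (hd.qe.empty r (lay_subset P _ (mem_of_bd hr)) ?_ ?_ ?_ ?_)
    · intro h0
      have := lin q p
      rw [h0] at this
      simp only [ori_right] at this
      have h5 := rotP dqp
      nlinarith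
    · rw [lin]; simp only [ori_mid, mul_zero, add_zero]
      exact mul_nonneg (by linarith) hd.h1.le
    · rw [lin]; simp only [ori_right, mul_zero, zero_add]
      exact mul_nonneg hs.le (rotP' dpq').le
    · rw [lin]; simp only [ori_mid, mul_zero, zero_add]
      exact mul_nonneg hs.le dqp.le
    · rw [lin]; simp only [ori_right, mul_zero, add_zero]
      exact mul_nonneg (by linarith) (rotP dqp).le
  · have ne1 : r ≠ d := by rintro rfl; simp at hrp
    have ne2 : r' ≠ d := by rintro rfl; simp at hpr
    have hrP := lay_subset P _ (mem_of_bd hrr.ha)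
    have hrP' := lay_subset P _ (mem_of_bd hrr.hb)
    rcases le_or_gt (ori e d r q) 0 with k1 | k1
    · exact vert r hrr.ha ne1 (hd.qe.near_corner hd.h3 hpb hrP (line r hrr.ha) k1 hrp)
    rcases le_or_gt (ori e d q' r') 0 with k2 | k2
    · have := hd.mirror.qe.near_corner hd.mirror.h3 (by unfold ori at *; linarith) hrP'
        (by have := line r' hrr.hb; unfold ori at *; linarith) (by unfold ori at *; linarith)
        (by unfold ori at *; linarith)
      exact vert r' hrr.hb ne2 (by tauto)
    have hrr' := hrr.pos
    have g1 := ori_gp e d r q p r'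
    have g2 := ori_gp e d r p q' r'
    have k3 : 0 < ori e d q r' := by
      by_contra hn
      nlinarith [mul_pos k1 hpr, mul_pos hrr' dqp, mul_nonneg (neg_nonneg.2 (not_lt.1 hn)) hrp.le]
    have k4 : 0 < ori e d r q' := by
      by_contra hn
      nlinarith [mul_pos hrp k2, mul_pos hrr' dpq', mul_nonneg (neg_nonneg.2 (not_lt.1 hn)) hpr.le]
    -- With `d` as the centre, `q` and `q'` would be two points of layer `i + 1` in one window of
    -- layer `i + 2`.
    have := Win.unique hP (i := i + 1) hd.qe.hc sd2 ⟨h.ed.ha, hrr, k1, k3⟩ ⟨h.ed.hb, hrr, k4, k2⟩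
    have hpos := h.ed.pos
    rw [this] at hpos
    simp at hpos

theorem Ray.beyond (hz : Surr (lay P k) z) (hx : x ∈ bd (lay P k)) (hx' : x' ∈ lay P (k + 1))
    (h : Ray z x x') : ∃ s : ℝ, 0 < s ∧ s < 1 ∧ x' = (z.1 + s * (x.1 - z.1), z.2 + s * (x.2 - z.2)) := by
  obtain ⟨s, hs, hxs⟩ := h
  refine ⟨s, hs, ?_, hxs⟩
  by_contra hn
  push Not at hn
  obtain ⟨v, hv, hsu⟩ := exists_support hx
  have h1 := hsu z hz
  have h2 := hsu x' (surr_of_lay_succ hx')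
  have : dt v x x' = (1 - s) * dt v x z := by
    rw [hxs]; unfold dt; simp only; ring
  rw [this] at h2
  nlinarith

/-- If consecutive points of layer `k` lie in a window of layer `k + 1` closed on the left, then
layer `k + 2` avoids this window. -/
theorem strip_far (hP : NoPent P) (hz : z ∈ lay P (k + 2)) (h : Ed (lay P k) e z x c)
    (h' : Ed (lay P (k + 1)) e z x' c') (hr : Ray z x x') (h1 : 0 < ori e z x' c)
    (h2 : 0 < ori e z c c') {u : ℝ × ℝ} (hu : u ∈ lay P (k + 2)) (hxu : 0 < ori e z x' u) :
    0 < ori e z c' u := by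
  have sz : Surr (lay P (k + 1)) z := surr_of_lay (by omega) hz
  have su : Surr (lay P (k + 1)) u := surr_of_lay (by omega) hu
  obtain ⟨s, hs, hs1, hxs⟩ := hr.beyond (sz.mono (lay_succ_subset P k)) h.ha (mem_of_bd h'.ha)
  by_contra hn
  push Not at hn
  have pos := h'.pos
  have posx := h.pos
  have b1 : 0 < ori e c' x' x := by
    have e1 : ori e z x c' * s = ori e z x' c' := by rw [hxs]; unfold ori; simp only; ring
    have e2 : ori e c' x' x = (1 - s) * ori e z x c' := by rw [hxs]; unfold ori; simp only; ring
    rw [e2]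
    have : 0 < ori e z x c' := pos_of_mul_pos_left (e1 ▸ pos) hs.le
    exact mul_pos (by linarith) this
  have b2 := bd_beyond sz h.hb (mem_of_bd h'.ha) (mem_of_bd h'.hb) h1 h2
  have hqe := h.qe_strip sz h' b1 (by unfold ori at *; linarith)
  have w1 := h'.ori_pos sz su
  have hxxu : 0 < ori e x' x u := by
    have e1 : s * ori e x' x u = (1 - s) * ori e z x' u := by
      rw [hxs]; unfold ori; simp only; ring
    have : 0 < s * ori e x' x u := by rw [e1]; exact mul_pos (by linarith) hxu
    exact pos_of_mul_pos_right this hs.le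
  have bar := ori_bary e z x' c' c c' u
  simp only [ori_right, mul_zero, add_zero] at bar
  have hcz : 0 < ori e c c' z := rotP h2
  have hcx : 0 < ori e c c' x' := hqe.cda
  have hzc : 0 ≤ ori e c' z u := by unfold ori at *; linarith
  have : 0 < ori e z x' c' * ori e c c' u := by
    rw [bar]
    nlinarith [mul_pos w1 hcz, mul_nonneg hzc hcx.le]
  have w2 : 0 < ori e c c' u := pos_of_mul_pos_right this pos.le
  -- The strip quadrilateral `x' x c c'` is empty, and `u` is in its wedge beyond `x' c'`.
  refine hP.wedge hqe.rot (lay_subset P _ hu) w2 (rotP w1) (rotP' hxxu)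

/-- On the ray through `x` in layer `k`, all points of layers beyond `k` to the left of the ray
are strictly beyond `y`, which is beyond the neighbour `c` of `x`. -/
structure Sig (P : Finset (ℝ × ℝ)) (e : ℝ) (z : ℝ × ℝ) (k : ℕ) (x c y : ℝ × ℝ) : Prop where
  ed : Ed (lay P k) e z x c
  hy : 0 < ori e z x y
  hcy : 0 ≤ ori e z c y
  far : ∀ u ∈ lay P (k + 1), 0 < ori e z x u → 0 < ori e z y u

/-- If no point of the next layer were on the ray of `x`, the window around this ray would end
beyond `y`. It would then contain both `x` and `c`, against `Win.unique`. Once the ray is met,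
`strip_far` restores the barrier. -/
theorem Sig.step (hP : NoPent P) (hz : z ∈ lay P (k + 2)) (h : Sig P e z k x c y) :
    ∃ x' c', Ray z x x' ∧ Sig P e z (k + 1) x' c' c' := by
  have sz : Surr (lay P (k + 1)) z := surr_of_lay (by omega) hz
  have sz0 : Surr (lay P k) z := surr_of_lay (by omega) hz
  have he := ne_of_ori_pos h.ed.pos
  have hxz : x ≠ z := by rintro rfl; exact not_bd_of_surr sz0 h.ed.ha
  have xc := h.ed.pos
  have xy := h.hy
  have cy := h.hcy
  have win : ∀ w' ∈ lay P (k + 1), 0 < ori e z x w' → 0 < ori e z c w' := by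
    intro w' hw' hxw
    have yw := h.far w' hw' hxw
    have g1 := ori_gp e z x c y w'
    by_contra hn
    nlinarith [mul_pos xc yw, mul_nonneg hxw.le cy, mul_nonneg (neg_nonneg.2 (not_lt.1 hn)) xy.le]
  rcases ray_or_window sz he hxz with ⟨x', hx', hr⟩ | ⟨w, w', hww, wx, xw⟩
  · obtain ⟨c', hc'⟩ := Ed.exists sz he hx'
    have hxc' : 0 < ori e z x c' := hr.symm.pos hc'.pos
    have cc := win c' (mem_of_bd hc'.hb) hxc'
    exact ⟨x', c', hr, hc', hc'.pos, by simp, fun u hu hxu =>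
      strip_far hP hz h.ed hc' hr (hr.pos xc) cc hu hxu⟩
  · exfalso
    have cw := win w' (mem_of_bd hww.hb) xw
    have g2 := ori_gp e z w x c w'
    have wp := hww.pos
    have wc : 0 < ori e z w c := by
      by_contra hn
      nlinarith [mul_pos wx cw, mul_pos wp xc, mul_nonneg (neg_nonneg.2 (not_lt.1 hn)) xw.le]
    have := Win.unique hP (lay_subset P _ hz) sz ⟨h.ed.ha, hww, wx, xw⟩ ⟨h.ed.hb, hww, wc, cw⟩
    rw [this] at xc; simp at xc

/-- `P` has at most `M` points on a line. -/
def ColBound (P : Finset (ℝ × ℝ)) (M : ℕ) : Prop :=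
  ∀ S ⊆ P, (∀ a ∈ S, ∀ b ∈ S, ∀ c ∈ S, ori 1 a b c = 0) → S.card ≤ M

theorem ori_of_ray {a b c : ℝ × ℝ} (ha : Ray z x a) (hb : Ray z x b) (hc : Ray z x c) :
    ori 1 a b c = 0 := by
  obtain ⟨s, -, rfl⟩ := ha
  obtain ⟨t, -, rfl⟩ := hb
  obtain ⟨u, -, rfl⟩ := hc
  unfold ori; simp only; ring

theorem card_le_of_ray {M : ℕ} (hM : ColBound P M) {ι : Type*} (s : Finset ι) (f : ι → ℝ × ℝ)
    (hf : Set.InjOn f s) (hmem : ∀ j ∈ s, f j ∈ P ∧ Ray z x (f j)) : s.card ≤ M := by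
  rw [← Finset.card_image_of_injOn hf]
  refine hM _ ?_ ?_
  · intro a ha
    obtain ⟨j, hj, rfl⟩ := Finset.mem_image.1 ha
    exact (hmem j hj).1
  · intro a ha b hb c hc
    obtain ⟨j, hj, rfl⟩ := Finset.mem_image.1 ha
    obtain ⟨j', hj', rfl⟩ := Finset.mem_image.1 hb
    obtain ⟨j'', hj'', rfl⟩ := Finset.mem_image.1 hc
    exact ori_of_ray (hmem j hj).2 (hmem j' hj').2 (hmem j'' hj'').2

theorem Sig.persist (hP : NoPent P) {r : ℕ} (hz : z ∈ lay P r) (h : Sig P e z k x c y) (j : ℕ)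
    (hj : k + j < r) : ∃ x' c' y', Ray z x x' ∧ Sig P e z (k + j) x' c' y' := by
  induction j with
  | zero => exact ⟨x, c, y, Ray.refl z x, h⟩
  | succ j ih =>
    obtain ⟨x', c', y', hr, hs⟩ := ih (by omega)
    obtain ⟨x2, c2, hr2, hs2⟩ := hs.step hP (lay_anti P (by omega) hz)
    exact ⟨x2, c2, c2, hr.trans hr2, hs2⟩

theorem bd_lay_inj {j j' : ℕ} {a : ℝ × ℝ} (h : a ∈ bd (lay P j)) (h' : a ∈ bd (lay P j')) :
    j = j' := by
  rcases lt_trichotomy j j' with k | k | k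
  · exact (not_bd_of_lay k (mem_of_bd h') h).elim
  · exact k
  · exact (not_bd_of_lay k (mem_of_bd h) h').elim

/-- Each of the layers `k, …, r - 1` has a point on the ray of `x`, and these points are distinct
and collinear. -/
theorem Sig.depth (hP : NoPent P) {r M : ℕ} (hM : ColBound P M) (hz : z ∈ lay P r)
    (h : Sig P e z k x c y) : r ≤ k + M := by
  have := fun j : Fin (r - k) => h.persist hP hz j (by omega)
  choose f c' y' hr hs using this
  have := card_le_of_ray hM Finset.univ f (fun a _ b _ hab => by
    have h1 := (hs a).ed.ha
    have h2 := (hs b).ed.ha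
    rw [hab] at h1
    have := bd_lay_inj h1 h2
    ext; omega) (fun j _ => ⟨bd_lay_subset (hs j).ed.ha, hr j⟩)
  simp at this
  omega

/-- `p` in layer `i` and `c` in layer `i + 1` are on one ray and the window of layer `i + 1` to the
left of `c` contains the point `p'` of layer `i`. -/
structure FilledZero (P : Finset (ℝ × ℝ)) (e : ℝ) (z : ℝ × ℝ) (i : ℕ) (p c c' p' : ℝ × ℝ) :
    Prop where
  hp : p ∈ bd (lay P i)
  ray : Ray z p c
  win : Win P e z i p' c c'

/-- The successor of `p` on layer `i` is in the same window as `p'`, and a window contains only one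
point. -/
theorem FilledZero.ed (hP : NoPent P) (hz : z ∈ lay P (i + 2)) (h : FilledZero P e z i p c c' p') :
    Ed (lay P i) e z p p' := by
  have sz : Surr (lay P (i + 1)) z := surr_of_lay (by omega) hz
  have sz0 : Surr (lay P i) z := surr_of_lay (by omega) hz
  have he := ne_of_ori_pos h.win.h1
  obtain ⟨b, hb⟩ := Ed.exists sz0 he h.hp
  have pp' : 0 < ori e z p p' := h.ray.symm.pos h.win.h1
  have bp := hb.next p' h.win.hp pp'
  have pb := hb.pos
  have p'c := h.win.h2
  have pc : 0 < ori e z p c' := h.ray.symm.pos h.win.ed.pos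
  have g := ori_gp e z p b p' c'
  have bc : 0 < ori e z b c' := by
    have : ori e z b p' = - ori e z p' b := ori_swap' ..
    by_contra hn
    nlinarith [mul_pos pb p'c, mul_nonneg pc.le (neg_nonneg.2 bp), mul_nonneg (neg_nonneg.2 (not_lt.1 hn)) pp'.le]
  have := Win.unique hP (lay_subset P _ hz) sz ⟨hb.hb, h.win.ed, h.ray.pos pb, bc⟩ h.win
  exact this ▸ hb

theorem FilledZero.sig (hP : NoPent P) (hz : z ∈ lay P (i + 2))
    (h : FilledZero P e z i p c c' p') : Sig P e z (i + 1) c c' c' :=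
  ⟨h.win.ed, h.win.ed.pos, by simp, fun _ hu hcu =>
    strip_far hP hz (h.ed hP hz) h.win.ed h.ray h.win.h1 h.win.h2 hu hcu⟩

/-- A filled zero starts a `Sig` one layer deeper, so it can occur only close to the last layer. -/
theorem FilledZero.depth (hP : NoPent P) {r M : ℕ} (hM : ColBound P M) (hz : z ∈ lay P r)
    (hi : i + 2 ≤ r) (h : FilledZero P e z i p c c' p') : r ≤ i + 1 + M :=
  (h.sig hP (lay_anti P hi hz)).depth hP hM hz

end

/-! ### Straightness at regular points -/

section

variable {P : Finset (ℝ × ℝ)} {e : ℝ} {i j k r M : ℕ}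
  {z p p' q q' d x c x' c' y a u h s W E q'' w w' : ℝ × ℝ}

theorem QE.te (h : QE P e p q d w) : TE P e p q d := by
  refine ⟨h.ha, h.hb, h.hc, h.abc, fun x hx h1 h2 h3 => ?_⟩
  have cda := h.cda
  have dab := h.dab
  have bcd := h.bcd
  have k1 : 0 ≤ ori e d w x := tri_nonneg h.abc h1 h2 h3 cda.le (rotN bcd.le) (by simp)
  have k2 : 0 ≤ ori e w p x := tri_nonneg h.abc h1 h2 h3 (by simp) dab.le (rotN cda.le)
  rcases h.empty x hx h1 h2 k1 k2 with hh | hh | hh | hh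
  · tauto
  · tauto
  · tauto
  · subst hh
    unfold ori at *; linarith

theorem tri_pos {e : ℝ} {a b c u v x : ℝ × ℝ} (h : 0 < ori e a b c) (h1 : 0 < ori e a b x)
    (h2 : 0 ≤ ori e b c x) (h3 : 0 ≤ ori e c a x) (ha : 0 ≤ ori e u v a) (hb : 0 ≤ ori e u v b)
    (hc : 0 < ori e u v c) : 0 < ori e u v x := by
  have := ori_bary e a b c u v x
  have h3 : 0 < ori e a b c * ori e u v x := by rw [this]; positivity
  exact pos_of_mul_pos_right h3 h.le

/-- Points of layer `i + 2` in the closed window are in the cone defining the apex. -/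
theorem Win.far (hz : Surr (lay P (i + 1)) z) (hw : Win P e z i a x c) (ha : IsD P e a x c s)
    (hu : u ∈ lay P (i + 2)) (h1 : 0 ≤ ori e z x u) (h2 : 0 ≤ ori e z u c) :
    0 ≤ ori e x s u ∧ 0 ≤ ori e s c u := by
  have b := hw.beyond hz
  have pos := hw.ed.pos
  have w1 := hw.h1
  have w2 := hw.h2
  have eu := hw.ed.ori_pos hz (surr_of_lay_succ hu)
  refine ha.far u (lay_subset P _ hu) ?_ ?_ eu
  · exact tri_pos (rotP pos) eu (rotN' h2) h1 b.le (by simp) (rotP w2)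
  · refine rotP (tri_pos (rotP pos) eu (rotN' h2) h1 (by simp) (rotN' b.le) ?_)
    exact rotP w1

/-- The opposite cone at `s` contains the deeper points of the closed window. With `s` on the ray of
`x` this cone has no point strictly to the left of the ray inside the window. -/
theorem sig_of_apex_ray (hz : z ∈ lay P (i + 2)) (hw : Win P e z i a x c) (ha : IsD P e a x c s)
    (hs : s ∈ lay P (i + 2)) (hr : Ray z x s) : Sig P e z (i + 1) x c c := by
  have sz : Surr (lay P (i + 1)) z := surr_of_lay (by omega) hz
  refine ⟨hw.ed, hw.ed.pos, by simp, fun u hu hxu => ?_⟩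
  by_contra hn
  have := (hw.far sz ha hu hxu.le (by rw [ori_swap']; linarith)).1
  obtain ⟨t, ht, ht1, hst⟩ := hr.beyond sz hw.ed.ha hs
  have e1 : ori e x s u = - (1 - t) * ori e z x u := by
    rw [hst]; unfold ori; simp only; ring
  rw [e1] at this
  nlinarith

/-- A later point `q''` that still precedes `c'` would be a second point in the window `d c'`. -/
theorem Ed.no_skip (hP : NoPent P) (hz : z ∈ lay P (i + 2)) (hw : Win P e z i q' d c')
    (hq : q'' ∈ bd (lay P i)) (hqq : 0 < ori e z q' q'') : ori e z q'' c' ≤ 0 := by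
  by_contra hn
  have sz : Surr (lay P (i + 1)) z := surr_of_lay (by omega) hz
  have g := ori_gp e z d q' q'' c'
  have w1 := hw.h1
  have w2 := hw.h2
  have pos := hw.ed.pos
  have : 0 < ori e z d q'' := by
    by_contra hn'
    nlinarith [mul_pos w1 (not_le.1 hn), mul_pos pos hqq, mul_nonneg (neg_nonneg.2 (not_lt.1 hn')) w2.le]
  have := Win.unique hP (lay_subset P _ hz) sz hw ⟨hq, hw.ed, this, by linarith⟩
  rw [this] at hqq
  simp at hqq

/-- The path from `p` through `q'` to `c'` cannot turn the wrong way. The apex `t` over the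
neighbour `p'` is not on the wrong side of `p q'`, and `c'` lies in the opposite cone at `t`. -/
theorem Win.turn (hP : NoPent P) (hz : z ∈ lay P (i + 3)) (h : Ed (lay P i) e z p p')
    (hw : Win P e z i p q q') (hw' : Win P e z i p' q' q'') (hd : Win P e z (i + 1) q' d c') :
    0 ≤ ori e p q' c' := by
  have sz1 : Surr (lay P (i + 1)) z := surr_of_lay (by omega) hz
  have sz : Surr (lay P i) z := surr_of_lay (by omega) hz
  have hc' : c' ∈ lay P (i + 2) := mem_of_bd hd.ed.hb
  obtain ⟨t, ht⟩ := hw'.exists_apex hP (lay_subset P _ hz) sz1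
  have k1 := hw'.ed.pos
  have k2 := hd.h2
  have hs := Ed.no_skip hP hz hd hw'.ed.hb k1
  have cen := hw'.center (lay_subset P _ hz) ht
  have b := hw'.beyond sz1
  have e1 := hw'.ed.ori_pos sz1 (surr_of_lay_succ hc')
  have far := (hw'.far sz1 ht hc' k2.le (by rw [ori_swap']; linarith)).1
  -- Otherwise `p` is in the wedge of the empty quadrilateral `p' q'' t q'` beyond the edge `q' p'`.
  have pt : 0 ≤ ori e p q' t := by
    by_contra hn
    refine hP.wedge ht.qe.rot (bd_lay_subset h.ha) ?_ ?_ ?_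
    · unfold ori at *; linarith
    · exact rotP' (h.ori_pos sz (surr_of_lay_succ (mem_of_bd hw.ed.hb)))
    · exact h.ori_pos sz (surr_of_lay_succ (mem_of_bd hw'.ed.hb))
  have g1 := ori_gp e q' t c' z p
  have g2 := ori_gp e q' q'' t c' z
  have zp : 0 < ori e q' z p := rotP' hw.h2
  have tz : 0 ≤ ori e q' t z := rotN cen.1
  have cz : 0 < ori e q' c' z := rotP k2
  have tp : 0 ≤ ori e q' t p := rotN pt
  have q''t : 0 < ori e q' q'' t := ht.h3
  have q''z : 0 < ori e q' q'' z := rotP k1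
  refine rotN' ?_
  rcases tz.lt_or_eq with l | l
  · by_contra hn
    nlinarith [mul_nonneg far zp.le, mul_nonneg tp cz.le, mul_pos l (neg_pos.2 (not_le.1 hn))]
  · rw [← l] at g1 g2
    nlinarith [mul_nonneg far zp.le, mul_nonneg tp cz.le, mul_pos q''t cz, mul_nonneg q''z.le far]

theorem ray_of_window {u : ℝ × ℝ} (h1 : 0 < ori e z q q') (h2 : 0 < ori e z q p)
    (h3 : 0 < ori e z p q') (h0 : ori e z p u = 0) (k1 : 0 ≤ ori e z q u) (k2 : 0 ≤ ori e z u q')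
    (hu : u ≠ z) : Ray z p u := by
  have hlt : 0 < ori e z u q' := by
    refine k2.lt_of_ne fun hn => hu ?_
    refine eq_of_ori_eq_zero (e := e) (a := z) (b := p) (c := q') h3.ne' h0 ?_
    rw [ori_swap']; linarith
  exact ray_of_ori_eq_zero h0 h3 hlt

/-- With `d` the apex over `p` and `s` the apex over the next point `q'`. -/
theorem apex_side (hz : z ∈ lay P (i + 2)) (hd : IsD P e p q q' d) (hw : Win P e z (i + 1) q' d c')
    (hs : IsD P e q' d c' s) (h : ori e p d z ≤ 0) :
    ori e p d s < 0 ∨ (ori e p d s = 0 ∧ ori e z d s = 0) := by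
  have cen := hw.center (lay_subset P _ hz) hs
  have pq' : 0 < ori e d p q' := rotP' hd.h1
  have sz' : 0 ≤ ori e d s z := rotN cen.1
  have pz : 0 ≤ ori e d p z := by rw [ori_swap]; linarith
  have q's : 0 < ori e d q' s := rotP' hs.h2
  have q'z : 0 < ori e d q' z := rotP hw.h1
  have g := ori_gp e d p q' s z
  have e1 : ori e p d s = - ori e d p s := ori_swap ..
  have e2 : ori e z d s = ori e d s z := (ori_rot ..).symm
  rw [e1, e2]
  have : 0 ≤ ori e d p s := by
    by_contra hn
    nlinarith [mul_nonneg pq'.le sz', mul_nonneg pz q's.le, mul_pos (neg_pos.2 (not_le.1 hn)) q'z]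
  rcases this.lt_or_eq with l | l
  · left; linarith
  · right
    refine ⟨by linarith, ?_⟩
    rw [← l] at g
    nlinarith [mul_nonneg pq'.le sz', mul_nonneg pz q's.le]

/-- An apex on the ray of `d` would start a `Sig`, for which too many layers remain. -/
theorem apex_side_strict (hP : NoPent P) (hM : ColBound P M) (hz : z ∈ lay P r)
    (hi : i + M + 6 ≤ r) (hd : IsD P e p q q' d)
    (hw : Win P e z (i + 1) q' d c') (hs : IsD P e q' d c' s) : 0 < ori e z d s := by
  have hzP := lay_subset P _ hz
  have cen := hw.center hzP hs
  refine cen.1.lt_of_ne fun h0 => ?_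
  have sz : s ∈ bd (lay P (i + 3)) := hw.apex_bd hP (lay_anti P (by omega) hz) hs
  have hsz : s ≠ z := by
    rintro rfl; exact not_bd_of_lay (by omega : i + 3 < r) hz sz
  have hray : Ray z d s := by
    have hlt : 0 < ori e z s c' := by
      refine cen.2.lt_of_ne fun hn => hsz ?_
      refine eq_of_ori_eq_zero (e := e) (a := z) (b := d) (c := c') hw.ed.pos.ne' h0.symm ?_
      rw [ori_swap']; linarith
    exact ray_of_ori_eq_zero h0.symm hw.ed.pos hlt
  have := (sig_of_apex_ray (lay_anti P (by omega) hz) hw hs (mem_of_bd sz) hray).depth hP hM hz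
  omega

theorem apex_side_lt (hP : NoPent P) (hM : ColBound P M) (hz : z ∈ lay P r)
    (hi : i + M + 6 ≤ r) (hd : IsD P e p q q' d) (hw : Win P e z (i + 1) q' d c')
    (hs : IsD P e q' d c' s) (h : ori e p d z ≤ 0) : ori e p d s < 0 := by
  rcases apex_side (lay_anti P (by omega) hz) hd hw hs h with h | h
  · exact h
  · linarith [apex_side_strict hP hM hz hi hd hw hs]

/-- The data of a point `p` of layer `i` whose right neighbours are regular: `q, q'` is its window,
`d` its apex, `p'` the next point of the layer with window `q', q''`, the window of `q'` is
`d, c'` and `s` is the apex over `q'`. -/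
structure Clean (P : Finset (ℝ × ℝ)) (e : ℝ) (z : ℝ × ℝ) (i : ℕ)
    (p q q' d p' q'' c' s : ℝ × ℝ) : Prop where
  win : Win P e z i p q q'
  ap : IsD P e p q q' d
  ed : Ed (lay P i) e z p p'
  win' : Win P e z i p' q' q''
  winR : Win P e z (i + 1) q' d c'
  apR : IsD P e q' d c' s

/-- By `Win.turn` the only alternative is a strict turn at `q'`. Then the empty triangles `q' c' d`
and `q' d p` combine into an empty convex quadrilateral, and the apex `s` lies in its wedge beyond
`c' d`. -/
theorem Clean.collinear (hP : NoPent P) (hM : ColBound P M) (hz : z ∈ lay P r)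
    (hi : i + M + 6 ≤ r) (h : Clean P e z i p q q' d p' q'' c' s) (hs : ori e p d z ≤ 0) :
    ori e p q' c' = 0 := by
  have sz2 : Surr (lay P (i + 2)) z := surr_of_lay (by omega) hz
  have t := Win.turn hP (lay_anti P (by omega) hz) h.ed h.win h.win' h.winR
  refine (t.lt_or_eq.resolve_left fun t => ?_).symm
  have lt := apex_side_lt hP hM hz hi h.ap h.winR h.apR hs
  have te2 := h.winR.te sz2
  have te1 := h.ap.qe.te
  have k1 : 0 < ori e d p c' := by
    have pq' : 0 < ori e d p q' := rotP' h.ap.h1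
    have cz : 0 < ori e d c' z := rotP h.winR.ed.pos
    have q'z : 0 < ori e d q' z := rotP h.winR.h1
    have pz : 0 ≤ ori e d p z := by rw [ori_swap]; linarith
    have q'c : 0 < ori e d q' c' := rotP' te2.abc
    have g := ori_gp e d p q' c' z
    by_contra hn
    nlinarith [mul_pos pq' cz, mul_nonneg pz q'c.le, mul_nonneg (neg_nonneg.2 (not_lt.1 hn)) q'z.le]
  have hqe : QE P e q' c' d p := QE.of_TE te2 te1.rot (rotP' k1) t
  refine hP.wedge hqe.rot.rot.rot h.apR.qe.hc h.apR.h1 (rotP h.apR.h3) ?_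
  unfold ori at *; linarith

/-- The triangles `q' s d` and `q' d p` are halves of apex quadrilaterals, hence empty. Collinearity
of `p`, `q'`, `c'` gives convexity at `q'`, and `apex_side_lt` gives it at `d`. -/
theorem Clean.qe (hP : NoPent P) (hM : ColBound P M) (hz : z ∈ lay P r)
    (hi : i + M + 6 ≤ r) (h : Clean P e z i p q q' d p' q'' c' s) (hs : ori e p d z ≤ 0) :
    QE P e p q' s d := by
  have sz2 : Surr (lay P (i + 2)) z := surr_of_lay (by omega) hz
  have lt := apex_side_lt hP hM hz hi h.ap h.winR h.apR hs
  have col := h.collinear hP hM hz hi hs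
  have g := ori_gp e q' p s d c'
  have e1 : ori e q' p c' = 0 := by rw [ori_swap, col, neg_zero]
  rw [e1] at g
  have dc : 0 < ori e q' c' d := (h.winR.te sz2).abc
  have e2 : ori e q' d c' = - ori e q' c' d := ori_swap' ..
  have sc : 0 < ori e q' c' s := h.apR.h1
  have e3 : ori e q' s c' = - ori e q' c' s := ori_swap' ..
  have pd : 0 < ori e q' d p := rotP h.ap.h1
  have e4 : ori e q' p d = - ori e q' d p := ori_swap' ..
  rw [e2, e3, e4] at g
  have k1 : 0 < ori e p q' s := by
    have e5 : ori e p q' s = - ori e q' p s := by unfold ori; ring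
    rw [e5]
    by_contra hn
    nlinarith [mul_pos pd sc, mul_nonneg (neg_nonneg.2 (not_lt.1 hn)) dc.le]
  refine QE.of_TE (a := q') (b := s) (c := d) (d := p) h.apR.qe.rot.rot.te.rot.rot ?_ ?_ k1 |>.rot.rot.rot
  · exact h.ap.qe.te.rot
  · unfold ori at *; linarith

/-- The condition on `p` is inherited by `q'`: otherwise `z` would be in the wedge of the empty
quadrilateral `p q' s d` beyond `s d`. -/
theorem Clean.sign (hP : NoPent P) (hM : ColBound P M) (hz : z ∈ lay P r)
    (hi : i + M + 6 ≤ r) (h : Clean P e z i p q q' d p' q'' c' s) (hs : ori e p d z < 0) :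
    ori e q' s z ≤ 0 := by
  by_contra hn
  have := apex_side_strict hP hM hz hi h.ap h.winR h.apR
  refine hP.wedge (h.qe hP hM hz hi hs.le) (lay_subset P _ hz) (not_le.1 hn) (rotP (rotP this)) ?_
  unfold ori at *; linarith

end

/-! ### One-sided barriers for apexes in line with the centre -/

section

variable {P : Finset (ℝ × ℝ)} {e : ℝ} {i j k r M : ℕ}
  {z p p' q q' d x c x' c' y a u h s W E q'' w w' δ : ℝ × ℝ}

/-- `x` is a point of layer `j + 1` and the apex `E` over the point of layer `j` in the window to
the left of `x` bounds the deeper layers from that side. -/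
structure Half (P : Finset (ℝ × ℝ)) (e : ℝ) (z : ℝ × ℝ) (j : ℕ) (a x c E : ℝ × ℝ) : Prop where
  win : Win P e z j a x c
  ap : IsD P e a x c E
  far : ∀ u ∈ lay P (j + 2), 0 < ori e z x u → 0 ≤ ori e z E u

def HalfStrict (P : Finset (ℝ × ℝ)) (e : ℝ) (z : ℝ × ℝ) (j : ℕ) (x E : ℝ × ℝ) : Prop :=
  ∀ u ∈ lay P (j + 2), 0 < ori e z x u → u ≠ E → 0 < ori e z E u

/-- When `p`, `d` and `z` are in line, `p q' h d` is an empty quadrilateral. A deeper point between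
the ray of `d` and the ray of `h` would lie in its wedge beyond `h d` or in the empty quadrilateral
of the apex `h`. -/
theorem half_of_ray (hP : NoPent P) (hz : z ∈ lay P (i + 4)) (hx : p ∈ bd (lay P i))
    (te : TE P e p q' d) (hw : Win P e z (i + 1) q' d c') (hh : IsD P e q' d c' h)
    (hr : Ray z p d) (ht : 0 ≤ ori e p q' c') (hdh : 0 < ori e z d h)
    (hs : 0 ≤ ori e q' h z) : Half P e z (i + 1) q' d c' h ∧
      (0 < ori e q' h z → HalfStrict P e z (i + 1) d h) := by
  have sz2 : Surr (lay P (i + 2)) z := surr_of_lay (by omega) hz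
  have sz : Surr (lay P i) z := surr_of_lay (by omega) hz
  have b := hw.beyond sz2
  have posd := hw.ed.pos
  have hd1 : d ∈ lay P (i + 1) := lay_succ_subset P _ (mem_of_bd hw.ed.ha)
  obtain ⟨t, t0, t1, hdt⟩ := hr.beyond sz hx hd1
  have lin : ∀ u, t * ori e d p u = (1 - t) * ori e z d u := by
    intro u; rw [hdt]; unfold ori; simp only; ring
  have dpos : ∀ u, 0 < ori e z d u → 0 < ori e d p u := by
    intro u hu
    have : 0 < t * ori e d p u := by rw [lin]; exact mul_pos (by linarith) hu
    exact pos_of_mul_pos_right this t0.le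
  have hd3 : 0 < ori e d c' h := hh.h3
  have q'hd : 0 < ori e q' h d := hh.h2
  have q'c'h : 0 < ori e q' c' h := hh.h1
  have q'dp : 0 < ori e q' d p := rotP te.abc
  have k1 : 0 < ori e q' h p := by
    have g := ori_gp e q' c' h d p
    have c1 : 0 ≤ ori e q' c' p := rotN ht
    have c2 : ori e q' h d = - ori e q' d h := ori_swap' ..
    by_contra hn
    nlinarith [mul_pos q'c'h q'dp, mul_nonneg (neg_nonneg.2 (not_lt.1 hn)) b.le, mul_nonneg c1 q'hd.le]
  have hdp : 0 < ori e h d p := rotP' (dpos h hdh)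
  have te2 : TE P e q' h d := hh.qe.rot.rot.te.rot.rot
  -- The barrier comes from this quadrilateral: `main` treats points in its wedge, `tri` those on
  -- the other side of `d h`.
  have V : QE P e q' h d p := QE.of_TE te2 te.rot hdp (rotP' k1)
  have cen := hw.center (lay_subset P _ hz) hh
  have main : ∀ u ∈ lay P (i + 3), 0 < ori e z d u → ori e z h u ≤ 0 → u ≠ h →
      0 < ori e d h u → ¬ 0 < ori e q' h u := by
    intro u hu zdu zhu une dhu hn
    exact hP.wedge V.rot.rot.rot (lay_subset P _ hu) hn (rotP' (rotP' dhu)) (rotP' (dpos u zdu))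
  have tri : ∀ u ∈ lay P (i + 3), 0 < ori e z d u → ori e z h u ≤ 0 → ori e d h u ≤ 0 → u = h := by
    intro u hu zdu zhu dhu
    have edc := hw.ed.ori_pos sz2 (surr_of_lay_succ hu)
    have k : 0 ≤ ori e c' h u := by
      have g := ori_gp e h d u z c'
      have a1 : 0 ≤ ori e h d u := by unfold ori at *; linarith
      have a2 : ori e h z c' ≤ 0 := by have := cen.2; unfold ori at *; linarith
      have a3 : 0 < ori e h d c' := rotP' hd3
      have a4 : ori e h u z ≤ 0 := by unfold ori at *; linarith
      have a5 : ori e h d z < 0 := by unfold ori at *; linarith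
      rw [← ori_rot e c' h u]
      by_contra hn
      nlinarith [mul_nonneg a1 (neg_nonneg.2 a2), mul_nonneg a3.le (neg_nonneg.2 a4), mul_pos (neg_pos.2 a5) (neg_pos.2 (not_le.1 hn))]
    have k2 : 0 ≤ ori e h d u := by rw [ori_swap]; linarith
    have := hh.qe.empty u (lay_subset P _ hu)
      (tri_nonneg hd3 edc.le k k2 b.le (by simp) q'c'h.le) k k2
      (tri_nonneg hd3 edc.le k k2 (by simp) (rotN' b.le) (rotN' q'hd.le))
    rcases this with rfl | rfl | rfl | rfl
    · exact (not_bd_of_lay (by omega) hu hw.hp).elim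
    · exact (not_bd_of_lay (by omega) hu hw.ed.hb).elim
    · rfl
    · simp at zdu
  have bar : ∀ u, ori e z d h * ori e q' h u =
      ori e d h u * ori e q' h z - ori e z h u * ori e q' h d := by
    intro u
    have bb := ori_bary e z d h q' h u
    simp only [ori_right, mul_zero, add_zero] at bb
    rw [bb, ori_swap e z h u]; ring
  refine ⟨⟨hw, hh, fun u hu zdu => ?_⟩, fun hs' u hu zdu une => ?_⟩
  · by_contra hn
    have une : u ≠ h := by rintro rfl; simp at hn
    rcases le_or_gt (ori e d h u) 0 with k | k
    · exact une (tri u hu zdu (not_le.1 hn).le k)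
    · refine main u hu zdu (not_le.1 hn).le une k (pos_of_mul_pos_right (b := ori e q' h u) ?_ hdh.le)
      rw [bar]
      nlinarith [mul_nonneg k.le hs, mul_pos (neg_pos.2 (not_le.1 hn)) q'hd]
  · by_contra hn
    have hn := not_lt.1 hn
    rcases le_or_gt (ori e d h u) 0 with k | k
    · exact une (tri u hu zdu hn k)
    · refine main u hu zdu hn une k (pos_of_mul_pos_right (b := ori e q' h u) ?_ hdh.le)
      rw [bar]
      nlinarith [mul_pos k hs', mul_nonneg (neg_nonneg.2 hn) q'hd.le]

theorem FilledZero.false (hP : NoPent P) (hM : ColBound P M) (hz : z ∈ lay P r)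
    (hi : i + M + 2 ≤ r) (hi' : i + 2 ≤ r) (h : FilledZero P e z i p c c' p') : False := by
  have := h.depth hP hM hz (by omega)
  omega

theorem Sig.false (hP : NoPent P) (hM : ColBound P M) (hz : z ∈ lay P r)
    (hi : k + M + 1 ≤ r) (h : Sig P e z k x c y) : False := by
  have := h.depth hP hM hz
  omega

/-- If an apex is on the ray of the left end of its window, then only few layers follow. -/
theorem Win.apex_pos (hP : NoPent P) (hM : ColBound P M) (hz : z ∈ lay P r) (hj : j + M + 4 ≤ r)
    (hw : Win P e z j a x c) (hE : IsD P e a x c E) : 0 < ori e z x E := by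
  have cen := hw.center (lay_subset P _ hz) hE
  refine cen.1.lt_of_ne fun h0 => ?_
  have sz : E ∈ bd (lay P (j + 2)) := hw.apex_bd hP (lay_anti P (by omega) hz) hE
  have hsz : E ≠ z := by
    rintro rfl; exact not_bd_of_lay (by omega : j + 2 < r) hz sz
  have hlt : 0 < ori e z E c := by
    refine cen.2.lt_of_ne fun hn => hsz ?_
    refine eq_of_ori_eq_zero (e := e) (a := z) (b := x) (c := c) hw.ed.pos.ne' h0.symm ?_
    rw [ori_swap']; linarith
  exact (sig_of_apex_ray (lay_anti P (by omega) hz) hw hE (mem_of_bd sz)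
    (ray_of_ori_eq_zero h0.symm hw.ed.pos hlt)).false hP hM hz (by omega)

/-- The window of the next layer around `x` ends at `E`. -/
theorem Half.window_end (hP : NoPent P) (hM : ColBound P M) (hz : z ∈ lay P r) (hj : j + M + 6 ≤ r)
    (hh : Half P e z j a x c E) (hw : Ed (lay P (j + 2)) e z w w') (h1 : 0 < ori e z w x)
    (h2 : 0 < ori e z x w') : w' = E := by
  have hE := hh.win.apex_pos hP hM hz (by omega) hh.ap
  have sz : Surr (lay P (j + 2)) z := surr_of_lay (by omega) hz
  have hEb : E ∈ bd (lay P (j + 2)) := hh.win.apex_bd hP (lay_anti P (by omega) hz) hh.ap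
  have f := hh.far w' (mem_of_bd hw.hb) h2
  have g := ori_gp e z w x E w'
  have pos := hw.pos
  have wE : 0 < ori e z w E := by
    by_contra hn
    nlinarith [mul_nonneg h1.le f, mul_pos pos hE, mul_nonneg (neg_nonneg.2 (not_lt.1 hn)) h2.le]
  have := hw.next E hEb wE
  have h0 : ori e z w' E = 0 := by
    rw [ori_swap']; linarith
  refine bd_ray_unique sz hw.hb hEb ?_
  refine (ray_of_ori_eq_zero (e := -e) (x := x) ?_ ?_ ?_)
  · rw [ori_neg, h0, neg_zero]
  · unfold ori at *; linarith
  · unfold ori at *; linarith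

/-- The barrier moves two layers inwards, from `x` to `δ` on the same ray. The point `E` takes the
role of the point in the window, and its apex `h` is the new barrier. -/
theorem Half.step (hP : NoPent P) (hM : ColBound P M) (hz : z ∈ lay P r) (hj : j + M + 10 ≤ r)
    (hh : Half P e z j a x c E) (hx : Ed (lay P (j + 2)) e z W E) (hWx : 0 < ori e z W x)
    (hδ : IsD P e x W E δ) (hr : Ray z x δ) (hc : Ed (lay P (j + 3)) e z δ c')
    (hEc : 0 < ori e z E c') : ∃ h, Half P e z (j + 2) E δ c' h ∧
      (HalfStrict P e z j x E → HalfStrict P e z (j + 2) δ h) := by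
  have hzP := lay_subset P _ hz
  have xE := hh.win.apex_pos hP hM hz (by omega) hh.ap
  have xc := hh.win.ed.pos
  have sz1 : Surr (lay P (j + 1)) z := surr_of_lay (by omega) hz
  have sz2 : Surr (lay P (j + 2)) z := surr_of_lay (by omega) hz
  have sz3 : Surr (lay P (j + 3)) z := surr_of_lay (by omega) hz
  have hz2 : ∀ m, m ≤ r → z ∈ lay P m := fun m hm => lay_anti P hm hz
  have he := ne_of_ori_pos xc
  have winx : Win P e z (j + 1) x W E := ⟨hh.win.ed.ha, hx, hWx, xE⟩
  have winE : Win P e z (j + 2) E δ c' := ⟨hx.hb, hc, hr.pos xE, hEc⟩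
  obtain ⟨h, hap⟩ := winE.exists_apex hP hzP sz3
  have hhb : h ∈ bd (lay P (j + 4)) := winE.apex_bd hP (hz2 _ (by omega)) hap
  have hc3 : c' ∈ lay P (j + 3) := mem_of_bd hc.hb
  have xc' : 0 < ori e z x c' := hr.symm.pos hc.pos
  have cen := hh.win.center hzP hh.ap
  -- If `c'` is within the window `x c`, it lies in the opposite cone at the apex `E`. Otherwise
  -- `Win.turn` applies to the successor of `x`, unless `E` is on the ray of `c`, which would be a
  -- filled zero.
  have turn : 0 ≤ ori e x E c' := by
    rcases le_or_gt 0 (ori e z c' c) with k | k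
    · exact (hh.win.far sz1 hh.ap (lay_succ_subset P _ hc3) xc'.le k).1
    obtain ⟨E2, hE2⟩ := Ed.exists sz2 he hx.hb
    have ns := Ed.no_skip hP (hz2 _ (by omega)) winE hE2.hb hE2.pos
    rcases cen.2.lt_or_eq with l | l
    · have cE2 : 0 < ori e z c E2 := by
        have g := ori_gp e z E c c' E2
        have p1 := hE2.pos
        have e1 : ori e z c' E2 = - ori e z E2 c' := ori_swap' ..
        have e2 : ori e z c c' = - ori e z c' c := ori_swap' ..
        by_contra hn
        nlinarith [mul_nonneg l.le (neg_nonneg.2 ns), mul_pos p1 (neg_pos.2 k), mul_nonneg hEc.le (neg_nonneg.2 (not_lt.1 hn))]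
      exact Win.turn hP (hz2 _ (by omega)) hh.win.ed winx ⟨hh.win.ed.hb, hE2, l, cE2⟩ winE
    · exfalso
      have ray : Ray z c E := by
        refine (ray_of_ori_eq_zero (e := -e) (x := x) ?_ ?_ ?_) <;> unfold ori at * <;> linarith
      exact FilledZero.false (e := -e) (i := j + 1) hP hM hz (by omega) (by omega)
        ⟨hh.win.ed.hb, ray, winx.mirror⟩
  have dh : 0 < ori e z δ h := winE.apex_pos hP hM hz (by omega) hap
  have xh : 0 < ori e z x h := hr.symm.pos dh
  have h2 : h ∈ lay P (j + 2) := lay_anti P (by omega) (mem_of_bd hhb)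
  have fw := hh.far h h2 xh
  have hne : h ≠ E := by
    rintro rfl; exact not_bd_of_lay (by omega : j + 2 < j + 4) (mem_of_bd hhb) hx.hb
  obtain ⟨g1, g2⟩ := half_of_ray hP (i := j + 1) (hz2 _ (by omega)) hh.win.ed.ha
    hδ.qe.te winE hap hr turn dh (rotN fw)
  exact ⟨h, g1, fun hst => g2 (rotP (hst h h2 xh hne))⟩

end

/-! ### Two-sided barriers -/

section

variable {P : Finset (ℝ × ℝ)} {e : ℝ} {i j k r M : ℕ}
  {z p p' q q' d x c x' c' y a u h s W E q'' w w' δ : ℝ × ℝ}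

/-- Both sides of the ray through `x`, a point of layer `j + 1`, are bounded by apexes. -/
def Delta (P : Finset (ℝ × ℝ)) (e : ℝ) (z : ℝ × ℝ) (j : ℕ) (x : ℝ × ℝ) : Prop :=
  ∃ a c E a' c' W, Half P e z j a x c E ∧ HalfStrict P e z j x E ∧ Half P (-e) z j a' x c' W

/-- A point of layer `j + 2` on the ray of `x` would start a `Sig` with the strict barrier `E`. -/
theorem Half.no_vertex (hP : NoPent P) (hM : ColBound P M) (hz : z ∈ lay P r)
    (hj : j + M + 6 ≤ r) (hh : Half P e z j a x c E) (hs : HalfStrict P e z j x E)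
    (hx' : x' ∈ bd (lay P (j + 2))) (hr : Ray z x x') : False := by
  have xE := hh.win.apex_pos hP hM hz (by omega) hh.ap
  have sz : Surr (lay P (j + 2)) z := surr_of_lay (by omega) hz
  have hEb : E ∈ bd (lay P (j + 2)) := hh.win.apex_bd hP (lay_anti P (by omega) hz) hh.ap
  obtain ⟨c', hc'⟩ := Ed.exists sz (ne_of_ori_pos xE) hx'
  have x'E := hr.pos xE
  have n := hc'.next E hEb x'E
  refine Sig.false (k := j + 2) (y := E) hP hM hz (by omega) ⟨hc', x'E, ?_, fun u hu hxu => ?_⟩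
  · rw [ori_swap']; linarith
  · refine hs u (lay_succ_subset P _ hu) (hr.symm.pos hxu) ?_
    rintro rfl; exact not_bd_of_lay (by omega : j + 2 < j + 3) hu hEb

/-- The ray of `x` passes through a window of layer `j + 2`, which ends at the two barriers. The
apex `δ` over `x` is squeezed onto the ray, and `Half.step` applies on both sides. -/
theorem Delta.step (hP : NoPent P) (hM : ColBound P M) (hz : z ∈ lay P r)
    (hj : j + M + 14 ≤ r) (h : Delta P e z j x) : ∃ x', Ray z x x' ∧ Delta P e z (j + 2) x' := by
  obtain ⟨a, c, E, a', cL, W, hR, hS, hL⟩ := h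
  have hzP := lay_subset P _ hz
  have hz2 : ∀ m, m ≤ r → z ∈ lay P m := fun m hm => lay_anti P hm hz
  have xE := hR.win.apex_pos hP hM hz (by omega) hR.ap
  have xW := hL.win.apex_pos hP hM hz (by omega) hL.ap
  have sz1 : Surr (lay P (j + 1)) z := surr_of_lay (by omega) hz
  have sz2 : Surr (lay P (j + 2)) z := surr_of_lay (by omega) hz
  have sz3 : Surr (lay P (j + 3)) z := surr_of_lay (by omega) hz
  have sz4 : Surr (lay P (j + 4)) z := surr_of_lay (by omega) hz
  have he := ne_of_ori_pos xE
  have hx := hR.win.ed.ha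
  have hxz : x ≠ z := by rintro rfl; exact not_bd_of_surr sz1 hx
  rcases ray_or_window sz2 he hxz with ⟨x', hx', hr⟩ | ⟨w, w', hw, wx, xw⟩
  · exact (hR.no_vertex hP hM hz (by omega) hS hx' hr).elim
  obtain rfl := hR.window_end hP hM hz (by omega) hw wx xw
  obtain rfl := hL.window_end hP hM hz (by omega) hw.mirror (by unfold ori at *; linarith)
    (by unfold ori at *; linarith)
  have winx : Win P e z (j + 1) x w w' := ⟨hx, hw, wx, xw⟩
  obtain ⟨δ, hδ⟩ := winx.exists_apex hP hzP sz2
  have hδb : δ ∈ bd (lay P (j + 3)) := winx.apex_bd hP (hz2 _ (by omega)) hδ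
  have hδ2 : δ ∈ lay P (j + 2) := lay_succ_subset P _ (mem_of_bd hδb)
  have cen := winx.center hzP hδ
  have ap := winx.apex_pos hP hM hz (by omega) hδ
  have ne3 : ∀ u ∈ lay P (j + 3), u ≠ w' := by
    rintro u hu rfl; exact not_bd_of_lay (by omega : j + 2 < j + 3) hu hw.hb
  -- Off the ray, a barrier would push `δ` to or past an end of the window in which `Win.center`
  -- places it; on the left, where the barrier is weak, contact suffices for the contradiction.
  have h0 : ori e z x δ = 0 := by
    rcases lt_trichotomy (ori e z x δ) 0 with k | k | k
    · have := hL.far δ hδ2 (by unfold ori at *; linarith)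
      unfold ori at *; linarith
    · exact k
    · have := hS δ hδ2 k (ne3 δ (mem_of_bd hδb))
      have := cen.2
      unfold ori at *; linarith
  have hδz : δ ≠ z := by rintro rfl; exact not_bd_of_lay (by omega : j + 3 < r) hz hδb
  have hr := ray_of_window hw.pos wx xw h0 cen.1 cen.2 hδz
  obtain ⟨c1, hc1⟩ := Ed.exists sz3 he hδb
  obtain ⟨c2, hc2⟩ := Ed.exists sz3 (neg_ne_zero.2 he) hδb
  have hc1m := mem_of_bd hc1.hb
  have hc2m := mem_of_bd hc2.hb
  obtain ⟨h, hRn, hSn⟩ := hR.step hP hM hz (by omega) hw wx hδ hr hc1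
    (hS c1 (lay_succ_subset P _ hc1m) (hr.symm.pos hc1.pos) (ne3 c1 hc1m))
  have hSn := hSn hS
  have wk := hL.far c2 (lay_succ_subset P _ hc2m) (hr.symm.pos hc2.pos)
  rcases wk.lt_or_eq with l | l
  · obtain ⟨h', hLn, -⟩ := hL.step hP hM hz (by omega) hw.mirror (by unfold ori at *; linarith)
      hδ.mirror hr hc2 l
    exact ⟨δ, hr, _, _, _, _, _, _, hRn, hSn, hLn⟩
  -- Only one barrier is strict. Here the neighbour `c2` of `δ` is on the ray of the other one, and
  -- the window of layer `j + 4` around `δ` yields two points in a window or a filled zero.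
  · exfalso
    have rwc : Ray z w c2 := ray_of_ori_eq_zero (e := e) (x := x) (by unfold ori at *; linarith) wx
      (by have := hr.symm.pos hc2.pos; unfold ori at *; linarith)
    rcases ray_or_window sz4 he hδz with ⟨x', hx', hr'⟩ | ⟨v, v', hv, vx, xv⟩
    · exact (hRn.no_vertex hP hM hz (by omega) hSn hx' hr')
    obtain rfl := hRn.window_end hP hM hz (by omega) hv vx xv
    have hxv : 0 < ori (-e) z x v := hr.symm.pos (by unfold ori at *; linarith)
    have f := hL.far v (lay_anti P (by omega) (mem_of_bd hv.ha)) hxv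
    have wδ : 0 < ori e z w δ := ap
    rcases f.lt_or_eq with k | k
    · have k : 0 < ori e z v w := by unfold ori at *; linarith
      have g := ori_gp e z v w δ v'
      have vv := hv.pos
      have wv' : 0 < ori e z w v' := by
        by_contra hn
        nlinarith [mul_pos k xv, mul_pos vv wδ, mul_nonneg (neg_nonneg.2 (not_lt.1 hn)) vx.le]
      have := Win.unique hP hzP sz4 ⟨hc2.hb, hv, rwc.pos' k, rwc.pos wv'⟩ ⟨hδb, hv, vx, xv⟩
      have hp := hc2.pos
      rw [this] at hp
      simp at hp
    · have rwv : Ray z w v := ray_of_ori_eq_zero (e := e) (x := x) (by unfold ori at *; linarith) wx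
        (by unfold ori at *; linarith)
      exact FilledZero.false (e := e) (i := j + 3) hP hM hz (by omega) (by omega)
        ⟨hc2.hb, rwc.symm.trans rwv, ⟨hδb, hv, vx, xv⟩⟩

/-- After `M` steps of two layers each there are `M + 1` points on the ray of `x`. -/
theorem Delta.depth (hP : NoPent P) (hM : ColBound P M) (hz : z ∈ lay P r)
    (h : Delta P e z j x) : r ≤ j + 3 * M + 16 := by
  by_contra hn
  push Not at hn
  have key : ∀ n, n ≤ M → ∃ x', Ray z x x' ∧ Delta P e z (j + 2 * n) x' := by
    intro n
    induction n with
    | zero => exact fun _ => ⟨x, Ray.refl z x, h⟩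
    | succ n ih =>
      intro hn
      obtain ⟨x1, r1, d1⟩ := ih (by omega)
      obtain ⟨x2, r2, d2⟩ := d1.step hP hM hz (by omega)
      exact ⟨x2, r1.trans r2, d2⟩
  have := fun n : Fin (M + 1) => key n (by omega)
  choose f hf hd using this
  have hb : ∀ n : Fin (M + 1), f n ∈ bd (lay P (j + 2 * (n : ℕ) + 1)) := by
    intro n
    obtain ⟨_, _, _, _, _, _, hR, -, -⟩ := hd n
    exact hR.win.ed.ha
  have := card_le_of_ray hM Finset.univ f (fun a _ b _ hab => by
    have h1 := hb a
    rw [hab] at h1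
    have := bd_lay_inj h1 (hb b)
    ext; omega) (fun n _ => ⟨bd_lay_subset (hb n), hf n⟩)
  simp at this

theorem Clean.half (hP : NoPent P) (hM : ColBound P M) (hz : z ∈ lay P r)
    (hi : i + M + 6 ≤ r) (h : Clean P e z i p q q' d p' q'' c' s) (h0 : ori e p d z = 0)
    (hs : 0 ≤ ori e q' s z) : Half P e z (i + 1) q' d c' s ∧
      (0 < ori e q' s z → HalfStrict P e z (i + 1) d s) := by
  have hzP := lay_subset P _ hz
  have hdb := h.win.apex_bd hP (lay_anti P (by omega) hz) h.ap
  have hdz : d ≠ z := by rintro rfl; exact not_bd_of_lay (by omega : i + 2 < r) hz hdb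
  have cen := h.win.center hzP h.ap
  refine half_of_ray hP (lay_anti P (by omega) hz) h.win.hp h.ap.qe.te h.winR h.apR
    (ray_of_window h.win.ed.pos h.win.h1 h.win.h2 ?_ cen.1 cen.2 hdz)
    (Win.turn hP (lay_anti P (by omega) hz) h.ed h.win h.win' h.winR)
    (h.winR.apex_pos hP hM hz (by omega) h.apR) hs
  unfold ori at *; linarith

/-- In the borderline case where `d` is in line with `p` and `z`, apexes diverging to both sides
would produce a `Delta` too far out. -/
theorem Clean.not_split {pL qL cL sL : ℝ × ℝ} (hP : NoPent P) (hM : ColBound P M)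
    (hz : z ∈ lay P r) (hi : i + 3 * M + 18 ≤ r)
    (h : Clean P e z i p q q' d p' q'' c' s) (h' : Clean P (-e) z i p q' q d pL qL cL sL)
    (h0 : ori e p d z = 0) (hs : 0 < ori e q' s z) (hs' : 0 ≤ ori (-e) q sL z) : False := by
  obtain ⟨a1, a2⟩ := h.half hP hM hz (by omega) h0 hs.le
  obtain ⟨b1, -⟩ := h'.half hP hM hz (by omega) (by rw [ori_neg, h0, neg_zero]) hs'
  have : Delta P e z (i + 1) d := ⟨_, _, _, _, _, _, a1, a2 hs, b1⟩
  have := this.depth hP hM hz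
  omega

end

/-! ### Choice of a direction, and the exceptional points -/

section

variable {P Q : Finset (ℝ × ℝ)} {e : ℝ} {i j k r M : ℕ}
  {z p p' q q' d x c x' c' y a b a' b' u h s W E q'' w w' δ : ℝ × ℝ}

theorem ray_of_ori_eq_zero' (h : ori e z b b' = 0) (h1 : 0 < ori e z a b) (h2 : 0 < ori e z a b') :
    Ray z b b' := by
  refine ray_of_ori_eq_zero (e := -e) (x := a) ?_ ?_ ?_ <;> unfold ori at * <;> linarith

theorem Ed.right_unique (hz : Surr Q z) (h : Ed Q e z a b) (h' : Ed Q e z a b') : b = b' := by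
  have h1 := h.next b' h'.hb h'.pos
  have h2 := h'.next b h.hb h.pos
  refine bd_ray_unique hz h.hb h'.hb (ray_of_ori_eq_zero' ?_ h.pos h'.pos)
  rw [ori_swap'] at h1
  linarith

theorem Ed.left_unique (hz : Surr Q z) (h : Ed Q e z a b) (h' : Ed Q e z a' b) : a = a' :=
  h.mirror.right_unique hz h'.mirror

theorem Ed.window_unique (hz : Surr Q z) (h : Ed Q e z a b) (h' : Ed Q e z a' b')
    (h1 : 0 < ori e z a u) (h2 : 0 < ori e z u b) (h1' : 0 < ori e z a' u)
    (h2' : 0 < ori e z u b') : a = a' ∧ b = b' := by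
  have main : ∀ a b b', Ed Q e z a b → b' ∈ bd Q → 0 < ori e z a u → 0 < ori e z u b →
      0 < ori e z u b' → ori e z b' b ≤ 0 := by
    intro a b b' h hb' h1 h2 h2'
    by_contra hn
    have pos := h.pos
    have g := ori_gp e z a u b' b
    have : 0 < ori e z a b' := by
      by_contra hn'
      nlinarith [mul_pos h1 (not_le.1 hn), mul_pos pos h2', mul_nonneg (neg_nonneg.2 (not_lt.1 hn')) h2.le]
    exact hn (h.next b' hb' this)
  have k1 := main a b b' h h'.hb h1 h2 h2'
  have k2 := main a' b' b h' h.hb h1' h2' h2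
  have : b = b' := by
    refine bd_ray_unique hz h.hb h'.hb (ray_of_ori_eq_zero' ?_ h2 h2')
    rw [ori_swap'] at k1
    linarith
  subst this
  exact ⟨h.left_unique hz h', rfl⟩

theorem Win.window_unique (hz : Surr (lay P (i + 1)) z) (h : Win P e z i p a b)
    (h' : Win P e z i p a' b') : a = a' ∧ b = b' :=
  h.ed.window_unique hz h'.ed h.h1 h.h2 h'.h1 h'.h2

/-- Points whose apex is on the right, or in line with the centre unless this extends. -/
def XS (P : Finset (ℝ × ℝ)) (e : ℝ) (z : ℝ × ℝ) (i : ℕ) (p : ℝ × ℝ) : Prop :=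
  ∃ q q' d, Win P e z i p q q' ∧ IsD P e p q q' d ∧ (ori e p d z < 0 ∨ (ori e p d z = 0 ∧
    ((∃ p' q'' c' s, Clean P (-e) z i p q' q d p' q'' c' s) →
      ∀ p' q'' c' s, Clean P e z i p q q' d p' q'' c' s → ori e q' s z ≤ 0)))

/-- Only an apex in line with `p` and `z` is undecided. Failure for both orientations means that the
configuration continues with diverging apexes on both sides, which `Clean.not_split` forbids. -/
theorem XS.or (hP : NoPent P) (hM : ColBound P M) (hz : z ∈ lay P r) (hi : i + 3 * M + 18 ≤ r)
    (h : Win P e z i p q q') : XS P e z i p ∨ XS P (-e) z i p := by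
  have sz1 : Surr (lay P (i + 1)) z := surr_of_lay (by omega) hz
  obtain ⟨d, hd⟩ := h.exists_apex hP (lay_subset P _ hz) sz1
  rcases lt_trichotomy (ori e p d z) 0 with k | k | k
  · exact Or.inl ⟨q, q', d, h, hd, Or.inl k⟩
  · by_contra hn
    push Not at hn
    obtain ⟨h1, h2⟩ := hn
    unfold XS at h1 h2
    push Not at h1 h2
    have h1 := (h1 q q' d h hd).2 k
    have h2 := (h2 q' q d h.mirror hd.mirror).2 (by rw [ori_neg, k, neg_zero])
    obtain ⟨-, a1, a2, a3, a4, ha, ha'⟩ := h1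
    obtain ⟨-, b1, b2, b3, b4, hb, hb'⟩ := h2
    exact ha.not_split hP hM hz (by omega) hb k ha' hb'.le
  · exact Or.inr ⟨q', q, d, h.mirror, hd.mirror, Or.inl (by rw [ori_neg]; linarith)⟩

theorem XS.step {pL qL cL sL : ℝ × ℝ} (hP : NoPent P) (hM : ColBound P M) (hz : z ∈ lay P r)
    (hi : i + 3 * M + 19 ≤ r) (hx : XS P e z i p) (h : Clean P e z i p q q' d p' q'' c' s)
    (h' : Clean P (-e) z i p q' q d pL qL cL sL) :
    XS P e z (i + 1) q' ∧ ori e p q' c' = 0 := by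
  have hzP := lay_subset P _ hz
  have sz1 : Surr (lay P (i + 1)) z := surr_of_lay (by omega) hz
  have sz2 : Surr (lay P (i + 2)) z := surr_of_lay (by omega) hz
  have sz3 : Surr (lay P (i + 3)) z := surr_of_lay (by omega) hz
  obtain ⟨q0, q0', d0, hw, hd, hx⟩ := hx
  obtain ⟨rfl, rfl⟩ := hw.window_unique sz1 h.win
  obtain rfl := hd.unique h.ap
  have hs : ori e p d0 z ≤ 0 := by
    rcases hx with hx | hx <;> linarith
  refine ⟨⟨d0, c', s, h.winR, h.apR, ?_⟩, h.collinear hP hM hz (by omega) hs⟩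
  have hq : ori e q0' s z ≤ 0 := by
    rcases hx with hx | ⟨-, hx⟩
    · exact h.sign hP hM hz (by omega) hx
    · exact hx ⟨_, _, _, _, h'⟩ _ _ _ _ h
  rcases hq.lt_or_eq with k | k
  · exact Or.inl k
  -- Borderline case at `q0'`. If both continuations exist, the empty quadrilateral `p q0' s d0`
  -- confines the apex `t` over `d0`, and an outward apex on the other side would contradict
  -- `Clean.not_split`.
  refine Or.inr ⟨k, ?_⟩
  rintro ⟨a1, a2, a3, t, ha⟩ b1 b2 b3 s2 hb
  by_contra hn
  push Not at hn
  have V := h.qe hP hM hz (by omega) hs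
  have side := apex_side_lt (e := -e) (i := i + 1) hP hM hz (by omega) ha.ap ha.winR ha.apR
    (by rw [ori_neg, k, neg_zero])
  have t1 := ha.apR.h1
  have t2 := ha.apR.h2
  have hpt : ori e t d0 p ≤ 0 := by
    by_contra hn'
    refine hP.wedge V ha.apR.qe.hc (by unfold ori at *; linarith) (by unfold ori at *; linarith)
      (not_le.1 hn')
  have key : ori e d0 t z ≤ 0 := by
    have g := ori_gp e d0 p s z t
    have ps : 0 < ori e d0 p s := by have := V.cda; unfold ori at *; linarith
    have sz : 0 < ori e d0 s z := by have := ha.winR.h1; unfold ori at *; linarith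
    have st : 0 < ori e d0 s t := by unfold ori at *; linarith
    have pz : 0 ≤ ori e d0 p z := by rw [ori_swap]; linarith
    have pt : ori e d0 p t ≤ 0 := by unfold ori at *; linarith
    rw [ori_swap']
    by_contra hn'
    nlinarith [mul_nonneg pz st.le, mul_nonneg (neg_nonneg.2 pt) sz.le, mul_pos ps (not_le.1 hn')]
  exact hb.not_split hP hM hz (by omega) ha k hn (by rw [ori_neg]; linarith)

/-- The point `b` of layer `i + 1` ends the half-open window containing `p`. -/
def Hw (P : Finset (ℝ × ℝ)) (e : ℝ) (z : ℝ × ℝ) (i : ℕ) (p b : ℝ × ℝ) : Prop :=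
  ∃ a, Ed (lay P (i + 1)) e z a b ∧ (Ray z p a ∨ (0 < ori e z a p ∧ 0 < ori e z p b))

theorem Hw.exists (hz : z ∈ lay P (i + 2)) (he : e ≠ 0) (hp : p ∈ bd (lay P i)) :
    ∃ b, Hw P e z i p b := by
  have sz1 : Surr (lay P (i + 1)) z := surr_of_lay (by omega) hz
  have sz0 : Surr (lay P i) z := surr_of_lay (by omega) hz
  rcases ray_or_window sz1 he (p := p) (by rintro rfl; exact not_bd_of_surr sz0 hp) with
    ⟨c, hc, hr⟩ | ⟨a, b, h, h1, h2⟩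
  · obtain ⟨b, hb⟩ := Ed.exists sz1 he hc
    exact ⟨b, c, hb, Or.inl hr⟩
  · exact ⟨b, a, h, Or.inr ⟨h1, h2⟩⟩

/-- Two points in one open window contradict `Win.unique`; one on the ray of the first end and one
inside form a filled zero, which is excluded this far out. -/
theorem Hw.inj (hP : NoPent P) (hM : ColBound P M) (hz : z ∈ lay P r) (hi : i + M + 2 ≤ r)
    (hi' : i + 2 ≤ r) (hp : p ∈ bd (lay P i)) (hp' : p' ∈ bd (lay P i)) (h : Hw P e z i p b)
    (h' : Hw P e z i p' b) : p = p' := by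
  have sz1 : Surr (lay P (i + 1)) z := surr_of_lay (by omega) hz
  have sz0 : Surr (lay P i) z := surr_of_lay (by omega) hz
  obtain ⟨a, ha, h⟩ := h
  obtain ⟨a', ha', h'⟩ := h'
  obtain rfl := ha.left_unique sz1 ha'
  rcases h with h | h <;> rcases h' with h' | h'
  · exact bd_ray_unique sz0 hp hp' (h.trans h'.symm)
  · exact (FilledZero.false hP hM hz hi hi' ⟨hp, h, hp', ha, h'.1, h'.2⟩).elim
  · exact (FilledZero.false hP hM hz hi hi' ⟨hp', h', hp, ha, h.1, h.2⟩).elim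
  · exact Win.unique hP (lay_subset P _ hz) sz1 ⟨hp, ha, h.1, h.2⟩ ⟨hp', ha, h'.1, h'.2⟩

theorem Hw.functional (hz : z ∈ lay P (i + 2)) (h : Hw P e z i p b) (h' : Hw P e z i p b') :
    b = b' := by
  have sz1 : Surr (lay P (i + 1)) z := surr_of_lay (by omega) hz
  obtain ⟨a, ha, h⟩ := h
  obtain ⟨a', ha', h'⟩ := h'
  rcases h with h | h <;> rcases h' with h' | h'
  · obtain rfl := bd_ray_unique sz1 ha.ha ha'.ha (h.symm.trans h')
    exact ha.right_unique sz1 ha'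
  · have := ha'.next a ha.ha (h.pos' h'.1)
    linarith [h.pos h'.2]
  · have := ha.next a' ha'.ha (h'.pos' h.1)
    linarith [h'.pos h.2]
  · exact (ha.window_unique sz1 ha' h.1 h.2 h'.1 h'.2).2

/-- The points of layer `i + 1` whose half-open window is empty. -/
noncomputable def growth (P : Finset (ℝ × ℝ)) (e : ℝ) (z : ℝ × ℝ) (i : ℕ) : Finset (ℝ × ℝ) :=
  (bd (lay P (i + 1))).filter fun b => ¬ ∃ p ∈ bd (lay P i), Hw P e z i p b

/-- Assigning to a point the end of its half-open window is injective, and `growth` is the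
complement of the image. In particular layer sizes do not decrease inwards in this range. -/
theorem card_growth (hP : NoPent P) (hM : ColBound P M) (hz : z ∈ lay P r) (hi : i + M + 2 ≤ r)
    (hi' : i + 2 ≤ r) (he : e ≠ 0) :
    (bd (lay P i)).card + (growth P e z i).card = (bd (lay P (i + 1))).card := by
  have := fun p : bd (lay P i) => Hw.exists (lay_anti P hi' hz) he p.2
  choose f hf using this
  have hinj : Function.Injective f := fun p p' hpp => by
    ext1
    have h1 := hf p
    rw [hpp] at h1
    exact Hw.inj hP hM hz hi hi' p.2 p'.2 h1 (hf p')
  have key : (Finset.univ.image f) = (bd (lay P (i + 1))).filter fun b =>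
      ∃ p ∈ bd (lay P i), Hw P e z i p b := by
    ext b
    simp only [Finset.mem_image, Finset.mem_univ, true_and, Finset.mem_filter]
    constructor
    · rintro ⟨p, rfl⟩
      obtain ⟨a, ha, h⟩ := hf p
      exact ⟨ha.hb, p, p.2, a, ha, h⟩
    · rintro ⟨hb, p, hp, hw⟩
      exact ⟨⟨p, hp⟩, (hf ⟨p, hp⟩).functional (lay_anti P hi' hz) hw⟩
  rw [growth, ← Finset.card_filter_add_card_filter_not (s := bd (lay P (i + 1))) (fun b => ∃ p ∈ bd (lay P i), Hw P e z i p b), ← key, Finset.card_image_of_injective _ hinj]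
  simp

/-- Points of layer `i` on the ray of a point of layer `i + 1`. -/
noncomputable def zu (P : Finset (ℝ × ℝ)) (z : ℝ × ℝ) (i : ℕ) : Finset (ℝ × ℝ) :=
  (bd (lay P i)).filter fun p => ∃ c ∈ bd (lay P (i + 1)), Ray z p c

/-- Points of layer `i + 1` on the ray of a point of layer `i`. -/
noncomputable def zl (P : Finset (ℝ × ℝ)) (z : ℝ × ℝ) (i : ℕ) : Finset (ℝ × ℝ) :=
  (bd (lay P (i + 1))).filter fun c => ∃ p ∈ bd (lay P i), Ray z p c

theorem mem_zu : p ∈ zu P z i ↔ p ∈ bd (lay P i) ∧ ∃ c ∈ bd (lay P (i + 1)), Ray z p c := by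
  simp only [zu, Finset.mem_filter]

theorem mem_zl : c ∈ zl P z i ↔ c ∈ bd (lay P (i + 1)) ∧ ∃ p ∈ bd (lay P i), Ray z p c := by
  simp only [zl, Finset.mem_filter]

theorem mem_growth : b ∈ growth P e z i ↔
    b ∈ bd (lay P (i + 1)) ∧ ¬ ∃ p ∈ bd (lay P i), Hw P e z i p b := by
  simp only [growth, Finset.mem_filter]

theorem card_zl (hz : z ∈ lay P (i + 2)) : (zl P z i).card = (zu P z i).card := by
  have sz1 : Surr (lay P (i + 1)) z := surr_of_lay (by omega) hz
  have sz0 : Surr (lay P i) z := surr_of_lay (by omega) hz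
  apply le_antisymm
  · refine Finset.card_le_card_of_forall_subsingleton (fun c p => Ray z p c) ?_ ?_
    · intro c hc
      simp only [zl, zu, Finset.mem_filter] at *
      obtain ⟨hc, p, hp, h⟩ := hc
      exact ⟨p, ⟨hp, c, hc, h⟩, h⟩
    · rintro p - c ⟨hc, h⟩ c' ⟨hc', h'⟩
      simp only [zl, zu, Finset.mem_filter] at *
      exact bd_ray_unique sz1 hc.1 hc'.1 (h.symm.trans h')
  · refine Finset.card_le_card_of_forall_subsingleton (fun p c => Ray z p c) ?_ ?_
    · intro c hc
      simp only [zl, zu, Finset.mem_filter] at *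
      obtain ⟨hc, p, hp, h⟩ := hc
      exact ⟨p, ⟨hp, c, hc, h⟩, h⟩
    · rintro p - c ⟨hc, h⟩ c' ⟨hc', h'⟩
      simp only [zl, zu, Finset.mem_filter] at *
      exact bd_ray_unique sz0 hc.1 hc'.1 (h.trans h'.symm)

/-- Alignments form runs along rays. Starts of runs minus ends of runs equal the change in the
number of alignments. -/
theorem card_tops (hz : z ∈ lay P (i + 2)) : (zu P z (i + 1) \ zl P z i).card + (zu P z i).card =
    (zu P z (i + 1)).card + (zl P z i \ zu P z (i + 1)).card := by
  have h1 := Finset.card_sdiff_add_card_inter (zu P z (i + 1)) (zl P z i)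
  have h2 := Finset.card_sdiff_add_card_inter (zl P z i) (zu P z (i + 1))
  have h3 := card_zl hz
  rw [Finset.inter_comm] at h2
  omega

theorem ray_out (hz : Surr (lay P i) z) (hx : x ∈ bd (lay P i)) (hx' : x' ∈ lay P (i + 1))
    (h : Ray z x x') (hu : 0 < ori e z x' u) : 0 < ori e x' x u := by
  obtain ⟨s, hs, hs1, hxs⟩ := h.beyond hz hx hx'
  have e1 : s * ori e x' x u = (1 - s) * ori e z x' u := by
    rw [hxs]; unfold ori; simp only; ring
  have : 0 < s * ori e x' x u := by rw [e1]; exact mul_pos (by linarith) hu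
  exact pos_of_mul_pos_right this hs.le

/-- Let a run of alignments end at `c`. Its window for the opposite orientation cannot contain an
interior point, which would be a filled zero. If it contained its other end `b` as an alignment, the
strip quadrilateral over `c b` would have a point of layer `i + 2` in its wedge, or that point would
complete a filled zero. -/
theorem bottoms_subset (hP : NoPent P) (hM : ColBound P M) (hz : z ∈ lay P r) (hi : i + M + 4 ≤ r)
    (he : e ≠ 0) : zl P z i \ zu P z (i + 1) ⊆ growth P (-e) z i := by
  have hz2 : ∀ m, m ≤ r → z ∈ lay P m := fun m hm => lay_anti P hm hz
  have sz0 : Surr (lay P i) z := surr_of_lay (by omega) hz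
  have sz1 : Surr (lay P (i + 1)) z := surr_of_lay (by omega) hz
  intro c hc
  by_cases hr0 : r < i + 4
  · omega
  have sz2 : Surr (lay P (i + 2)) z := surr_of_lay (by omega) hz
  simp only [zl, zu, growth, Finset.mem_filter, Finset.mem_sdiff, not_and] at hc ⊢
  obtain ⟨⟨hc, p, hp, hpc⟩, hnz⟩ := hc
  refine ⟨hc, ?_⟩
  rintro ⟨p', hp', b, hb, h⟩
  have hb : Ed (lay P (i + 1)) e z c b := by simpa using hb.mirror
  rcases h with h | ⟨h1, h2⟩
  swap
  · exact FilledZero.false hP hM hz (by omega) (by omega) ⟨hp, hpc, hp', hb,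
      by unfold ori at *; linarith, by unfold ori at *; linarith⟩
  have pp' : 0 < ori e z p p' := hpc.symm.pos (h.symm.pos' hb.pos)
  have hed : Ed (lay P i) e z p p' := by
    obtain ⟨b2, hb2⟩ := Ed.exists sz0 he hp
    have n := hb2.next p' hp' pp'
    have : b2 = p' := by
      rcases n.lt_or_eq with k | k
      · refine (FilledZero.false hP hM hz (by omega) (by omega) ⟨hp, hpc, hb2.hb, hb,
          hpc.pos hb2.pos, h.pos' ?_⟩).elim
        rw [ori_swap']; linarith
      · exact (bd_ray_unique sz0 hp' hb2.hb (ray_of_ori_eq_zero' k pp' hb2.pos)).symm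
    exact this ▸ hb2
  have b1 := ray_out sz0 hp (mem_of_bd hc) hpc hb.pos
  have b2 := ray_out (e := -e) sz0 hp' (mem_of_bd hb.hb) h (u := c) hb.mirror.pos
  have hqe := hed.qe_strip sz1 hb (rotP' b1) (by unfold ori at *; linarith)
  have hcz : c ≠ z := by rintro rfl; exact not_bd_of_surr sz1 hc
  rcases ray_or_window sz2 he hcz with ⟨x, hx, hr⟩ | ⟨w, w', hw, wc, cw⟩
  · exact hnz hc ⟨x, hx, hr⟩
  have skip := Ed.no_skip hP (hz2 _ (by omega)) ⟨hc, hw, wc, cw⟩ hb.hb hb.pos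
  have hw' := mem_of_bd hw.hb
  rcases skip.lt_or_eq with k | k
  · refine hP.wedge hqe.rot (lay_subset P _ hw') ?_ (rotP (hb.ori_pos sz1 (surr_of_lay_succ hw')))
      (rotP' (ray_out sz0 hp (mem_of_bd hc) hpc cw))
    have := ray_out (e := -e) (u := w') sz0 hp' (mem_of_bd hb.hb) h (by unfold ori at *; linarith)
    unfold ori at *; linarith
  · have hr : Ray z b w' := ray_of_ori_eq_zero' k hb.pos cw
    exact FilledZero.false (e := -e) (i := i + 1) hP hM hz (by omega) (by omega)
      ⟨hb.hb, hr, Win.mirror ⟨hc, hw, wc, cw⟩⟩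

/-- Points of layer `i` whose right neighbourhood is regular. -/
def CleanR (P : Finset (ℝ × ℝ)) (e : ℝ) (z : ℝ × ℝ) (i : ℕ) (p : ℝ × ℝ) : Prop :=
  ∃ q q' d p' q'' c' s, Clean P e z i p q q' d p' q'' c' s

noncomputable def unclean (P : Finset (ℝ × ℝ)) (e : ℝ) (z : ℝ × ℝ) (i : ℕ) : Finset (ℝ × ℝ) :=
  (bd (lay P i) \ zu P z i).filter fun p => ¬ CleanR P e z i p

theorem exists_win (hz : z ∈ lay P (i + 2)) (he : e ≠ 0) (hp : p ∈ bd (lay P i) \ zu P z i) :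
    ∃ q q', Win P e z i p q q' := by
  have sz1 : Surr (lay P (i + 1)) z := surr_of_lay (by omega) hz
  have sz0 : Surr (lay P i) z := surr_of_lay (by omega) hz
  simp only [zu, Finset.mem_sdiff, Finset.mem_filter, not_and] at hp
  rcases ray_or_window sz1 he (p := p) (by rintro rfl; exact not_bd_of_surr sz0 hp.1) with
    ⟨c, hc, hr⟩ | ⟨a, b, h, h1, h2⟩
  · exact (hp.2 hp.1 ⟨c, hc, hr⟩).elim
  · exact ⟨a, b, hp.1, h, h1, h2⟩

theorem Win.ed_next (hP : NoPent P) (hzP : z ∈ P) (sz1 : Surr (lay P (i + 1)) z)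
    (sz0 : Surr (lay P i) z) (hw : Win P e z i p q q') (hw' : Win P e z i x q' q'')
    (hn : ¬ ∃ y ∈ bd (lay P i), Ray z y q') : Ed (lay P i) e z p x := by
  obtain ⟨y, hy⟩ := Ed.exists sz0 (ne_of_ori_pos hw.h1) hw.hp
  have pq' := hw.h2
  have py := hy.pos
  have q'y : 0 < ori e z q' y := by
    rcases lt_trichotomy (ori e z q' y) 0 with k | k | k
    · have yq' : 0 < ori e z y q' := by rw [ori_swap']; linarith
      have qp := hw.h1
      have qq' := hw.ed.pos
      have g := ori_gp e z q p y q'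
      have qy : 0 < ori e z q y := by
        by_contra hn
        nlinarith [mul_pos qp yq', mul_pos py qq', mul_nonneg (neg_nonneg.2 (not_lt.1 hn)) pq'.le]
      have := Win.unique hP hzP sz1 hw ⟨hy.hb, hw.ed, qy, yq'⟩
      rw [this] at py; simp at py
    · exact (hn ⟨y, hy.hb, (ray_of_ori_eq_zero' k pq' py).symm⟩).elim
    · exact k
  rcases lt_or_ge 0 (ori e z y q'') with k | k
  · rw [Win.unique hP hzP sz1 hw' ⟨hy.hb, hw'.ed, q'y, k⟩]
    exact hy
  · exfalso
    have q'x := hw'.h1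
    have xq'' := hw'.h2
    have qq := hw'.ed.pos
    have g1 := ori_gp e z q' x q'' y
    have k' : 0 ≤ ori e z q'' y := by rw [ori_swap']; linarith
    have xy : 0 < ori e z x y := by
      by_contra hn
      nlinarith [mul_nonneg q'x.le k', mul_pos q'y xq'', mul_nonneg (neg_nonneg.2 (not_lt.1 hn)) qq.le]
    have g2 := ori_gp e z p q' x y
    have px : 0 < ori e z p x := by
      by_contra hn
      nlinarith [mul_pos pq' xy, mul_pos py q'x, mul_nonneg (neg_nonneg.2 (not_lt.1 hn)) q'y.le]
    linarith [hy.next x hw'.hp px]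

/-- Each unclean point is charged to one cause: the end `q'` of its window starts a run of
alignments, the successor of its apex is in `growth`, or the successor of `q'` is in `growth`. The
three lemmas `cA`, `cB`, `cC` say that a cause determines the point. -/
theorem card_unclean (hP : NoPent P) (hM : ColBound P M) (hz : z ∈ lay P r) (hi : i + M + 6 ≤ r)
    (he : e ≠ 0) : (unclean P e z i).card ≤ (zu P z (i + 1) \ zl P z i).card +
      (growth P e z (i + 1)).card + (growth P e z i).card := by
  have hzP := lay_subset P _ hz
  have hz2 : ∀ m, m ≤ r → z ∈ lay P m := fun m hm => lay_anti P hm hz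
  have sz0 : Surr (lay P i) z := surr_of_lay (by omega) hz
  have sz1 : Surr (lay P (i + 1)) z := surr_of_lay (by omega) hz
  have sz2 : Surr (lay P (i + 2)) z := surr_of_lay (by omega) hz
  have cA : ((unclean P e z i).filter fun p => ∃ q', q' ∈ zu P z (i + 1) \ zl P z i ∧
      ∃ q, Win P e z i p q q').card ≤ (zu P z (i + 1) \ zl P z i).card := by
    refine Finset.card_le_card_of_forall_subsingleton (fun p q' => ∃ q, Win P e z i p q q') ?_ ?_
    · intro p hp
      simp only [Finset.mem_filter] at hp
      exact hp.2
    · rintro q' - p ⟨-, q, h⟩ p' ⟨-, q2, h'⟩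
      obtain rfl := h.ed.left_unique sz1 h'.ed
      exact Win.unique hP hzP sz1 h h'
  have cC : ((unclean P e z i).filter fun p => ∃ b ∈ growth P e z i,
      ∃ q q', Win P e z i p q q' ∧ Ed (lay P (i + 1)) e z q' b).card ≤ (growth P e z i).card := by
    refine Finset.card_le_card_of_forall_subsingleton
      (fun p b => ∃ q q', Win P e z i p q q' ∧ Ed (lay P (i + 1)) e z q' b) ?_ ?_
    · intro p hp
      simp only [Finset.mem_filter] at hp
      exact hp.2
    · rintro b - p ⟨-, q, q1, h, hb⟩ p' ⟨-, q2, q3, h', hb'⟩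
      obtain rfl := hb.left_unique sz1 hb'
      obtain rfl := h.ed.left_unique sz1 h'.ed
      exact Win.unique hP hzP sz1 h h'
  have cB : ((unclean P e z i).filter fun p => ∃ b ∈ growth P e z (i + 1),
      ∃ q q' d, Win P e z i p q q' ∧ IsD P e p q q' d ∧ Ed (lay P (i + 2)) e z d b).card ≤
        (growth P e z (i + 1)).card := by
    refine Finset.card_le_card_of_forall_subsingleton
      (fun p b => ∃ q q' d, Win P e z i p q q' ∧ IsD P e p q q' d ∧ Ed (lay P (i + 2)) e z d b) ?_ ?_
    · intro p hp
      simp only [Finset.mem_filter] at hp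
      exact hp.2
    · rintro b - p ⟨-, q, q1, d, h, hd, hb⟩ p' ⟨-, q2, q3, d', h', hd', hb'⟩
      obtain rfl := hb.left_unique sz2 hb'
      have a1 := h.apex_pos hP hM hz (by omega) hd
      have a2 := h.mirror.apex_pos hP hM hz (by omega) hd.mirror
      have a3 := h'.apex_pos hP hM hz (by omega) hd'
      have a4 := h'.mirror.apex_pos hP hM hz (by omega) hd'.mirror
      obtain ⟨rfl, rfl⟩ := h.ed.window_unique sz1 h'.ed (u := d) a1 (by unfold ori at *; linarith)
        a3 (by unfold ori at *; linarith)
      exact Win.unique hP hzP sz1 h h'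
  refine le_trans (le_trans (Finset.card_le_card (t := _ ∪ _ ∪ _) ?_) (Finset.card_union_le _ _))
    (Nat.add_le_add ((Finset.card_union_le _ _).trans (Nat.add_le_add cA cB)) cC)
  intro p hp
  obtain ⟨hp0, hpc⟩ : p ∈ bd (lay P i) \ zu P z i ∧ ¬ CleanR P e z i p := by
    simpa only [unclean, Finset.mem_filter] using hp
  simp only [Finset.mem_union, Finset.mem_filter, hp, true_and]
  obtain ⟨q, q', hw⟩ := exists_win (hz2 _ (by omega)) he hp0
  obtain ⟨d, hd⟩ := hw.exists_apex hP hzP sz1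
  have hdb := hw.apex_bd hP (hz2 _ (by omega)) hd
  have a1 := hw.apex_pos hP hM hz (by omega) hd
  have a2 : 0 < ori e z d q' := by
    have := hw.mirror.apex_pos hP hM hz (by omega) hd.mirror
    unfold ori at *; linarith
  have q'zl : q' ∉ zl P z i := by
    intro hn
    simp only [zl, Finset.mem_filter] at hn
    obtain ⟨-, x, hx, hr⟩ := hn
    exact FilledZero.false (e := -e) hP hM hz (by omega) (by omega) ⟨hx, hr, hw.mirror⟩
  by_cases hzu : q' ∈ zu P z (i + 1)
  · exact Or.inl (Or.inl ⟨q', Finset.mem_sdiff.2 ⟨hzu, q'zl⟩, q, hw⟩)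
  obtain ⟨w, c', hw'⟩ := exists_win (e := e) (hz2 (i + 1 + 2) (by omega)) he
    (Finset.mem_sdiff.2 ⟨hw.ed.hb, hzu⟩)
  -- If the window of `q'` does not start at `d`, then the half-open window from `d` to its
  -- successor is empty, so the successor is in `growth`.
  by_cases hwd : w = d
  swap
  · left; right
    obtain ⟨b, hb⟩ := Ed.exists sz2 he hdb
    refine ⟨b, ?_, q, q', d, hw, hd, hb⟩
    refine mem_growth.2 ⟨hb.hb, ?_⟩
    rintro ⟨x, hx, d', hb', h⟩
    obtain rfl := hb.left_unique sz2 hb'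
    have inside : ∀ x ∈ bd (lay P (i + 1)), 0 < ori e z q x → 0 < ori e z x q' → False := by
      intro x hx h1 h2
      have := hw.ed.next x hx h1
      linarith
    rcases h with h | ⟨h1, h2⟩
    · exact inside x hx (h.symm.pos' a1) (h.symm.pos a2)
    · rcases lt_trichotomy (ori e z q' b) 0 with k | k | k
      · have bq : 0 < ori e z b q' := by rw [ori_swap']; linarith
        have db := hb.pos
        have pos := hw.ed.pos
        have g1 := ori_gp e z d x b q'
        have xq' : 0 < ori e z x q' := by
          by_contra hn
          nlinarith [mul_pos h1 bq, mul_pos a2 h2, mul_nonneg (neg_nonneg.2 (not_lt.1 hn)) db.le]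
        have g2 := ori_gp e z q d x q'
        have qx : 0 < ori e z q x := by
          by_contra hn
          nlinarith [mul_pos a1 xq', mul_pos pos h1, mul_nonneg (neg_nonneg.2 (not_lt.1 hn)) a2.le]
        exact inside x hx qx xq'
      · refine hzu (mem_zu.2 ⟨hw.ed.hb, b, hb.hb, ?_⟩)
        exact ray_of_ori_eq_zero' k a2 hb.pos
      · exact hwd ((hb.window_unique sz2 hw'.ed a2 k hw'.h1 hw'.h2).1).symm
  · subst hwd
    right
    -- Now everything but a point in the window after `q'` is available, so for an unclean `p` that
    -- window is empty.
    obtain ⟨q'', hq''⟩ := Ed.exists sz1 he hw.ed.hb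
    refine ⟨q'', ?_, q, q', hw, hq''⟩
    refine mem_growth.2 ⟨hq''.hb, ?_⟩
    rintro ⟨x, hx, a, ha, h⟩
    obtain rfl := hq''.left_unique sz1 ha
    rcases h with h | ⟨h1, h2⟩
    · exact q'zl (mem_zl.2 ⟨hw.ed.hb, x, hx, h⟩)
    · apply hpc
      obtain ⟨s, hs⟩ := hw'.exists_apex hP hzP sz2
      refine ⟨q, q', w, x, q'', c', s, hw, hd, ?_, ⟨hx, hq'', h1, h2⟩, hw', hs⟩
      exact hw.ed_next hP hzP sz1 sz0 ⟨hx, hq'', h1, h2⟩ fun h => q'zl (mem_zl.2 ⟨hw.ed.hb, h⟩)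

end

/-! ### Collinear chains of an injective map -/

section

variable {P Q : Finset (ℝ × ℝ)} {e : ℝ} {i j k r M N m : ℕ}
  {z p p' q q' d x c x' c' y a b a' b' u v h s W E q'' w w' δ : ℝ × ℝ}

theorem ori_line (hab : a ≠ b) (ha : ori 1 u v a = 0) (hb : ori 1 u v b = 0)
    (hc : ori 1 a b c = 0) : ori 1 u v c = 0 := by
  have k1 : ori 1 u v c * (b.1 - a.1) = 0 := by
    have : ori 1 u v c * (b.1 - a.1) = ori 1 a b c * (v.1 - u.1) +
      ori 1 u v b * (c.1 - a.1) + ori 1 u v a * (b.1 - c.1) := by unfold ori; ring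
    rw [this, ha, hb, hc]; ring
  have k2 : ori 1 u v c * (b.2 - a.2) = 0 := by
    have : ori 1 u v c * (b.2 - a.2) = ori 1 a b c * (v.2 - u.2) +
      ori 1 u v b * (c.2 - a.2) + ori 1 u v a * (b.2 - c.2) := by unfold ori; ring
    rw [this, ha, hb, hc]; ring
  by_contra hn
  refine hab (Prod.ext ?_ ?_)
  · have := (mul_eq_zero.1 k1).resolve_left hn; linarith
  · have := (mul_eq_zero.1 k2).resolve_left hn; linarith

theorem ori_line' (huv : u ≠ v) (ha : ori 1 u v a = 0) (hb : ori 1 u v b = 0)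
    (hc : ori 1 u v c = 0) : ori 1 a b c = 0 := by
  have k1 : ori 1 a b c * (v.1 - u.1) = 0 := by
    have : ori 1 a b c * (v.1 - u.1) = ori 1 u v a * (c.1 - b.1) + ori 1 u v b * (a.1 - c.1) +
      ori 1 u v c * (b.1 - a.1) := by unfold ori; ring
    rw [this, ha, hb, hc]; ring
  have k2 : ori 1 a b c * (v.2 - u.2) = 0 := by
    have : ori 1 a b c * (v.2 - u.2) = ori 1 u v a * (c.2 - b.2) + ori 1 u v b * (a.2 - c.2) +
      ori 1 u v c * (b.2 - a.2) := by unfold ori; ring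
    rw [this, ha, hb, hc]; ring
  by_contra hn
  refine huv (Prod.ext ?_ ?_)
  · have := (mul_eq_zero.1 k1).resolve_left hn; linarith
  · have := (mul_eq_zero.1 k2).resolve_left hn; linarith

/-- Consecutive triples of distinct neighbours pass the line on from one pair to the next. -/
theorem iterate_line {σ : ℝ × ℝ → ℝ × ℝ} {n : ℕ} (hne : ∀ k < n, σ^[k] y ≠ σ^[k + 1] y)
    (col : ∀ k, k + 2 ≤ n → ori 1 (σ^[k] y) (σ^[k + 1] y) (σ^[k + 2] y) = 0) {k : ℕ}
    (hk : k ≤ n) : ori 1 y (σ y) (σ^[k] y) = 0 := by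
  induction k using Nat.strong_induction_on with
  | _ k ih =>
    match k with
    | 0 => simp
    | 1 => simp
    | k + 2 =>
      exact ori_line (hne k (by omega)) (ih k (by omega) (by omega))
        (ih (k + 1) (by omega) (by omega)) (col k hk)

/-- A set that splits into collinear chains under an injective map. -/
theorem chain_card (hM : ColBound P M) {X T : Finset (ℝ × ℝ)} (hX : X ⊆ P) (σ : ℝ × ℝ → ℝ × ℝ)
    (rk : ℝ × ℝ → ℕ) (hσ : ∀ x ∈ X, x ∉ T → σ x ∈ X)
    (hinj : ∀ x ∈ X, x ∉ T → ∀ y ∈ X, y ∉ T → σ x = σ y → x = y)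
    (hrk : ∀ x ∈ X, x ∉ T → rk (σ x) = rk x + 1) (hm : ∀ x ∈ X, rk x < m)
    (col : ∀ x ∈ X, x ∉ T → σ x ∉ T → ori 1 x (σ x) (σ (σ x)) = 0) : X.card ≤ M * T.card := by
  -- Induction on the remaining rank: it increases along `σ` and stays below `m`, so each chain
  -- reaches `T`.
  have ex : ∀ l, ∀ x ∈ X, m ≤ rk x + l → ∃ n, σ^[n] x ∈ T ∧ ∀ k < n, σ^[k] x ∈ X ∧ σ^[k] x ∉ T := by
    intro l
    induction l with
    | zero => intro x hx hl; have := hm x hx; omega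
    | succ l ih =>
      intro x hx hl
      by_cases hxT : x ∈ T
      · exact ⟨0, hxT, fun k hk => by omega⟩
      · obtain ⟨n, hn, hk⟩ := ih (σ x) (hσ x hx hxT) (by rw [hrk x hx hxT]; omega)
        refine ⟨n + 1, hn, fun k hkn => ?_⟩
        cases k with
        | zero => exact ⟨hx, hxT⟩
        | succ k => exact hk k (by omega)
  have ex : ∀ x, ∃ n, x ∈ X → σ^[n] x ∈ T ∧ ∀ k < n, σ^[k] x ∈ X ∧ σ^[k] x ∉ T := by
    intro x
    by_cases hx : x ∈ X
    · obtain ⟨n, hn⟩ := ex m x hx (by omega)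
      exact ⟨n, fun _ => hn⟩
    · exact ⟨0, fun h => (hx h).elim⟩
  choose n hn using ex
  -- Sort `X` by the first point of `T` on the chain; it remains to see that each fibre is
  -- collinear.
  refine Finset.card_le_mul_card_image_of_maps_to (f := fun x => σ^[n x] x) (fun x hx => (hn x hx).1) M ?_
  intro t ht
  have cancel : ∀ k a b, (∀ l < k, σ^[l] a ∈ X ∧ σ^[l] a ∉ T) → (∀ l < k, σ^[l] b ∈ X ∧ σ^[l] b ∉ T) →
      σ^[k] a = σ^[k] b → a = b := by
    intro k
    induction k with
    | zero => intro a b _ _ h; exact h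
    | succ k ih =>
      intro a b ha hb h
      refine ih a b (fun l hl => ha l (by omega)) (fun l hl => hb l (by omega)) ?_
      rw [Function.iterate_succ_apply', Function.iterate_succ_apply'] at h
      exact hinj _ (ha k (by omega)).1 (ha k (by omega)).2 _ (hb k (by omega)).1 (hb k (by omega)).2 h
  -- By injectivity off `T`, of two points with the same chain end the one with the shorter chain
  -- lies on the chain of the other.
  have iter : ∀ a ∈ X, ∀ y ∈ X, σ^[n a] a = σ^[n y] y → n a ≤ n y → ∃ l ≤ n y, a = σ^[l] y := by
    intro a ha y hy h hle
    refine ⟨n y - n a, by omega, cancel (n a) _ _ (hn a ha).2 ?_ ?_⟩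
    · intro l hl
      rw [← Function.iterate_add_apply]
      exact (hn y hy).2 _ (by omega)
    · rw [← Function.iterate_add_apply, h]
      congr 1
      omega
  have line : ∀ y ∈ X, ∀ a b c, (∃ l ≤ n y, a = σ^[l] y) → (∃ l ≤ n y, b = σ^[l] y) →
      (∃ l ≤ n y, c = σ^[l] y) → ori 1 a b c = 0 := by
    rintro y hy a b c ⟨l1, h1, rfl⟩ ⟨l2, h2, rfl⟩ ⟨l3, h3, rfl⟩
    have hne : ∀ k < n y, σ^[k] y ≠ σ^[k + 1] y := by
      intro k hk heq
      have := (hn y hy).2 k hk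
      have := hrk _ this.1 this.2
      rw [← Function.iterate_succ_apply' σ k y, ← heq] at this
      omega
    have hcol : ∀ k, k + 2 ≤ n y → ori 1 (σ^[k] y) (σ^[k + 1] y) (σ^[k + 2] y) = 0 := by
      intro k hk
      have a1 := (hn y hy).2 k (by omega)
      have a2 := (hn y hy).2 (k + 1) (by omega)
      have := col _ a1.1 a1.2 (by rw [← Function.iterate_succ_apply' σ k y]; exact a2.2)
      rw [Function.iterate_succ_apply' σ (k + 1) y, Function.iterate_succ_apply' σ k y]
      exact this
    rcases Nat.eq_zero_or_pos (n y) with h0 | h0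
    · have e1 : l1 = 0 := by omega
      have e2 : l2 = 0 := by omega
      subst e1 e2
      simp
    · exact ori_line' (hne 0 h0) (iterate_line hne hcol h1) (iterate_line hne hcol h2)
        (iterate_line hne hcol h3)
  refine hM _ ((Finset.filter_subset _ _).trans hX) ?_
  intro a ha b hb c hc
  simp only [Finset.mem_filter] at ha hb hc
  obtain ⟨y, hy, h1, h2, h3⟩ : ∃ y ∈ X, (∃ l ≤ n y, a = σ^[l] y) ∧ (∃ l ≤ n y, b = σ^[l] y) ∧
      (∃ l ≤ n y, c = σ^[l] y) := by
    -- The longest of the three chains contains all three points.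
    rcases le_total (n a) (n b) with h1 | h1 <;> rcases le_total (n b) (n c) with h2 | h2 <;>
      rcases le_total (n a) (n c) with h3 | h3
    all_goals first
      | exact ⟨c, hc.1, iter a ha.1 c hc.1 (ha.2.trans hc.2.symm) (by omega), iter b hb.1 c hc.1 (hb.2.trans hc.2.symm) (by omega), iter c hc.1 c hc.1 rfl le_rfl⟩
      | exact ⟨b, hb.1, iter a ha.1 b hb.1 (ha.2.trans hb.2.symm) (by omega), iter b hb.1 b hb.1 rfl le_rfl, iter c hc.1 b hb.1 (hc.2.trans hb.2.symm) (by omega)⟩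
      | exact ⟨a, ha.1, iter a ha.1 a ha.1 rfl le_rfl, iter b hb.1 a ha.1 (hb.2.trans ha.2.symm) (by omega), iter c hc.1 a ha.1 (hc.2.trans ha.2.symm) (by omega)⟩
  exact line y hy a b c h1 h2 h3

end

/-! ### Counting the points of the outer layers -/

section

variable {P Q : Finset (ℝ × ℝ)} {e : ℝ} {i j k r M N m : ℕ}
  {z p p' q q' d x c x' c' y a b a' b' u v h s W E q'' w w' δ : ℝ × ℝ}

theorem sum_growth (hP : NoPent P) (hM : ColBound P M) (hz : z ∈ lay P r) (he : e ≠ 0)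
    (hi : i + m + M + 2 ≤ r) : ∑ j ∈ Finset.range m, (growth P e z (i + j)).card +
      (bd (lay P i)).card = (bd (lay P (i + m))).card := by
  induction m with
  | zero => simp
  | succ m ih =>
    have := card_growth (i := i + m) hP hM hz (by omega) (by omega) he
    have := ih (by omega)
    rw [Finset.sum_range_succ, ← Nat.add_assoc]
    omega

/-- Ends of runs are `growth` points, and `growth` telescopes to at most one layer size. -/
theorem sum_bottoms (hP : NoPent P) (hM : ColBound P M) (hz : z ∈ lay P r) (he : e ≠ 0)
    (hN : ∀ i, (bd (lay P i)).card ≤ N) (hi : m + M + 4 ≤ r) :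
    ∑ j ∈ Finset.range m, (zl P z j \ zu P z (j + 1)).card ≤ N := by
  have h1 := sum_growth (i := 0) (m := m) hP hM hz (neg_ne_zero.2 he) (by omega)
  have h2 : ∑ j ∈ Finset.range m, (zl P z j \ zu P z (j + 1)).card ≤
      ∑ j ∈ Finset.range m, (growth P (-e) z (0 + j)).card := by
    refine Finset.sum_le_sum fun j hj => Finset.card_le_card ?_
    rw [Nat.zero_add]
    have := Finset.mem_range.1 hj
    exact bottoms_subset hP hM hz (by omega) he
  have := hN (0 + m)
  omega

/-- Starts of runs are the ends plus the change in the number of alignments, at most `N + N`. -/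
theorem sum_tops (hP : NoPent P) (hM : ColBound P M) (hz : z ∈ lay P r) (he : e ≠ 0)
    (hN : ∀ i, (bd (lay P i)).card ≤ N) (hi : m + M + 4 ≤ r) :
    ∑ j ∈ Finset.range m, (zu P z (j + 1) \ zl P z j).card ≤ 2 * N := by
  have key : ∀ n, n ≤ m → ∑ j ∈ Finset.range n, (zu P z (j + 1) \ zl P z j).card +
      (zu P z 0).card = (zu P z n).card +
        ∑ j ∈ Finset.range n, (zl P z j \ zu P z (j + 1)).card := by
    intro n
    induction n with
    | zero => simp
    | succ n ih =>
      intro hn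
      have := ih (by omega)
      have := card_tops (i := n) (lay_anti P (by omega) hz)
      rw [Finset.sum_range_succ, Finset.sum_range_succ]
      omega
  have h1 := key m le_rfl
  have h2 := sum_bottoms hP hM hz he hN hi
  have h3 : (zu P z m).card ≤ N := (Finset.card_le_card fun p hp => (mem_zu.1 hp).1).trans (hN m)
  omega

theorem sum_unclean (hP : NoPent P) (hM : ColBound P M) (hz : z ∈ lay P r) (he : e ≠ 0)
    (hN : ∀ i, (bd (lay P i)).card ≤ N) (hi : m + M + 6 ≤ r) :
    ∑ j ∈ Finset.range m, (unclean P e z j).card ≤ 4 * N := by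
  have h1 := sum_growth (i := 0) (m := m) hP hM hz he (by omega)
  have h2 := sum_growth (i := 1) (m := m) hP hM hz he (by omega)
  have h3 := sum_tops hP hM hz he hN (m := m) (by omega)
  have h4 : ∑ j ∈ Finset.range m, (unclean P e z j).card ≤ ∑ j ∈ Finset.range m,
      ((zu P z (j + 1) \ zl P z j).card + (growth P e z (1 + j)).card +
        (growth P e z (0 + j)).card) := by
    refine Finset.sum_le_sum fun j hj => ?_
    have := Finset.mem_range.1 hj
    rw [Nat.zero_add, Nat.add_comm 1 j]
    exact card_unclean hP hM hz (by omega) he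
  rw [Finset.sum_add_distrib, Finset.sum_add_distrib] at h4
  have := hN (0 + m)
  have := hN (1 + m)
  omega

/-- The layer of a point. -/
noncomputable def lev (P : Finset (ℝ × ℝ)) (p : ℝ × ℝ) : ℕ :=
  if h : ∃ i, p ∈ bd (lay P i) then h.choose else 0

theorem lev_eq (h : p ∈ bd (lay P i)) : lev P p = i := by
  have ex : ∃ i, p ∈ bd (lay P i) := ⟨i, h⟩
  rw [lev, dif_pos ex]
  exact bd_lay_inj ex.choose_spec h

/-- The right end of the window of `p`. -/
noncomputable def rnext (P : Finset (ℝ × ℝ)) (e : ℝ) (z p : ℝ × ℝ) : ℝ × ℝ :=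
  if h : ∃ q' q, Win P e z (lev P p) p q q' then h.choose else p

theorem rnext_eq (hz : z ∈ lay P (i + 2)) (h : Win P e z i p q q') : rnext P e z p = q' := by
  have hl := lev_eq h.hp
  have ex : ∃ q' q, Win P e z (lev P p) p q q' := ⟨q', q, hl.symm ▸ h⟩
  rw [rnext, dif_pos ex]
  have key : ∀ w, (∃ q, Win P e z (lev P p) p q w) → w = q' := by
    rw [hl]
    rintro w ⟨q2, h2⟩
    exact (h2.window_unique (surr_of_lay (by omega) hz) h).2
  exact key _ ex.choose_spec

/-- The points of the first `m` layers with a property. -/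
noncomputable def upto (P : Finset (ℝ × ℝ)) (m : ℕ) (f : ℕ → ℝ × ℝ → Prop) : Finset (ℝ × ℝ) :=
  (Finset.range m).biUnion fun i => (bd (lay P i)).filter (f i)

theorem mem_upto {f : ℕ → ℝ × ℝ → Prop} :
    p ∈ upto P m f ↔ ∃ i < m, p ∈ bd (lay P i) ∧ f i p := by
  simp [upto]

theorem upto_subset {f : ℕ → ℝ × ℝ → Prop} : upto P m f ⊆ P := by
  intro p hp
  obtain ⟨i, -, h, -⟩ := mem_upto.1 hp
  exact bd_lay_subset h

theorem XS.not_zu (hz : z ∈ lay P (i + 2)) (h : XS P e z i p) : p ∈ bd (lay P i) \ zu P z i := by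
  have sz : Surr (lay P (i + 1)) z := surr_of_lay (by omega) hz
  obtain ⟨q, q', d, hw, -⟩ := h
  refine Finset.mem_sdiff.2 ⟨hw.hp, fun hn => ?_⟩
  obtain ⟨-, c, hc, hr⟩ := mem_zu.1 hn
  have := hw.ed.next c hc (hr.pos' hw.h1)
  linarith [hr.pos hw.h2]

/-- `XS.step` makes `rnext` a chain map in the sense of `chain_card`: it preserves `XS`, produces
collinear triples and is injective by `Win.unique`. -/
theorem card_XS (hP : NoPent P) (hM : ColBound P M) (hz : z ∈ lay P r) (he : e ≠ 0)
    (hN : ∀ i, (bd (lay P i)).card ≤ N) (hi : m + 3 * M + 19 ≤ r) :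
    (upto P m (XS P e z)).card ≤ M * (9 * N) := by
  have hzP := lay_subset P _ hz
  have hz2 : ∀ m, m ≤ r → z ∈ lay P m := fun m hm => lay_anti P hm hz
  set X := upto P m (XS P e z) with hX
  set T := X.filter fun p => lev P p + 1 = m ∨ ¬ CleanR P e z (lev P p) p ∨
    ¬ CleanR P (-e) z (lev P p) p with hT
  -- Chains end in the last layer considered, at most `N` points, or at points unclean for `e` or
  -- for `-e`, at most `4 N` each.
  have hTc : T.card ≤ 9 * N := by
    have sub : T ⊆ bd (lay P (m - 1)) ∪ ((Finset.range m).biUnion (unclean P e z) ∪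
        (Finset.range m).biUnion (unclean P (-e) z)) := by
      intro p hp
      simp only [hT, hX, Finset.mem_filter, mem_upto] at hp
      obtain ⟨⟨i, him, hpi, hxs⟩, h⟩ := hp
      rw [lev_eq hpi] at h
      have hnz := hxs.not_zu (hz2 _ (by omega))
      simp only [Finset.mem_union, Finset.mem_biUnion, Finset.mem_range, unclean,
        Finset.mem_filter]
      rcases h with h | h | h
      · left
        have : m - 1 = i := by omega
        rw [this]; exact hpi
      · exact Or.inr (Or.inl ⟨i, him, hnz, h⟩)
      · exact Or.inr (Or.inr ⟨i, him, hnz, h⟩)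
    have h1 := Finset.card_le_card sub
    have h2 := Finset.card_union_le (bd (lay P (m - 1))) ((Finset.range m).biUnion (unclean P e z) ∪
        (Finset.range m).biUnion (unclean P (-e) z))
    have h3 := Finset.card_union_le ((Finset.range m).biUnion (unclean P e z))
        ((Finset.range m).biUnion (unclean P (-e) z))
    have h4 := (Finset.card_biUnion_le (s := Finset.range m) (t := unclean P e z)).trans
      (sum_unclean hP hM hz he hN (m := m) (by omega))
    have h5 := (Finset.card_biUnion_le (s := Finset.range m) (t := unclean P (-e) z)).trans
      (sum_unclean hP hM hz (neg_ne_zero.2 he) hN (m := m) (by omega))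
    have := hN (m - 1)
    omega
  have good : ∀ x ∈ X, x ∉ T → ∃ i q q' c', i + 1 < m ∧ Win P e z i x q q' ∧
      (∃ d, Win P e z (i + 1) q' d c') ∧ XS P e z (i + 1) q' ∧ ori e x q' c' = 0 := by
    intro x hx hxT
    have hx' := hx
    simp only [hX, mem_upto] at hx'
    obtain ⟨i, him, hxi, hxs⟩ := hx'
    have hl := lev_eq hxi
    simp only [hT, Finset.mem_filter, hx, true_and, hl, not_or, not_not] at hxT
    obtain ⟨h1, ⟨q, q', d, p', q'', c', s, hc⟩, ⟨a1, a2, a3, a4, a5, a6, a7, hc'⟩⟩ := hxT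
    have sz1 : Surr (lay P (i + 1)) z := surr_of_lay (by omega) hz
    obtain ⟨rfl, rfl⟩ := hc'.win.window_unique sz1 hc.win.mirror
    obtain rfl := hc'.ap.unique hc.ap.mirror
    have := hxs.step hP hM hz (by omega) hc hc'
    exact ⟨i, a2, a1, c', by omega, hc.win, ⟨a3, hc.winR⟩, this.1, this.2⟩
  refine (chain_card hM (X := X) (T := T) (m := m) upto_subset (rnext P e z) (lev P) ?_ ?_ ?_ ?_ ?_).trans
    (Nat.mul_le_mul_left M hTc)
  · intro x hx hxT
    obtain ⟨i, q, q', c', him, hw, -, hxs, -⟩ := good x hx hxT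
    rw [rnext_eq (hz2 _ (by omega)) hw]
    exact mem_upto.2 ⟨i + 1, him, hw.ed.hb, hxs⟩
  · intro x hx hxT y hy hyT hxy
    obtain ⟨i, q, q', c', him, hw, -, hxs, -⟩ := good x hx hxT
    obtain ⟨i2, q2, q2', c2', him2, hw2, -, hxs2, -⟩ := good y hy hyT
    rw [rnext_eq (hz2 _ (by omega)) hw, rnext_eq (hz2 _ (by omega)) hw2] at hxy
    subst hxy
    have := bd_lay_inj hw.ed.hb hw2.ed.hb
    obtain rfl : i = i2 := by omega
    have sz1 : Surr (lay P (i + 1)) z := surr_of_lay (by omega) hz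
    obtain rfl := hw.ed.left_unique sz1 hw2.ed
    exact Win.unique hP hzP sz1 hw hw2
  · intro x hx hxT
    obtain ⟨i, q, q', c', him, hw, -, hxs, -⟩ := good x hx hxT
    rw [rnext_eq (hz2 _ (by omega)) hw, lev_eq hw.hp, lev_eq hw.ed.hb]
  · intro x hx
    simp only [hX, mem_upto] at hx
    obtain ⟨i, him, hxi, hxs⟩ := hx
    rw [lev_eq hxi]; exact him
  · intro x hx hxT hyT
    obtain ⟨i, q, q', c', him, hw, ⟨d, hw'⟩, hxs, h0⟩ := good x hx hxT
    rw [rnext_eq (hz2 _ (by omega)) hw, rnext_eq (hz2 _ (by omega)) hw']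
    have e1 : ori e x q' c' = e * ori 1 x q' c' := by unfold ori; ring
    rw [e1] at h0
    exact (mul_eq_zero.1 h0).resolve_left he

/-- The point of the next layer on the ray of `p`. -/
noncomputable def znext (P : Finset (ℝ × ℝ)) (z p : ℝ × ℝ) : ℝ × ℝ :=
  if h : ∃ c ∈ bd (lay P (lev P p + 1)), Ray z p c then h.choose else p

theorem znext_eq (hz : z ∈ lay P (i + 2)) (hp : p ∈ bd (lay P i)) (hc : c ∈ bd (lay P (i + 1)))
    (h : Ray z p c) : znext P z p = c := by
  have hl := lev_eq hp
  have ex : ∃ c ∈ bd (lay P (lev P p + 1)), Ray z p c := ⟨c, hl.symm ▸ hc, h⟩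
  rw [znext, dif_pos ex]
  have key : ∀ w, (w ∈ bd (lay P (lev P p + 1)) ∧ Ray z p w) → w = c := by
    rw [hl]
    rintro w ⟨h1, h2⟩
    exact bd_ray_unique (surr_of_lay (by omega) hz) h1 hc (h2.symm.trans h)
  exact key _ ex.choose_spec

/-- Here the chains are the runs of alignments along rays; they end in the last layer considered or
at one of the at most `N` bottoms. -/
theorem card_zu (hP : NoPent P) (hM : ColBound P M) (hz : z ∈ lay P r)
    (hN : ∀ i, (bd (lay P i)).card ≤ N) (hi : m + M + 4 ≤ r) :
    (upto P m fun i p => p ∈ zu P z i).card ≤ M * (2 * N) := by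
  have hz2 : ∀ m, m ≤ r → z ∈ lay P m := fun m hm => lay_anti P hm hz
  set X := upto P m (fun i p => p ∈ zu P z i) with hX
  set T := X.filter fun p => lev P p + 1 = m ∨ znext P z p ∉ zu P z (lev P p + 1) with hT
  have good : ∀ x ∈ X, ∃ i c, i < m ∧ x ∈ bd (lay P i) ∧ c ∈ bd (lay P (i + 1)) ∧ Ray z x c ∧
      znext P z x = c := by
    intro x hx
    simp only [hX, mem_upto, mem_zu] at hx
    obtain ⟨i, him, hxi, -, c, hc, hr⟩ := hx
    exact ⟨i, c, him, hxi, hc, hr, znext_eq (hz2 _ (by omega)) hxi hc hr⟩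
  have good2 : ∀ x ∈ X, x ∉ T → lev P x + 1 < m ∧ znext P z x ∈ zu P z (lev P x + 1) := by
    intro x hx hxT
    simp only [hT, Finset.mem_filter, hx, true_and, not_or, not_not] at hxT
    obtain ⟨i, c, him, hxi, hc, hr, hn⟩ := good x hx
    have := lev_eq hxi
    exact ⟨by omega, hxT.2⟩
  have inj : ∀ x ∈ X, ∀ y ∈ X, znext P z x = znext P z y → x = y := by
    intro x hx y hy hxy
    obtain ⟨i, c, him, hxi, hc, hr, hn⟩ := good x hx
    obtain ⟨i2, c2, him2, hxi2, hc2, hr2, hn2⟩ := good y hy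
    rw [hn, hn2] at hxy
    subst hxy
    have := bd_lay_inj hc hc2
    obtain rfl : i = i2 := by omega
    exact bd_ray_unique (surr_of_lay (by omega) hz) hxi hxi2 (hr.trans hr2.symm)
  have hTc : T.card ≤ 2 * N := by
    have sub : T ⊆ bd (lay P (m - 1)) ∪ T.filter (fun x => znext P z x ∉ zu P z (lev P x + 1)) := by
      intro x hx
      have hx' := hx
      rw [hT, Finset.mem_filter] at hx'
      rcases hx'.2 with h | h
      · obtain ⟨i, c, him, hxi, hc, hr, hn⟩ := good x hx'.1
        rw [lev_eq hxi] at h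
        have : m - 1 = i := by omega
        rw [this]
        exact Finset.mem_union_left _ hxi
      · refine Finset.mem_union_right _ ?_
        simp only [Finset.mem_filter]
        exact ⟨hx, h⟩
    have h1 := (Finset.card_le_card sub).trans (Finset.card_union_le _ _)
    have h2 : (T.filter (fun x => znext P z x ∉ zu P z (lev P x + 1))).card ≤
        ((Finset.range m).biUnion fun j => zl P z j \ zu P z (j + 1)).card := by
      refine Finset.card_le_card_of_injOn (znext P z) ?_ ?_
      · intro x hx
        simp only [Finset.coe_filter, Set.mem_ofPred_eq, hT, Finset.mem_filter] at hx
        obtain ⟨i, c, him, hxi, hc, hr, hn⟩ := good x hx.1.1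
        rw [lev_eq hxi, hn] at hx
        rw [hn]
        simp only [Finset.coe_biUnion, Set.mem_iUnion, Finset.mem_coe]
        exact ⟨i, Finset.mem_range.2 him, Finset.mem_sdiff.2 ⟨mem_zl.2 ⟨hc, x, hxi, hr⟩, hx.2⟩⟩
      · intro x hx y hy hxy
        simp only [Finset.coe_filter, Set.mem_ofPred_eq, hT, Finset.mem_filter] at hx hy
        exact inj x hx.1.1 y hy.1.1 hxy
    have h3 := Finset.card_biUnion_le (s := Finset.range m) (t := fun j => zl P z j \ zu P z (j + 1))
    have h4 := sum_bottoms (e := 1) (m := m) hP hM hz one_ne_zero hN (by omega)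
    have := hN (m - 1)
    omega
  refine (chain_card hM (X := X) (T := T) (m := m) upto_subset (znext P z) (lev P) ?_ ?_ ?_ ?_ ?_).trans
    (Nat.mul_le_mul_left M hTc)
  · intro x hx hxT
    have := good2 x hx hxT
    exact mem_upto.2 ⟨_, this.1, (mem_zu.1 this.2).1, this.2⟩
  · exact fun x hx _ y hy _ h => inj x hx y hy h
  · intro x hx hxT
    obtain ⟨i, c, him, hxi, hc, hr, hn⟩ := good x hx
    rw [hn, lev_eq hxi, lev_eq hc]
  · intro x hx
    obtain ⟨i, c, him, hxi, hc, hr, hn⟩ := good x hx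
    rw [lev_eq hxi]; exact him
  · intro x hx hxT hyT
    have g2 := good2 x hx hxT
    obtain ⟨i, c, him, hxi, hc, hr, hn⟩ := good x hx
    rw [lev_eq hxi] at g2
    have hcX : znext P z x ∈ X := mem_upto.2 ⟨_, g2.1, (mem_zu.1 g2.2).1, g2.2⟩
    obtain ⟨i2, c2, him2, hxi2, hc2, hr2, hn2⟩ := good _ hcX
    rw [hn2]
    rw [hn] at hr2 ⊢
    exact ori_of_ray (Ray.refl z x) hr (hr.trans hr2)

/-- A point is aligned with the next layer or is `XS` for one of the two orientations: `2 N + 9 N +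
9 N` chains suffice. -/
theorem card_upper_layers (hP : NoPent P) (hM : ColBound P M) (hz : z ∈ lay P r)
    (hN : ∀ i, (bd (lay P i)).card ≤ N) (hi : m + 3 * M + 19 ≤ r) :
    (upto P m fun _ _ => True).card ≤ M * (20 * N) := by
  have h1 := card_XS (e := 1) hP hM hz one_ne_zero hN hi
  have h2 := card_XS (e := -1) hP hM hz (by norm_num) hN hi
  have h3 := card_zu hP hM hz hN (m := m) (by omega)
  have sub : (upto P m fun _ _ => True) ⊆ (upto P m fun i p => p ∈ zu P z i) ∪
      (upto P m (XS P 1 z) ∪ upto P m (XS P (-1) z)) := by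
    intro p hp
    obtain ⟨i, him, hpi, -⟩ := mem_upto.1 hp
    simp only [Finset.mem_union, mem_upto]
    by_cases hzu : p ∈ zu P z i
    · exact Or.inl ⟨i, him, hpi, hzu⟩
    · obtain ⟨q, q', hw⟩ := exists_win (e := 1) (lay_anti P (by omega) hz) one_ne_zero
        (Finset.mem_sdiff.2 ⟨hpi, hzu⟩)
      rcases XS.or hP hM hz (by omega) hw with h | h
      · exact Or.inr (Or.inl ⟨i, him, hpi, h⟩)
      · exact Or.inr (Or.inr ⟨i, him, hpi, h⟩)
  have h4 := (Finset.card_le_card sub).trans (Finset.card_union_le _ _)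
  have h5 := Finset.card_union_le (upto P m (XS P 1 z)) (upto P m (XS P (-1) z))
  nlinarith

end

/-! ### Boundary points on a common supporting line -/

section

variable {P Q L : Finset (ℝ × ℝ)} {e : ℝ} {M : ℕ} {z a b c d f u v w x y : ℝ × ℝ}

theorem sq_dist_pos (hab : a ≠ b) : 0 < (b.1 - a.1) ^ 2 + (b.2 - a.2) ^ 2 := by
  by_contra hn
  have h1 : b.1 - a.1 = 0 := by nlinarith [sq_nonneg (b.1 - a.1), sq_nonneg (b.2 - a.2)]
  have h2 : b.2 - a.2 = 0 := by nlinarith [sq_nonneg (b.1 - a.1), sq_nonneg (b.2 - a.2)]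
  exact hab (Prod.ext (by linarith) (by linarith))

theorem dt_bary (e : ℝ) (a b c v u x : ℝ × ℝ) : ori e a b c * dt v u x =
    ori e b c x * dt v u a + ori e c a x * dt v u b + ori e a b x * dt v u c := by
  unfold ori dt; ring

theorem dt_self (v x : ℝ × ℝ) : dt v x x = 0 := by unfold dt; ring

theorem tri_not_separated (h : 0 < ori e a b c) (h1 : 0 ≤ ori e a b x) (h2 : 0 ≤ ori e b c x)
    (h3 : 0 ≤ ori e c a x) (ha : 0 < dt v x a) (hb : 0 < dt v x b) (hc : 0 < dt v x c) :
    False := by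
  have h0 := dt_bary e a b c v x x
  have hs : ori e a b c = ori e a b x + ori e b c x + ori e c a x := by unfold ori; ring
  rw [dt_self, mul_zero] at h0
  have t1 := mul_nonneg h2 ha.le
  have t2 := mul_nonneg h3 hb.le
  have t3 := mul_nonneg h1 hc.le
  have s1 : ori e b c x = 0 := (mul_eq_zero.1 (le_antisymm (by linarith) t1)).resolve_right ha.ne'
  have s2 : ori e c a x = 0 := (mul_eq_zero.1 (le_antisymm (by linarith) t2)).resolve_right hb.ne'
  have s3 : ori e a b x = 0 := (mul_eq_zero.1 (le_antisymm (by linarith) t3)).resolve_right hc.ne'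
  linarith

/-- A subset whose complement consists of points separable from it inherits the absence of empty
pentagons. -/
theorem NoPent.island (hP : NoPent P) (hQ : Q ⊆ P)
    (h : ∀ x ∈ P, x ∉ Q → ∃ v : ℝ × ℝ, ∀ y ∈ Q, 0 < dt v x y) : NoPent Q := by
  intro e a ha b hb c hc d hd f hf abc abd abf acd acf adf bcd bcf bdf cdf
  obtain ⟨x, hx, xa, xb, xc, xd, xf, k1, k2, k3, k4, k5⟩ := hP e a (hQ ha) b (hQ hb) c (hQ hc) d
    (hQ hd) f (hQ hf) abc abd abf acd acf adf bcd bcf bdf cdf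
  by_cases hxQ : x ∈ Q
  · exact ⟨x, hxQ, xa, xb, xc, xd, xf, k1, k2, k3, k4, k5⟩
  · exfalso
    obtain ⟨v, hv⟩ := h x hx hxQ
    rcases le_or_gt 0 (ori e c a x) with h1 | h1
    · exact tri_not_separated abc k1 k2 h1 (hv a ha) (hv b hb) (hv c hc)
    · rcases le_or_gt 0 (ori e d a x) with h2 | h2
      · exact tri_not_separated acd (by rw [ori_swap]; linarith) k3 h2 (hv a ha) (hv c hc) (hv d hd)
      · exact tri_not_separated adf (by rw [ori_swap]; linarith) k4 k5 (hv a ha) (hv d hd) (hv f hf)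

theorem NoPent.sdiff_bd (hP : NoPent P) : NoPent (P \ bd P) := by
  refine hP.island Finset.sdiff_subset fun x hx hxQ => ?_
  have hxb : x ∈ bd P := by
    by_contra hn
    exact hxQ (Finset.mem_sdiff.2 ⟨hx, hn⟩)
  obtain ⟨v, -, hv⟩ := exists_support hxb
  exact ⟨v, fun y hy => hv y (surr_of_mem_sdiff hy)⟩

theorem NoPent.lay (hP : NoPent P) (i : ℕ) : NoPent (lay P i) := by
  induction i with
  | zero => exact hP
  | succ i ih => exact ih.sdiff_bd

theorem ColBound.mono (hM : ColBound P M) (hQ : Q ⊆ P) : ColBound Q M :=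
  fun S hS h => hM S (hS.trans hQ) h

theorem bd_mono (hQ : Q ⊆ P) (ha : a ∈ bd P) (haQ : a ∈ Q) : a ∈ bd Q := by
  simp only [bd, Finset.mem_filter] at ha ⊢
  obtain ⟨-, v, hv, h⟩ := ha
  exact ⟨haQ, v, hv, fun x hx => h x (hQ hx)⟩

theorem mem_bd_of_side (hab : a ≠ b) (he : e ≠ 0) (hx : x ∈ Q) (h0 : ori e a b x = 0)
    (h : ∀ u ∈ Q, 0 ≤ ori e a b u) : x ∈ bd Q := by
  simp only [bd, Finset.mem_filter]
  refine ⟨hx, (-(e * (b.2 - a.2)), e * (b.1 - a.1)), ?_, fun u hu => ?_⟩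
  · intro hv
    rw [Prod.mk_eq_zero] at hv
    have h1 := (mul_eq_zero.1 (neg_eq_zero.1 hv.1)).resolve_left he
    have h2 := (mul_eq_zero.1 hv.2).resolve_left he
    exact hab (Prod.ext (by linarith) (by linarith))
  · have := h u hu
    unfold ori dt at *
    simp only
    linarith

theorem pos_of_side (hab : a ≠ b) (he : e ≠ 0) (h : ∀ u ∈ Q, 0 ≤ ori e a b u) (hz : Surr Q z) :
    0 < ori e a b z := by
  obtain ⟨x, hx, hlt⟩ := hz (-(e * (b.2 - a.2)), e * (b.1 - a.1)) (by
    intro hv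
    rw [Prod.mk_eq_zero] at hv
    have h1 := (mul_eq_zero.1 (neg_eq_zero.1 hv.1)).resolve_left he
    have h2 := (mul_eq_zero.1 hv.2).resolve_left he
    exact hab (Prod.ext (by linarith) (by linarith)))
  have := h x hx
  unfold ori dt at *
  simp only at hlt
  linarith

/-- `a` and `b` lie on a common supporting line of `Q` (or coincide). -/
def Cos (Q : Finset (ℝ × ℝ)) (a b : ℝ × ℝ) : Prop := ∃ e : ℝ, e ≠ 0 ∧ ∀ u ∈ Q, 0 ≤ ori e a b u

theorem Cos.refl (Q : Finset (ℝ × ℝ)) (a : ℝ × ℝ) : Cos Q a a := ⟨1, one_ne_zero, fun u _ => by simp⟩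

theorem Cos.symm (h : Cos Q a b) : Cos Q b a := by
  obtain ⟨e, he, h⟩ := h
  exact ⟨-e, neg_ne_zero.2 he, fun u hu => by rw [ori_neg']; exact h u hu⟩

/-- Otherwise an end of the chord would be a convex combination of `x`, the other end and the
interior point `g`, with positive weight on `g`. -/
theorem beyond_chord {w' g : ℝ × ℝ} (hw : w ∈ bd Q) (hw' : w' ∈ bd Q) (hg : Surr Q g)
    (h : 0 < ori e w w' g) (hx : x ∈ Q) (hb : ori e w w' x < 0) :
    0 < ori e w x g ∧ 0 < ori e x w' g := by
  constructor
  · by_contra hn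
    refine bd_not_comb (e := e) hw (Or.inl hx) (Or.inl (mem_of_bd hw')) hg h.le ?_ ?_
    · rw [ori_swap]; linarith
    · unfold ori at *; linarith
  · by_contra hn
    refine bd_not_comb (e := e) hw' (Or.inl (mem_of_bd hw)) (Or.inl hx) hg ?_ h.le ?_
    · rw [ori_swap]; linarith
    · unfold ori at *; linarith

/-- If `e₁ w w' e₂` is a convex quadrilateral with `w, w'` on the boundary of `Q`, `e₁` interior,
then no point of `Q` lies beyond the chord `w w'`, since it would complete an empty pentagon. -/
theorem chord_side {w' e₁ e₂ : ℝ × ℝ} (hQ : NoPent Q) (hw : w ∈ bd Q) (hw' : w' ∈ bd Q)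
    (h₁ : e₁ ∈ Q) (s₁ : Surr Q e₁) (h₂ : e₂ ∈ Q) (k1 : 0 < ori e w w' e₁) (k2 : 0 < ori e w w' e₂)
    (k3 : 0 < ori e e₂ e₁ w) (k4 : 0 < ori e e₂ e₁ w')
    (te : ∀ y ∈ Q, 0 ≤ ori e e₁ w' y → 0 ≤ ori e w' e₂ y → 0 ≤ ori e e₂ e₁ y →
      y = e₁ ∨ y = w' ∨ y = e₂)
    (hL : ∀ y ∈ Q \ bd Q, ori e e₂ e₁ y ≤ 0)
    (hx : ∀ x ∈ Q, ori e w w' x < 0 → 0 < ori e w x e₂ ∧ 0 < ori e x w' e₂) :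
    ∀ x ∈ Q, 0 ≤ ori e w w' x := by
  by_contra! hn
  obtain ⟨x, hxQ, hxn⟩ := hn
  -- Choose `x` nearest to the chord among the points beyond it. Then `e₁ w x w' e₂` is a convex
  -- pentagon, and the extra point `y` in it is not beyond the chord.
  obtain ⟨x, hx', hmax⟩ := Finset.exists_max_image (Q.filter fun x => ori e w w' x < 0)
    (fun x => ori e w w' x) ⟨x, by simp [*]⟩
  clear hxQ hxn
  simp only [Finset.mem_filter] at hx' hmax
  obtain ⟨hxQ, hxn⟩ := hx'
  obtain ⟨l1, l2⟩ := beyond_chord hw hw' s₁ k1 hxQ hxn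
  obtain ⟨l3, l4⟩ := hx x hxQ hxn
  have l5 : 0 < ori e e₁ x e₂ := by
    have := ori_gp e e₁ w x w' e₂
    have t1 : 0 < ori e e₁ w x := rotP' l1
    have t2 : 0 < ori e e₁ w' e₂ := rotP k4
    have t3 : 0 < ori e e₁ w e₂ := rotP k3
    have t4 : 0 < ori e e₁ x w' := rotP' l2
    have t5 : 0 < ori e e₁ w w' := rotP' k1
    by_contra hn
    nlinarith [mul_pos t1 t2, mul_pos t3 t4, mul_nonneg t5.le (neg_nonneg.2 (not_lt.1 hn))]
  obtain ⟨y, hy, y1, y2, y3, y4, y5, m1, m2, m3, m4, m5⟩ := hQ e e₁ h₁ w (mem_of_bd hw) x hxQ w'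
    (mem_of_bd hw') e₂ h₂ (rotP' l1) (rotP' k1) (rotP k3) (rotP' l2) l5 (rotP k4)
    (by unfold ori at *; linarith) l3 k2 l4
  have n1 : ori e e₁ w' y < 0 := by
    by_contra hn
    have := te y hy (not_lt.1 hn) m4 m5
    tauto
  have n2 : 0 ≤ ori e w w' y := by
    by_contra hn
    have hle := hmax y ⟨hy, not_le.1 hn⟩
    have hs : ori e w w' y = ori e w w' x + ori e w x y + ori e x w' y := by unfold ori; ring
    refine y3 (eq_of_ori_eq_zero (e := e) (a := x) (b := w) (c := w') ?_ ?_ ?_)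
    · have : ori e x w w' = ori e w w' x := by unfold ori; ring
      rw [this]; exact hxn.ne
    · rw [ori_swap]; linarith
    · linarith
  -- A boundary point `y` would be a convex combination with weight on `e₁`, or coincide with `w`;
  -- an inner one contradicts that the inner set is on one side of `e₁ e₂`.
  by_cases hyb : y ∈ bd Q
  · rcases le_total 0 (ori e e₁ x y) with h | h
    · rcases m3.lt_or_eq with h' | h'
      · exact bd_not_comb (e := e) hyb (Or.inl hxQ) (Or.inl (mem_of_bd hw')) s₁
          (by unfold ori at *; linarith) (rotN h) h'
      · have := ori_bary e e₁ x w' w w' y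
        simp only [ori_right, mul_zero, add_zero, ← h', zero_mul, zero_add, ori_mid] at this
        have t4 : 0 < ori e e₁ x w' := rotP' l2
        have t5 : 0 < ori e w' e₁ y := by rw [ori_swap]; linarith
        nlinarith [mul_nonneg t4.le n2, mul_pos t5 (neg_pos.2 hxn)]
    · rcases m2.lt_or_eq with h' | h'
      · exact bd_not_comb (e := e) hyb (Or.inl (mem_of_bd hw)) (Or.inl hxQ) s₁
          (by unfold ori at *; linarith) (rotN m1) h'
      · have t4 : 0 < ori e e₁ w x := rotP' l1
        have e1 := ori_bary e e₁ w x w w' y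
        have e2 := ori_bary e e₁ w x e₁ w' y
        simp only [ori_right, mul_zero, add_zero, ← h', zero_mul, zero_add, ori_mid, ori_left]
          at e1 e2
        have t5 : 0 ≤ ori e x e₁ y := by rw [ori_swap]; linarith
        have t6 : ori e e₁ w' w < 0 := by unfold ori at *; linarith
        have t7 : ori e e₁ w' x < 0 := by unfold ori at *; linarith
        have t8 : ori e e₁ w y = 0 := by
          have := mul_nonneg t4.le n2
          have := mul_nonneg m1 (neg_pos.2 hxn).le
          exact (mul_eq_zero.1 (show ori e e₁ w y * ori e w w' x = 0 by linarith)).resolve_right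
            hxn.ne
        exact y2 (eq_of_ori_eq_zero (e := e) (a := w) (b := e₁) (c := x)
          (by have : ori e w e₁ x = - ori e e₁ w x := by unfold ori; ring
              rw [this]; linarith)
          (by rw [ori_swap]; linarith) h'.symm)
  · have h0 := hL y (Finset.mem_sdiff.2 ⟨hy, hyb⟩)
    have e1 := ori_gp e e₁ w w' e₂ y
    have h0' : ori e e₁ e₂ y = 0 := by
      have : ori e e₁ e₂ y = - ori e e₂ e₁ y := by rw [ori_swap]
      linarith
    rw [h0'] at e1
    have t2 : 0 < ori e e₁ w' e₂ := rotP k4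
    have t3 : 0 < ori e e₁ w e₂ := rotP k3
    nlinarith [mul_pos t3 (neg_pos.2 n1), mul_nonneg m1 t2.le]

/-- The point of `L` closest to `a` on the ray from `a` through `b`. -/
theorem exists_adjacent (hb : b ∈ L) (hab : a ≠ b) : ∃ c ∈ L, (∃ t : ℝ, 0 < t ∧
    c = (a.1 + t * (b.1 - a.1), a.2 + t * (b.2 - a.2))) ∧
    ∀ y ∈ L, ∀ t : ℝ, 0 ≤ t → t ≤ 1 → y = (a.1 + t * (c.1 - a.1), a.2 + t * (c.2 - a.2)) →
      y = a ∨ y = c := by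
  obtain ⟨c, hc, hmin⟩ := Finset.exists_min_image (L.filter fun c => ∃ t : ℝ, 0 < t ∧
    c = (a.1 + t * (b.1 - a.1), a.2 + t * (b.2 - a.2))) (fun c => dt (b - a) a c)
    ⟨b, by simp only [Finset.mem_filter]; exact ⟨hb, 1, one_pos, by simp⟩⟩
  simp only [Finset.mem_filter] at hc hmin
  obtain ⟨hc, t, ht, rfl⟩ := hc
  refine ⟨_, hc, ⟨t, ht, rfl⟩, fun y hy s hs hs1 hys => ?_⟩
  simp only [add_sub_cancel_left] at hys
  rcases hs.lt_or_eq with h | h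
  · right
    have := hmin y ⟨hy, s * t, mul_pos h ht, by rw [hys]; simp only [mul_assoc]⟩
    have hpos := sq_dist_pos hab
    rw [hys] at this
    unfold dt at this
    simp only [Prod.fst_sub, Prod.snd_sub, add_sub_cancel_left] at this
    have h3 : t * ((b.1 - a.1) ^ 2 + (b.2 - a.2) ^ 2) * (1 - s) ≤ 0 := by linarith
    have : s = 1 := by
      have := mul_pos ht hpos
      by_contra hne
      have : 0 < 1 - s := by
        rcases hs1.lt_or_eq with h | h
        · linarith
        · exact absurd h hne
      nlinarith
    rw [hys, this]; simp
  · left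
    rw [hys, ← h]; simp

/-- Replace `b` by the inner point `c` next to `a` on the line. The chord `w w'` and the segment `a
c` span a convex quadrilateral whose relevant triangle is empty, and `chord_side` makes the chord a
side of the hull. -/
theorem cos_of_beyond {w' : ℝ × ℝ} (hQ : NoPent Q) (ha : a ∈ Q \ bd Q) (hb : b ∈ Q \ bd Q)
    (h : ∀ u ∈ Q \ bd Q, 0 ≤ ori e a b u) (hw : w ∈ bd Q) (hw' : w' ∈ bd Q)
    (h1 : ori e a b w < 0) (h2 : ori e a b w' < 0) : Cos Q w w' := by
  have hab : a ≠ b := by rintro rfl; simp at h1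
  have he : e ≠ 0 := by rintro rfl; simp [ori] at h1
  by_cases hww : w = w'
  · rw [hww]; exact Cos.refl _ _
  obtain ⟨c, hc, ⟨t, ht, hct⟩, hadj⟩ := exists_adjacent hb hab
  have hori : ∀ x, ori e a c x = t * ori e a b x := fun x => by rw [hct]; unfold ori; simp only; ring
  have h' : ∀ u ∈ Q \ bd Q, 0 ≤ ori e a c u := fun u hu => by
    rw [hori]; exact mul_nonneg ht.le (h u hu)
  have h1' : ori e a c w < 0 := by rw [hori]; exact mul_neg_of_pos_of_neg ht h1
  have h2' : ori e a c w' < 0 := by rw [hori]; exact mul_neg_of_pos_of_neg ht h2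
  have sa := surr_of_mem_sdiff ha
  have sc := surr_of_mem_sdiff hc
  have haQ := (Finset.mem_sdiff.1 ha).1
  have hcQ := (Finset.mem_sdiff.1 hc).1
  clear hori hct h h1 h2 hb
  -- the chord does not meet the side
  have split : ∀ w w', w ∈ bd Q → w' ∈ bd Q → w ≠ w' → ori e a c w < 0 → ori e a c w' < 0 →
      0 ≤ ori e w w' a → ori e w w' c ≤ 0 → False := by
    intro w w' hw hw' hne h1 h2 k1 k2
    rcases k2.lt_or_eq with k2 | k2
    · refine bd_not_comb (e := e) (x := w) (y := c) (w := a) hw' (Or.inl (mem_of_bd hw))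
        (Or.inl hcQ) sa ?_ k1 ?_
      · unfold ori at *; linarith
      · rw [ori_swap']; linarith
    · rcases k1.lt_or_eq with k1 | k1
      · refine bd_not_comb (e := e) (x := a) (y := w) (w := c) hw' (Or.inl haQ)
          (Or.inl (mem_of_bd hw)) sc ?_ ?_ ?_
        · rw [ori_swap]; linarith
        · unfold ori at *; linarith
        · unfold ori at *; linarith
      · have e1 := eq_of_ori_eq_zero (e := e) (a := w) (b := a) (c := c) (x := w')
          (by rw [← ori_rot]; exact h1.ne) (by rw [ori_swap']; linarith) (by rw [ori_swap']; linarith)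
        exact hne e1.symm
  have main : ∀ w w', w ∈ bd Q → w' ∈ bd Q → w ≠ w' → ori e a c w < 0 → ori e a c w' < 0 →
      0 < ori e w w' a → 0 < ori e w w' c → Cos Q w w' := by
    intro w w' hw hw' hne h1 h2 k1 k2
    refine ⟨e, he, chord_side hQ hw hw' haQ sa hcQ k1 k2 (by rw [ori_swap]; linarith)
      (by rw [ori_swap]; linarith) (fun y hy y1 y2 y3 => ?_)
      (fun y hy => by have := h' y hy; rw [ori_swap]; linarith)
      (fun x hx hxn => beyond_chord hw hw' sc k2 hx hxn)⟩
    have hT : 0 < ori e a w' c := by rw [ori_swap']; linarith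
    by_cases hyb : y ∈ bd Q
    · right; left
      have z1 : ori e a w' y = 0 := by
        by_contra hn
        exact bd_not_comb (e := e) hyb (Or.inl haQ) (Or.inl (mem_of_bd hw')) sc (rotN' y2)
          (rotN y3) (lt_of_le_of_ne y1 (Ne.symm hn))
      have z2 : ori e w' c y = 0 := by
        by_contra hn
        exact bd_not_comb (e := e) hyb (Or.inl (mem_of_bd hw')) (Or.inl hcQ) sa (rotN' y3)
          (rotN y1) (lt_of_le_of_ne y2 (Ne.symm hn))
      exact eq_of_ori_eq_zero (e := e) (a := w') (b := a) (c := c)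
        (by rw [ori_swap]; linarith) (by rw [ori_swap]; linarith) z2
    · have := h' y (Finset.mem_sdiff.2 ⟨hy, hyb⟩)
      have z0 : ori e c a y = 0 := by
        rw [ori_swap] at y3 ⊢; linarith
      have hs : ori e a w' c = ori e a w' y + ori e w' c y + ori e c a y := by unfold ori; ring
      have := hadj y (Finset.mem_sdiff.2 ⟨hy, hyb⟩) (ori e a w' y / ori e a w' c)
        (div_nonneg y1 hT.le) ((div_le_one hT).2 (by linarith)) (by
          have e1 : ori e a w' c * (y.1 - a.1) = ori e a w' y * (c.1 - a.1) := by
            have : ori e a w' c * (y.1 - a.1) - ori e a w' y * (c.1 - a.1) =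
              ori e c a y * (w'.1 - a.1) := by unfold ori; ring
            rw [z0] at this; linarith
          have e2 : ori e a w' c * (y.2 - a.2) = ori e a w' y * (c.2 - a.2) := by
            have : ori e a w' c * (y.2 - a.2) - ori e a w' y * (c.2 - a.2) =
              ori e c a y * (w'.2 - a.2) := by unfold ori; ring
            rw [z0] at this; linarith
          ext
          · simp only; field_simp; linarith
          · simp only; field_simp; linarith)
      tauto
  rcases lt_or_ge 0 (ori e w w' a) with k1 | k1
  · rcases lt_or_ge 0 (ori e w w' c) with k2 | k2
    · exact main w w' hw hw' hww h1' h2' k1 k2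
    · exact (split w w' hw hw' hww h1' h2' k1.le k2).elim
  · rcases lt_or_ge (ori e w w' c) 0 with k2 | k2
    · rcases k1.lt_or_eq with k1 | k1
      · exact (main w' w hw' hw (Ne.symm hww) h2' h1' (by rw [ori_swap]; linarith)
          (by rw [ori_swap]; linarith)).symm
      · exact (split w w' hw hw' hww h1' h2' k1.ge k2.le).elim
    · exact (split w' w hw' hw (Ne.symm hww) h2' h1' (by rw [ori_swap]; linarith)
        (by rw [ori_swap]; linarith)).elim

/-- Points on the rays of two coside vertices of the next layer are coside. -/
theorem Cos.outward {x' w w' : ℝ × ℝ} {j : ℕ} (hP : NoPent P) (hz : z ∈ lay P (j + 2))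
    (h : Cos (lay P (j + 1)) w w') (hw : w ∈ lay P (j + 1)) (hw' : w' ∈ lay P (j + 1))
    (hx : x ∈ bd (lay P j)) (hx' : x' ∈ bd (lay P j)) (hr : Ray z x w) (hr' : Ray z x' w') :
    Cos (lay P j) x x' := by
  have sz : Surr (lay P j) z := surr_of_lay (by omega) hz
  obtain ⟨e, he, h⟩ := h
  by_cases hww : w = w'
  · rw [bd_ray_unique sz hx hx' (hr.trans (hww ▸ hr'.symm))]
    exact Cos.refl _ _
  have hp := pos_of_side hww he h (surr_of_lay_succ hz)
  have key : ∀ x v, x ∈ bd (lay P j) → v ∈ lay P (j + 1) → Ray z x v → ori e w w' v = 0 →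
      ori e w w' x < 0 := by
    intro x v hx hv hr h0
    obtain ⟨s, s0, s1, hs⟩ := Ray.beyond sz hx hv hr
    have : ori e w w' v = (1 - s) * ori e w w' z + s * ori e w w' x := by
      rw [hs]; unfold ori; simp only; ring
    nlinarith
  exact cos_of_beyond (hP.lay j) hw hw' h hx hx' (key x w hx hw hr (by simp))
    (key x' w' hx' hw' hr' (by simp))

end

/-! ### Point sets all of whose points are on the boundary -/

section

variable {P Q L S T : Finset (ℝ × ℝ)} {e t : ℝ} {M : ℕ} {z a b c d f u v w x y a' b' : ℝ × ℝ}

theorem exists_dt_of_bd (h : x ∈ bd L) : ∃ v : ℝ × ℝ, v ≠ 0 ∧ ∀ u ∈ L, 0 ≤ dt v x u := by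
  simp only [bd, Finset.mem_filter] at h
  exact h.2

theorem eq_zero_of_dt (h : ori e x a b ≠ 0) (ha : dt v x a = 0) (hb : dt v x b = 0) : v = 0 := by
  have k1 : ori e x a b * v.1 = 0 := by
    have : ori e x a b * v.1 = e * ((b.2 - x.2) * dt v x a - (a.2 - x.2) * dt v x b) := by
      unfold ori dt; ring
    rw [this, ha, hb]; ring
  have k2 : ori e x a b * v.2 = 0 := by
    have : ori e x a b * v.2 = e * ((a.1 - x.1) * dt v x b - (b.1 - x.1) * dt v x a) := by
      unfold ori dt; ring
    rw [this, ha, hb]; ring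
  exact Prod.ext ((mul_eq_zero.1 k1).resolve_left h) ((mul_eq_zero.1 k2).resolve_left h)

theorem not_bd_of_triangle (hx : x ∈ bd L) (ha : a ∈ L) (hb : b ∈ L) (hc : c ∈ L)
    (h1 : 0 < ori e a b x) (h2 : 0 < ori e b c x) (h3 : 0 < ori e c a x) : False := by
  obtain ⟨v, hv, h⟩ := exists_dt_of_bd hx
  have h0 := dt_bary e a b c v x x
  rw [dt_self, mul_zero] at h0
  have t1 := mul_nonneg h2.le (h a ha)
  have t2 := mul_nonneg h3.le (h b hb)
  have t3 := mul_nonneg h1.le (h c hc)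
  refine hv (eq_zero_of_dt (e := e) (x := x) (a := a) (b := b) (rotP' h1).ne' ?_ ?_)
  · exact (mul_eq_zero.1 (le_antisymm (by linarith) t1)).resolve_left h2.ne'
  · exact (mul_eq_zero.1 (le_antisymm (by linarith) t2)).resolve_left h3.ne'

theorem not_bd_of_diagonal (hx : x ∈ bd L) (ha : a ∈ L) (hb : b ∈ L) (hc : c ∈ L) (hd : d ∈ L)
    (h1 : 0 < ori e a b x) (h2 : 0 < ori e b c x) (h3 : ori e c a x = 0)
    (h4 : 0 < ori e a c d) : False := by
  obtain ⟨v, hv, h⟩ := exists_dt_of_bd hx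
  have h0 := dt_bary e a b c v x x
  rw [dt_self, mul_zero, h3, zero_mul] at h0
  have t1 := mul_nonneg h2.le (h a ha)
  have t3 := mul_nonneg h1.le (h c hc)
  have z1 := (mul_eq_zero.1 (le_antisymm (by linarith) t1)).resolve_left h2.ne'
  have z3 := (mul_eq_zero.1 (le_antisymm (by linarith) t3)).resolve_left h1.ne'
  have h5 := dt_bary e a b c v x d
  rw [z1, z3] at h5
  have hs : 0 < ori e a b c := by
    have : ori e a b c = ori e a b x + ori e b c x + ori e c a x := by unfold ori; ring
    linarith
  have h6 : ori e c a d = - ori e a c d := by rw [ori_swap]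
  rw [h6] at h5
  have z2 : dt v x b = 0 := by
    refine le_antisymm ?_ (h b hb)
    by_contra hn
    nlinarith [mul_nonneg hs.le (h d hd), mul_pos h4 (not_le.1 hn)]
  exact hv (eq_zero_of_dt (e := e) (x := x) (a := a) (b := b) (rotP' h1).ne' z1 z2)

/-- `a b c d f` is a strictly convex pentagon in counterclockwise order (if `0 < e`). -/
structure Pent (e : ℝ) (a b c d f : ℝ × ℝ) : Prop where
  abc : 0 < ori e a b c
  abd : 0 < ori e a b d
  abf : 0 < ori e a b f
  acd : 0 < ori e a c d
  acf : 0 < ori e a c f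
  adf : 0 < ori e a d f
  bcd : 0 < ori e b c d
  bcf : 0 < ori e b c f
  bdf : 0 < ori e b d f
  cdf : 0 < ori e c d f

/-- `x` is in the closed pentagon `a b c d f`. -/
def InPent (e : ℝ) (a b c d f x : ℝ × ℝ) : Prop :=
  0 ≤ ori e a b x ∧ 0 ≤ ori e b c x ∧ 0 ≤ ori e c d x ∧ 0 ≤ ori e d f x ∧ 0 ≤ ori e f a x

theorem Pent.rot (h : Pent e a b c d f) : Pent e b c d f a :=
  ⟨h.bcd, h.bcf, rotP h.abc, h.bdf, rotP h.abd, rotP h.abf, h.cdf, rotP h.acd, rotP h.acf,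
    rotP h.adf⟩

theorem InPent.rot (h : InPent e a b c d f x) : InPent e b c d f a x :=
  ⟨h.2.1, h.2.2.1, h.2.2.2.1, h.2.2.2.2, h.1⟩

theorem Pent.nonneg (h : Pent e a b c d f) (hx : InPent e a b c d f x) (ha : 0 ≤ ori e u v a)
    (hb : 0 ≤ ori e u v b) (hc : 0 ≤ ori e u v c) (hd : 0 ≤ ori e u v d) (hf : 0 ≤ ori e u v f) :
    0 ≤ ori e u v x := by
  obtain ⟨k1, k2, k3, k4, k5⟩ := hx
  rcases le_or_gt 0 (ori e c a x) with h1 | h1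
  · exact tri_nonneg h.abc k1 k2 h1 ha hb hc
  · rcases le_or_gt 0 (ori e d a x) with h2 | h2
    · exact tri_nonneg h.acd (by rw [ori_swap]; linarith) k3 h2 ha hc hd
    · exact tri_nonneg h.adf (by rw [ori_swap]; linarith) k4 k5 ha hd hf

/-- A boundary point lies neither inside a triangle of the fan from `a` nor inside one of its two
diagonals, so only the edges of the pentagon remain. -/
theorem Pent.exists_edge (h : Pent e a b c d f) (hin : InPent e a b c d f x) (hx : x ∈ bd L)
    (ha : a ∈ L) (hb : b ∈ L) (hc : c ∈ L) (hd : d ∈ L) (hf : f ∈ L) :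
    ori e a b x = 0 ∨ ori e b c x = 0 ∨ ori e c d x = 0 ∨ ori e d f x = 0 ∨ ori e f a x = 0 := by
  by_contra! hn
  obtain ⟨n1, n2, n3, n4, n5⟩ := hn
  obtain ⟨k1, k2, k3, k4, k5⟩ := hin
  have k1 := lt_of_le_of_ne k1 n1.symm
  have k2 := lt_of_le_of_ne k2 n2.symm
  have k3 := lt_of_le_of_ne k3 n3.symm
  have k4 := lt_of_le_of_ne k4 n4.symm
  have k5 := lt_of_le_of_ne k5 n5.symm
  rcases lt_trichotomy 0 (ori e c a x) with h1 | h1 | h1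
  · exact not_bd_of_triangle hx ha hb hc k1 k2 h1
  · exact not_bd_of_diagonal hx ha hb hc hd k1 k2 h1.symm h.acd
  · have h1' : 0 < ori e a c x := by rw [ori_swap]; linarith
    rcases lt_trichotomy 0 (ori e d a x) with h2 | h2 | h2
    · exact not_bd_of_triangle hx ha hc hd h1' k3 h2
    · exact not_bd_of_diagonal hx ha hc hd hf h1' k3 h2.symm h.adf
    · exact not_bd_of_triangle hx ha hd hf (by rw [ori_swap]; linarith) k4 k5

/-- Moving the corner `a` along its edge to `x` keeps the pentagon convex and strictly reduces the
points of the set in it. -/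
theorem Pent.shrink (h : Pent e a b c d f) (hin : InPent e a b c d f x) (h0 : ori e a b x = 0)
    (hxa : x ≠ a) (hxb : x ≠ b) : Pent e x b c d f ∧
      (∀ y, InPent e x b c d f y → InPent e a b c d f y) ∧ ¬ InPent e x b c d f a := by
  obtain ⟨k1, k2, k3, k4, k5⟩ := hin
  have abc := h.abc
  obtain ⟨t, hxt⟩ : ∃ t : ℝ, x = (a.1 + t * (b.1 - a.1), a.2 + t * (b.2 - a.2)) := by
    refine ⟨ori e c a x / ori e a b c, ?_⟩
    have e1 : ori e a b c * (x.1 - a.1) = ori e c a x * (b.1 - a.1) := by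
      have : ori e a b c * (x.1 - a.1) - ori e c a x * (b.1 - a.1) =
        ori e a b x * (c.1 - a.1) := by unfold ori; ring
      rw [h0] at this; linarith
    have e2 : ori e a b c * (x.2 - a.2) = ori e c a x * (b.2 - a.2) := by
      have : ori e a b c * (x.2 - a.2) - ori e c a x * (b.2 - a.2) =
        ori e a b x * (c.2 - a.2) := by unfold ori; ring
      rw [h0] at this; linarith
    ext
    · simp only; field_simp; linarith
    · simp only; field_simp; linarith
  have e1 : ori e b c x = (1 - t) * ori e a b c := by rw [hxt]; unfold ori; simp only; ring
  have e2 : ori e f a x = t * ori e a b f := by rw [hxt]; unfold ori; simp only; ring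
  have t0 : 0 < t := by
    rcases lt_trichotomy 0 t with h' | h' | h'
    · exact h'
    · exact absurd (by rw [hxt, ← h']; simp) hxa
    · rw [e2] at k5; nlinarith [h.abf]
  have t1 : 0 < 1 - t := by
    rcases lt_trichotomy 0 (1 - t) with h' | h' | h'
    · exact h'
    · exact absurd (by rw [hxt, show t = 1 by linarith]; simp) hxb
    · rw [e1] at k2; nlinarith
  have lin : ∀ p q, ori e x p q = (1 - t) * ori e a p q + t * ori e b p q := fun p q => by
    rw [hxt]; unfold ori; simp only; ring
  have hpent : Pent e x b c d f := by
    refine ⟨?_, ?_, ?_, ?_, ?_, ?_, h.bcd, h.bcf, h.bdf, h.cdf⟩ <;> rw [lin] <;>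
      try simp only [ori_left, mul_zero, add_zero]
    · exact mul_pos t1 h.abc
    · exact mul_pos t1 h.abd
    · exact mul_pos t1 h.abf
    · exact add_pos (mul_pos t1 h.acd) (mul_pos t0 h.bcd)
    · exact add_pos (mul_pos t1 h.acf) (mul_pos t0 h.bcf)
    · exact add_pos (mul_pos t1 h.adf) (mul_pos t0 h.bdf)
  refine ⟨hpent, fun y hy => ?_, fun hy => ?_⟩
  · refine ⟨?_, hy.2.1, hy.2.2.1, hy.2.2.2.1, ?_⟩
    · have := hy.1
      rw [lin] at this
      simp only [ori_left, mul_zero, add_zero] at this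
      exact nonneg_of_mul_nonneg_right this t1
    · refine hpent.nonneg hy k5 (rotP' h.abf).le (rotP' h.acf).le (rotP' h.adf).le (by simp)
  · have := hy.2.2.2.2
    rw [show ori e f x a = - ori e f a x by unfold ori; ring, e2] at this
    nlinarith [h.abf]

/-- Without inner points, not even a nonempty convex pentagon exists. Its extra point is on an edge
and can replace a corner, and induction applies to the number of points in the pentagon. -/
theorem NoPent.not_pent (hL : NoPent L) (hbd : bd L = L) : ∀ n : ℕ, ∀ a ∈ L, ∀ b ∈ L, ∀ c ∈ L,
    ∀ d ∈ L, ∀ f ∈ L, Pent e a b c d f → (L.filter (InPent e a b c d f)).card = n → False := by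
  intro n
  induction n using Nat.strong_induction_on with
  | _ n ih =>
  have edge : ∀ a ∈ L, ∀ b ∈ L, ∀ c ∈ L, ∀ d ∈ L, ∀ f ∈ L, ∀ x ∈ L, Pent e a b c d f →
      (L.filter (InPent e a b c d f)).card = n → InPent e a b c d f x → x ≠ a → x ≠ b →
      ori e a b x = 0 → False := by
    intro a ha b hb c hc d hd f hf x hx h hn hin hxa hxb h0
    obtain ⟨h', hsub, hna⟩ := h.shrink hin h0 hxa hxb
    refine ih _ ?_ x hx b hb c hc d hd f hf h' rfl
    rw [← hn]
    refine Finset.card_lt_card (Finset.ssubset_iff_of_subset ?_ |>.2 ⟨a, ?_, ?_⟩)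
    · intro y hy
      simp only [Finset.mem_filter] at hy ⊢
      exact ⟨hy.1, hsub y hy.2⟩
    · simp only [Finset.mem_filter]
      exact ⟨ha, by simp, (rotP h.abc).le, (rotP h.acd).le, (rotP h.adf).le, by simp⟩
    · simp only [Finset.mem_filter, not_and]
      exact fun _ => hna
  intro a ha b hb c hc d hd f hf h hn
  obtain ⟨x, hx, xa, xb, xc, xd, xf, k⟩ := hL e a ha b hb c hc d hd f hf h.abc h.abd h.abf h.acd
    h.acf h.adf h.bcd h.bcf h.bdf h.cdf
  have hin : InPent e a b c d f x := k
  have hrot : ∀ {a b c d f : ℝ × ℝ}, (L.filter (InPent e a b c d f)).card = n →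
      (L.filter (InPent e b c d f a)).card = n := by
    intro a b c d f h
    rw [← h]
    congr 1
    ext y
    simp only [Finset.mem_filter]
    exact ⟨fun h => ⟨h.1, h.2.rot.rot.rot.rot⟩, fun h => ⟨h.1, h.2.rot⟩⟩
  have hx' : x ∈ bd L := by rw [hbd]; exact hx
  rcases h.exists_edge hin hx' ha hb hc hd hf with h0 | h0 | h0 | h0 | h0
  · exact edge a ha b hb c hc d hd f hf x hx h hn hin xa xb h0
  · exact edge b hb c hc d hd f hf a ha x hx h.rot (hrot hn) hin.rot xb xc h0
  · exact edge c hc d hd f hf a ha b hb x hx h.rot.rot (hrot (hrot hn)) hin.rot.rot xc xd h0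
  · exact edge d hd f hf a ha b hb c hc x hx h.rot.rot.rot (hrot (hrot (hrot hn))) hin.rot.rot.rot
      xd xf h0
  · exact edge f hf a ha b hb c hc d hd x hx h.rot.rot.rot.rot (hrot (hrot (hrot (hrot hn))))
      hin.rot.rot.rot.rot xf xa h0

/-- A supporting line at `a` keeps the directions to `T` within a half plane, where the comparison
by angle is transitive. -/
theorem exists_first (ha : a ∈ bd L) (hT : T ⊆ L) (hne : T.Nonempty)
    (hnc : ∀ x ∈ T, ∀ y ∈ T, x ≠ y → ori 1 a x y ≠ 0) :
    ∃ b ∈ T, ∀ y ∈ T, y ≠ b → 0 < ori 1 a b y := by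
  obtain ⟨v, hv, h⟩ := exists_dt_of_bd ha
  induction hne using Finset.Nonempty.cons_induction with
  | singleton b => exact ⟨b, by simp, fun y hy hyb => absurd (Finset.mem_singleton.1 hy) hyb⟩
  | cons x T hx hne ih =>
    obtain ⟨b, hb, hbT⟩ := ih (fun y hy => hT (Finset.mem_cons_of_mem hy))
      fun p hp q hq => hnc p (Finset.mem_cons_of_mem hp) q (Finset.mem_cons_of_mem hq)
    have hxb : x ≠ b := by rintro rfl; exact hx hb
    have h0 := hnc x (Finset.mem_cons_self x T) b (Finset.mem_cons_of_mem hb) hxb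
    rcases lt_or_gt_of_ne h0 with hlt | hgt
    · refine ⟨b, Finset.mem_cons_of_mem hb, fun y hy hyb => ?_⟩
      rcases Finset.mem_cons.1 hy with rfl | hy
      · rw [ori_swap']; linarith
      · exact hbT y hy hyb
    · refine ⟨x, Finset.mem_cons_self x T, fun y hy hyx => ?_⟩
      have hyT := (Finset.mem_cons.1 hy).resolve_left hyx
      by_cases hyb : y = b
      · rwa [hyb]
      have k1 := hbT y hyT hyb
      refine lt_of_le_of_ne ?_ (hnc x (Finset.mem_cons_self x T) y hy (Ne.symm hyx)).symm
      by_contra hneg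
      have dx := h x (hT (Finset.mem_cons_self x T))
      have db := h b (hT (Finset.mem_cons_of_mem hb))
      have dy := h y (hT hy)
      have hid : dt v a x * ori 1 a b y - dt v a b * ori 1 a x y + dt v a y * ori 1 a x b = 0 := by
        unfold ori dt; ring
      have zb : dt v a b = 0 := by
        refine le_antisymm ?_ db
        by_contra hn
        nlinarith [mul_nonneg dx k1.le, mul_nonneg dy hgt.le, mul_pos (not_le.1 hn)
          (neg_pos.2 (not_le.1 hneg))]
      have zx : dt v a x = 0 := by
        refine le_antisymm ?_ dx
        by_contra hn
        rw [zb] at hid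
        nlinarith [mul_pos (not_le.1 hn) k1, mul_nonneg dy hgt.le]
      exact hv (eq_zero_of_dt h0 zx zb)

/-- Sort the other four points by angle around `a`. Each triple turns left, because its middle point
would otherwise be inside a triangle, so the five points form a convex pentagon. -/
theorem NoPent.not_five (hL : NoPent L) (hbd : bd L = L) (hS : S ⊆ L) (h5 : S.card = 5)
    (hnc : ∀ a ∈ S, ∀ b ∈ S, ∀ c ∈ S, a ≠ b → a ≠ c → b ≠ c → ori 1 a b c ≠ 0) : False := by
  obtain ⟨a, ha⟩ : S.Nonempty := Finset.card_pos.1 (by omega)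
  have hab : a ∈ bd L := by rw [hbd]; exact hS ha
  have first : ∀ T ⊆ S, a ∉ T → T.Nonempty → ∃ b ∈ T, ∀ y ∈ T, y ≠ b → 0 < ori 1 a b y := by
    intro T hT haT hne
    refine exists_first hab (hT.trans hS) hne fun x hx y hy hxy => hnc a ha x (hT hx) y (hT hy)
      ?_ ?_ hxy <;> rintro rfl <;> contradiction
  have turn : ∀ b ∈ S, ∀ c ∈ S, ∀ d ∈ S, a ≠ b → 0 < ori 1 a b c → 0 < ori 1 a b d →
      0 < ori 1 a c d → 0 < ori 1 b c d := by
    intro b hb c hc d hd hab' abc abd acd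
    have hbc : b ≠ c := by rintro rfl; simp at abc
    have hbd' : b ≠ d := by rintro rfl; simp at abd
    have hcd : c ≠ d := by rintro rfl; simp at acd
    by_contra hn
    have hlt := lt_of_le_of_ne (not_lt.1 hn) (hnc b hb c hc d hd hbc hbd' hcd)
    exact not_bd_of_triangle (e := 1) (x := c) (by rw [hbd]; exact hS hc) (hS ha) (hS hb) (hS hd)
      abc (by rw [ori_swap']; linarith) (rotP' acd)
  have c4 : (S.erase a).card = 4 := by rw [Finset.card_erase_of_mem ha, h5]
  obtain ⟨b, hb, hb'⟩ := first (S.erase a) (Finset.erase_subset _ _) (by simp)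
    (Finset.card_pos.1 (by omega))
  have c3 : ((S.erase a).erase b).card = 3 := by rw [Finset.card_erase_of_mem hb, c4]
  have s3 : (S.erase a).erase b ⊆ S := (Finset.erase_subset _ _).trans (Finset.erase_subset _ _)
  obtain ⟨c, hc, hc'⟩ := first _ s3 (by simp) (Finset.card_pos.1 (by omega))
  have c2 : (((S.erase a).erase b).erase c).card = 2 := by rw [Finset.card_erase_of_mem hc, c3]
  have s2 := (Finset.erase_subset c _).trans s3
  obtain ⟨d, hd, hd'⟩ := first _ s2 (by simp) (Finset.card_pos.1 (by omega))
  have c1 : ((((S.erase a).erase b).erase c).erase d).card = 1 := by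
    rw [Finset.card_erase_of_mem hd, c2]
  obtain ⟨f, hf⟩ := Finset.card_pos.1 (show 0 < _ by rw [c1]; exact one_pos)
  have hbS := Finset.mem_of_mem_erase hb
  have hcS := s3 hc
  have hdS := s2 hd
  have hfS := s2 (Finset.mem_of_mem_erase hf)
  simp only [Finset.mem_erase, ne_eq] at hb hc hd hf
  have abc := hb' c (by simp; tauto) (by tauto)
  have abd := hb' d (by simp; tauto) (by tauto)
  have abf := hb' f (by simp; tauto) (by tauto)
  have acd := hc' d (by simp; tauto) (by tauto)
  have acf := hc' f (by simp; tauto) (by tauto)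
  have adf := hd' f (by simp; tauto) (by tauto)
  have nb : a ≠ b := fun h => hb.1 h.symm
  have nc : a ≠ c := fun h => hc.2.1 h.symm
  exact hL.not_pent hbd _ a (hS ha) b (hS hbS) c (hS hcS) d (hS hdS) f (hS hfS)
    ⟨abc, abd, abf, acd, acf, adf, turn b hbS c hcS d hdS nb abc abd acd,
      turn b hbS c hcS f hfS nb abc abf acf, turn b hbS d hdS f hfS nb abd abf adf,
      turn c hcS d hdS f hfS nc acd acf adf⟩ rfl

end

/-! ### Supporting lines and the layer next to the last -/

section

variable {P Q L S T : Finset (ℝ × ℝ)} {e t : ℝ} {M : ℕ} {z a b c d f u v w x y a' b' : ℝ × ℝ}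

/-- `a` and `b` are distinct points of `L` and `L` is to the left of the line `a b`. -/
structure Side (L : Finset (ℝ × ℝ)) (a b : ℝ × ℝ) : Prop where
  ha : a ∈ L
  hb : b ∈ L
  ne : a ≠ b
  left : ∀ u ∈ L, 0 ≤ ori 1 a b u

theorem exists_line_param (hab : a ≠ b) (h : ori 1 a b x = 0) :
    ∃ t : ℝ, x = (a.1 + t * (b.1 - a.1), a.2 + t * (b.2 - a.2)) := by
  have hpos := sq_dist_pos hab
  refine ⟨dt (b - a) a x / ((b.1 - a.1) ^ 2 + (b.2 - a.2) ^ 2), ?_⟩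
  unfold ori at h
  unfold dt
  ext
  · simp only [Prod.fst_sub, Prod.snd_sub]
    field_simp
    linear_combination -(b.2 - a.2) * h
  · simp only [Prod.fst_sub, Prod.snd_sub]
    field_simp
    linear_combination (b.1 - a.1) * h

theorem Side.exists_pos (h : Side L a b) {p q s : ℝ × ℝ} (hp : p ∈ L) (hq : q ∈ L) (hs : s ∈ L)
    (hnc : ori 1 p q s ≠ 0) : ∃ u ∈ L, 0 < ori 1 a b u := by
  by_contra! hn
  have h0 : ∀ u ∈ L, ori 1 a b u = 0 := fun u hu => le_antisymm (hn u hu) (h.left u hu)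
  exact hnc (ori_line' h.ne (h0 p hp) (h0 q hq) (h0 s hs))

theorem Side.same_line (h : Side L a b) (h' : Side L a' b') (ha : ori 1 a b a' = 0)
    (hb : ori 1 a b b' = 0) (hu : ∃ u ∈ L, 0 < ori 1 a b u) (hx : ori 1 a b x < 0) :
    ori 1 a' b' x < 0 := by
  obtain ⟨s, hs⟩ := exists_line_param h.ne ha
  obtain ⟨t, ht⟩ := exists_line_param h.ne hb
  have key : ∀ y, ori 1 a' b' y = (t - s) * ori 1 a b y := fun y => by
    rw [hs, ht]; unfold ori; simp only; ring
  obtain ⟨u, huL, hu⟩ := hu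
  have h1 := h'.left u huL
  rw [key] at h1
  have h2 : 0 < t - s := by
    rcases (nonneg_of_mul_nonneg_left h1 hu).lt_or_eq with h3 | h3
    · exact h3
    · exact absurd (by rw [hs, ht, show t = s by linarith]) h'.ne
  rw [key]
  exact mul_neg_of_pos_of_neg h2 hx

theorem ori_line_param (e : ℝ) (a c : ℝ × ℝ) (t : ℝ) (p q : ℝ × ℝ) :
    ori e p q (a.1 + t * (c.1 - a.1), a.2 + t * (c.2 - a.2)) =
      (1 - t) * ori e p q a + t * ori e p q c := by
  unfold ori; simp only; ring

/-- A supporting line at a point strictly between `a` and `c` contains both. Comparing its direction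
with the sides at `a` and `c` identifies it with one of those. -/
theorem side_middle {m gm g g' : ℝ × ℝ} (h : Side L m gm) (ha : Side L a g) (hc : Side L c g')
    (hac : a ≠ c) (t0 : 0 < t) (t1 : t < 1) (hm : m = (a.1 + t * (c.1 - a.1), a.2 + t * (c.2 - a.2))) :
    (ori 1 m gm a = 0 ∧ ori 1 m gm g = 0) ∨ (ori 1 m gm c = 0 ∧ ori 1 m gm g' = 0) := by
  have k := ori_line_param 1 a c t m gm
  rw [← hm, ori_mid] at k
  have ka := h.left a ha.ha
  have kc := h.left c hc.ha
  have za : ori 1 m gm a = 0 := by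
    by_contra hn
    nlinarith [mul_pos (sub_pos.2 t1) (lt_of_le_of_ne ka (Ne.symm hn)), mul_nonneg t0.le kc]
  have zc : ori 1 m gm c = 0 := by
    rw [za, mul_zero, zero_add] at k
    exact (mul_eq_zero.1 k.symm).resolve_left t0.ne'
  obtain ⟨s, hs⟩ := exists_line_param (x := gm) hac (ori_line' h.ne za zc (by simp))
  have key : ∀ x, ori 1 m gm x = (s - t) * ori 1 a c x := fun x => by
    rw [hs, hm]; unfold ori; simp only; ring
  have hst : s - t ≠ 0 := fun h0 => h.ne (by rw [hs, hm, show s = t by linarith])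
  rcases lt_or_gt_of_ne hst with hlt | hgt
  · refine Or.inr ⟨zc, ?_⟩
    have h1 := h.left g' hc.hb
    have h2 := hc.left a ha.ha
    rw [key] at h1 ⊢
    have h3 : ori 1 c g' a = ori 1 a c g' := by unfold ori; ring
    rw [h3] at h2
    exact le_antisymm (mul_nonpos_of_nonpos_of_nonneg hlt.le h2) h1
  · refine Or.inl ⟨za, ?_⟩
    have h1 := h.left g ha.hb
    have h2 := ha.left c hc.ha
    rw [key] at h1 ⊢
    have h3 : ori 1 a g c = - ori 1 a c g := by unfold ori; ring
    rw [h3] at h2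
    nlinarith

/-- Among five supporting lines of a point set without inner points two coincide. -/
theorem NoPent.exists_same_side {ι : Type*} [DecidableEq ι] (hL : NoPent L) (hbd : bd L = L)
    (I : Finset ι) (h5 : I.card = 5) (p q : ι → ℝ × ℝ) (hs : ∀ i ∈ I, Side L (p i) (q i)) :
    ∃ i ∈ I, ∃ j ∈ I, i ≠ j ∧ ori 1 (p i) (q i) (p j) = 0 ∧ ori 1 (p i) (q i) (q j) = 0 := by
  by_contra! hn
  have inj : ∀ i ∈ I, ∀ j ∈ I, p i = p j → i = j := by
    intro i hi j hj hij
    by_contra hne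
    refine hn i hi j hj hne (by rw [← hij]; simp) (le_antisymm ?_ ((hs i hi).left _ (hs j hj).hb))
    have := (hs j hj).left _ (hs i hi).hb
    rw [← hij, ori_swap'] at this
    linarith
  have mid : ∀ i ∈ I, ∀ j ∈ I, ∀ k ∈ I, i ≠ j → j ≠ k → ∀ t : ℝ, 0 < t → t < 1 →
      p j ≠ ((p i).1 + t * ((p k).1 - (p i).1), (p i).2 + t * ((p k).2 - (p i).2)) := by
    intro i hi j hj k hk hij hjk t t0 t1 hp
    have hik : p i ≠ p k := fun h => hij (inj i hi j hj (by rw [hp, ← h]; simp))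
    rcases side_middle (hs j hj) (hs i hi) (hs k hk) hik t0 t1 hp with h | h
    · exact hn j hj i hi (Ne.symm hij) h.1 h.2
    · exact hn j hj k hk hjk h.1 h.2
  -- Five base points with no three collinear are impossible, and three collinear ones have a middle
  -- one, to which `side_middle` applies.
  refine hL.not_five hbd (S := I.image p) (fun x hx => ?_) ?_ ?_
  · obtain ⟨i, hi, rfl⟩ := Finset.mem_image.1 hx
    exact (hs i hi).ha
  · rw [Finset.card_image_of_injOn fun i hi j hj h => inj i hi j hj h, h5]
  · intro a ha b hb c hc hab hac hbc h0
    obtain ⟨i, hi, rfl⟩ := Finset.mem_image.1 ha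
    obtain ⟨j, hj, rfl⟩ := Finset.mem_image.1 hb
    obtain ⟨k, hk, rfl⟩ := Finset.mem_image.1 hc
    have nij : i ≠ j := by rintro rfl; exact hab rfl
    have nik : i ≠ k := by rintro rfl; exact hac rfl
    have njk : j ≠ k := by rintro rfl; exact hbc rfl
    obtain ⟨t, ht⟩ := exists_line_param hab h0
    have n0 : t ≠ 0 := by rintro rfl; exact hac (by rw [ht]; simp)
    have n1 : t ≠ 1 := by rintro rfl; exact hbc (by rw [ht]; simp)
    rcases lt_or_gt_of_ne n0 with h1 | h1
    -- The three cases for `t` decide which point is in the middle; the parameter is recomputed for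
    -- the outer two.
    · refine mid k hk i hi j hj (Ne.symm nik) nij (-t / (1 - t)) (by
        apply div_pos <;> linarith) (by rw [div_lt_one] <;> linarith) ?_
      have : (1 - t) ≠ 0 := by linarith
      rw [ht]
      ext <;> simp only <;> field_simp <;> ring
    · rcases lt_or_gt_of_ne n1 with h2 | h2
      · exact mid i hi k hk j hj nik (Ne.symm njk) t h1 h2 ht
      · refine mid i hi j hj k hk nij njk (1 / t) (by positivity) (by rw [div_lt_one] <;> linarith) ?_
        rw [ht]
        ext <;> simp only <;> field_simp <;> ring

theorem surr_centroid {p q s : ℝ × ℝ} (hp : p ∈ L) (hq : q ∈ L) (hs : s ∈ L)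
    (hnc : ori 1 p q s ≠ 0) :
    Surr L ((p.1 + q.1 + s.1) / 3, (p.2 + q.2 + s.2) / 3) := by
  intro v hv
  by_contra! hn
  have h1 := hn p hp
  have h2 := hn q hq
  have h3 := hn s hs
  have hsum : dt v ((p.1 + q.1 + s.1) / 3, (p.2 + q.2 + s.2) / 3) p +
    dt v ((p.1 + q.1 + s.1) / 3, (p.2 + q.2 + s.2) / 3) q +
    dt v ((p.1 + q.1 + s.1) / 3, (p.2 + q.2 + s.2) / 3) s = 0 := by
    unfold dt; simp only; ring
  refine hv (eq_zero_of_dt (e := 1) (x := p) (a := q) (b := s) hnc ?_ ?_)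
  all_goals
    unfold dt at *
    simp only at *
    linarith

theorem Ed.side (h : Ed L 1 z a b) (hz : Surr L z) : Side L a b :=
  ⟨mem_of_bd h.ha, mem_of_bd h.hb, by rintro rfl; simpa using h.pos, fun _ hu => h.ori_nonneg hz hu⟩

/-- The boundary points of `Q` lie strictly beyond sides of the set of inner points. -/
theorem exists_side_beyond {p q s : ℝ × ℝ} (hp : p ∈ Q \ bd Q) (hq : q ∈ Q \ bd Q)
    (hs : s ∈ Q \ bd Q) (hnc : ori 1 p q s ≠ 0) (hw : w ∈ bd Q) :
    ∃ a b, Side (Q \ bd Q) a b ∧ ori 1 a b w < 0 := by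
  have hz := surr_centroid hp hq hs hnc
  set z : ℝ × ℝ := ((p.1 + q.1 + s.1) / 3, (p.2 + q.2 + s.2) / 3)
  have hzQ : Surr Q z := hz.mono Finset.sdiff_subset
  have hwz : w ≠ z := by rintro h; exact not_bd_of_surr hzQ (h ▸ hw)
  have beyond : ∀ a b, Ed (Q \ bd Q) 1 z a b → 0 ≤ ori 1 z a w → 0 < ori 1 z w b →
      ori 1 a b w < 0 := by
    intro a b h h1 h2
    by_contra hn
    have haL := mem_of_bd h.ha
    have hbL := mem_of_bd h.hb
    refine bd_not_comb (e := 1) (x := b) (y := z) (w := a) hw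
      (Or.inl (Finset.sdiff_subset hbL)) (Or.inr hzQ) (surr_of_mem_sdiff haL) ?_ ?_ ?_
    · exact rotN' h1
    · exact rotN (not_lt.1 hn)
    · exact rotP' h2
  rcases ray_or_window hz one_ne_zero hwz with ⟨c, hc, hr⟩ | ⟨a, b, h, h1, h2⟩
  · obtain ⟨b, hb⟩ := Ed.exists hz one_ne_zero hc
    refine ⟨c, b, hb.side hz, beyond c b hb ?_ (hr.symm.pos hb.pos)⟩
    rw [hr.symm.ori_eq]
  · exact ⟨a, b, h.side hz, beyond a b h h1.le h2⟩

/-- The supporting functional at `x` is nonnegative at `a` and `b` and zero in between, so it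
vanishes at both. -/
theorem cos_of_between {g : ℝ × ℝ} (hx : x ∈ bd Q) (ha : a ∈ Q) (hb : b ∈ Q) (h0 : ori e a b x = 0)
    (h1 : 0 < ori e g a x) (h2 : 0 < ori e g x b) (hab : 0 < ori e g a b) :
    Cos Q a b ∧ Cos Q x b ∧ Cos Q a x := by
  obtain ⟨v, hv, h⟩ := exists_dt_of_bd hx
  have hid : ori e g a b * dt v x x = ori e a b x * dt v x g + ori e b g x * dt v x a +
    ori e g a x * dt v x b := dt_bary e g a b v x x
  rw [dt_self, mul_zero, h0, zero_mul, zero_add] at hid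
  have h2' : 0 < ori e b g x := rotP' h2
  have ta := mul_nonneg h2'.le (h a ha)
  have tb := mul_nonneg h1.le (h b hb)
  have za := (mul_eq_zero.1 (le_antisymm (by linarith) ta)).resolve_left h2'.ne'
  have zb := (mul_eq_zero.1 (le_antisymm (by linarith) tb)).resolve_left h1.ne'
  have key : ∀ p q : ℝ × ℝ, p ≠ q → dt v x p = 0 → dt v x q = 0 → Cos Q p q := by
    intro p q hpq hp hq
    have hk : ∀ u, dt v x u * ((q.1 - p.1) ^ 2 + (q.2 - p.2) ^ 2) =
        ori (v.2 * (q.1 - p.1) - v.1 * (q.2 - p.2)) p q u := by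
      intro u
      unfold dt ori at *
      linear_combination
        ((q.1 - p.1) ^ 2 + (q.2 - p.2) ^ 2 - (q.1 - p.1) * (u.1 - p.1) - (q.2 - p.2) * (u.2 - p.2)) * hp
        + ((q.1 - p.1) * (u.1 - p.1) + (q.2 - p.2) * (u.2 - p.2)) * hq
    refine ⟨v.2 * (q.1 - p.1) - v.1 * (q.2 - p.2), fun hk0 => ?_, fun u hu => ?_⟩
    · refine hv ?_
      have hpos := sq_dist_pos hpq
      have h3 : v.1 * (q.1 - p.1) + v.2 * (q.2 - p.2) = 0 := by unfold dt at *; linarith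
      have e1 : v.1 * ((q.1 - p.1) ^ 2 + (q.2 - p.2) ^ 2) = 0 := by
        linear_combination (q.1 - p.1) * h3 - (q.2 - p.2) * hk0
      have e2 : v.2 * ((q.1 - p.1) ^ 2 + (q.2 - p.2) ^ 2) = 0 := by
        linear_combination (q.2 - p.2) * h3 + (q.1 - p.1) * hk0
      exact Prod.ext ((mul_eq_zero.1 e1).resolve_right hpos.ne')
        ((mul_eq_zero.1 e2).resolve_right hpos.ne')
    · rw [← hk]
      exact mul_nonneg (h u hu) (by positivity)
  refine ⟨key a b ?_ za zb, key x b ?_ (dt_self v x) zb, key a x ?_ za (dt_self v x)⟩ <;>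
    rintro rfl
  · simp at hab
  · simp at h2
  · simp at h1

/-- If `z` is the only inner point, three boundary points in a half plane contain a coside pair. -/
theorem cos_of_single {w₁ wa wb : ℝ × ℝ} (hQ : NoPent Q) (hz : Q \ bd Q = {z}) (h₁ : w₁ ∈ bd Q)
    (ha : wa ∈ bd Q) (hb : wb ∈ bd Q) (k1 : 0 < ori e z w₁ wa) (k2 : 0 < ori e z w₁ wb)
    (k3 : 0 < ori e z wa wb) : Cos Q w₁ wa ∨ Cos Q wa wb := by
  have hzm : z ∈ Q \ bd Q := by rw [hz]; simp
  have hzQ := (Finset.mem_sdiff.1 hzm).1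
  have sz := surr_of_mem_sdiff hzm
  have he := ne_of_ori_pos k1
  by_contra! hn
  obtain ⟨n1, n2⟩ := hn
  have turn : ∀ x y w, x ∈ bd Q → y ∈ bd Q → w ∈ bd Q → 0 < ori e z x y → 0 < ori e z y w →
      0 < ori e z x w → 0 ≤ ori e x y w := by
    intro x y w hx hy hw l1 l2 l3
    by_contra hneg
    exact bd_not_comb (e := e) (x := x) (y := w) (w := z) hy (Or.inl (mem_of_bd hx))
      (Or.inl (mem_of_bd hw)) sz (rotN l2.le) (rotN l1.le) (by rw [ori_swap']; linarith)
  have inner : ∀ y ∈ Q, y ≠ z → y ∈ bd Q := by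
    intro y hy hyz
    by_contra hyb
    have : y ∈ Q \ bd Q := Finset.mem_sdiff.2 ⟨hy, hyb⟩
    rw [hz, Finset.mem_singleton] at this
    exact hyz this
  have p1 : 0 < ori e w₁ wa wb := by
    refine lt_of_le_of_ne (turn _ _ _ h₁ ha hb k1 k3 k2) fun h0 => ?_
    exact n2 (cos_of_between ha (mem_of_bd h₁) (mem_of_bd hb) (by rw [ori_swap', ← h0, neg_zero])
      k1 k3 k2).2.1
  refine n1 ⟨e, he, chord_side (e₁ := z) (e₂ := wb) hQ h₁ ha hzQ sz (mem_of_bd hb) (rotP k1) p1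
    (rotP' k2) (rotP' k3) ?_ ?_ ?_⟩
  · intro y hy y1 y2 y3
    by_cases hyz : y = z
    · exact Or.inl hyz
    right
    have hyb := inner y hy hyz
    rcases y2.lt_or_eq with y2 | y2
    · exact (bd_not_comb (e := e) hyb (Or.inl (mem_of_bd ha)) (Or.inl (mem_of_bd hb)) sz (rotN' y3)
        (rotN y1) y2).elim
    · rcases y1.lt_or_eq with y1 | y1
      · rcases y3.lt_or_eq with y3 | y3
        · exact absurd (cos_of_between hyb (mem_of_bd ha) (mem_of_bd hb) y2.symm y1 (rotP y3) k3).1 n2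
        · right
          refine eq_of_ori_eq_zero (e := e) (a := wb) (b := wa) (c := z) ?_ ?_ y3.symm
          · have : ori e wb wa z = - ori e z wa wb := by unfold ori; ring
            rw [this]; linarith
          · rw [ori_swap]; linarith
      · left
        refine eq_of_ori_eq_zero (e := e) (a := wa) (b := wb) (c := z) ?_ y2.symm ?_
        · exact (rotP k3).ne'
        · rw [ori_swap]; linarith
  · intro y hy
    rw [hz, Finset.mem_singleton] at hy
    rw [hy]; simp
  · intro x hx hxn
    obtain ⟨l1, l2⟩ := beyond_chord h₁ ha sz (rotP k1) hx hxn
    have hxz : x ≠ z := by rintro rfl; simp at l1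
    have hxb := inner x hx hxz
    have m1 : 0 < ori e z w₁ x := rotP' l1
    have m2 : 0 < ori e z x wa := rotP' l2
    have m3 : 0 < ori e z x wb := by
      have := ori_gp e z w₁ x wa wb
      by_contra hneg
      nlinarith [mul_pos m1 k3, mul_pos k2 m2, mul_nonneg k1.le (neg_nonneg.2 (not_lt.1 hneg))]
    constructor
    · refine lt_of_le_of_ne (turn _ _ _ h₁ hxb hb m1 m3 k2) fun h0 => ?_
      have := ori_bary e z w₁ wb w₁ wa x
      rw [show ori e w₁ wb x = 0 by rw [ori_swap', ← h0, neg_zero]] at this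
      simp only [zero_mul, zero_add, ori_mid, mul_zero] at this
      nlinarith [mul_pos m1 p1, mul_pos k2 (neg_pos.2 hxn)]
    · refine lt_of_le_of_ne (turn _ _ _ hxb ha hb m2 k3 m3) fun h0 => ?_
      exact n2 (cos_of_between ha hx (mem_of_bd hb) (by rw [ori_swap', ← h0, neg_zero])
        m2 k3 m3).2.1

/-- Take a largest subset without related pairs. -/
theorem exists_related_cover {α : Type*} [DecidableEq α] (R : α → α → Prop) (S : Finset α) (n : ℕ)
    (h : ∀ T ⊆ S, T.card = n + 1 → ∃ x ∈ T, ∃ y ∈ T, x ≠ y ∧ R x y) :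
    ∃ F ⊆ S, F.card ≤ n ∧ ∀ s ∈ S, s ∈ F ∨ ∃ x ∈ F, R x s ∨ R s x := by
  obtain ⟨F, hF, hmax⟩ := Finset.exists_max_image
    (S.powerset.filter fun F => ∀ x ∈ F, ∀ y ∈ F, x ≠ y → ¬ R x y) Finset.card
    ⟨∅, by simp⟩
  simp only [Finset.mem_filter, Finset.mem_powerset] at hF hmax
  refine ⟨F, hF.1, ?_, fun s hs => ?_⟩
  · by_contra hn
    obtain ⟨T, hT, hc⟩ := Finset.exists_subset_card_eq (show n + 1 ≤ F.card by omega)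
    obtain ⟨x, hx, y, hy, hxy, hR⟩ := h T (hT.trans hF.1) hc
    exact hF.2 x (hT hx) y (hT hy) hxy hR
  · by_contra! hn
    have := hmax (insert s F) ⟨Finset.insert_subset hs hF.1, fun x hx y hy hxy => ?_⟩
    · rw [Finset.card_insert_of_notMem hn.1] at this
      omega
    · rcases Finset.mem_insert.1 hx with h1 | h1 <;> rcases Finset.mem_insert.1 hy with h2 | h2
      · exact absurd (h1.trans h2.symm) hxy
      · rw [h1]; exact (hn.2 y h2).2
      · rw [h2]; exact (hn.2 x h1).1
      · exact hF.2 x h1 y h2 hxy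

/-- At most two boundary points are on a line through an inner point. -/
theorem card_bd_line_le (ha : Surr Q a) (hb : b ≠ a) (hS : S ⊆ bd Q)
    (h : ∀ x ∈ S, ori 1 a b x = 0) : S.card ≤ 2 := by
  by_contra hn
  have hray : ∀ x ∈ S, ∃ t : ℝ, t ≠ 0 ∧ x = (a.1 + t * (b.1 - a.1), a.2 + t * (b.2 - a.2)) := by
    intro x hx
    obtain ⟨t, ht⟩ := exists_line_param (Ne.symm hb) (h x hx)
    refine ⟨t, ?_, ht⟩
    rintro rfl
    refine not_bd_of_surr ha ?_
    have := hS hx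
    rw [ht] at this
    simpa using this
  have hcard := Finset.card_filter_add_card_filter_not (s := S) fun x => 0 < dt (b - a) a x
  have uniq : ∀ x ∈ S, ∀ y ∈ S, (0 < dt (b - a) a x ↔ 0 < dt (b - a) a y) → x = y := by
    intro x hx y hy hiff
    obtain ⟨s, s0, hs⟩ := hray x hx
    obtain ⟨t, t0, ht⟩ := hray y hy
    have hpos := sq_dist_pos (Ne.symm hb)
    have e1 : dt (b - a) a x = s * ((b.1 - a.1) ^ 2 + (b.2 - a.2) ^ 2) := by
      rw [hs]; unfold dt; simp only [Prod.fst_sub, Prod.snd_sub]; ring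
    have e2 : dt (b - a) a y = t * ((b.1 - a.1) ^ 2 + (b.2 - a.2) ^ 2) := by
      rw [ht]; unfold dt; simp only [Prod.fst_sub, Prod.snd_sub]; ring
    rw [e1, e2, mul_pos_iff_of_pos_right hpos, mul_pos_iff_of_pos_right hpos] at hiff
    have hts : 0 < t / s := by
      rcases lt_or_gt_of_ne s0 with h | h
      · have : t < 0 := lt_of_le_of_ne (not_lt.1 fun h' => absurd (hiff.2 h') (by linarith)) t0
        exact div_pos_of_neg_of_neg this h
      · exact div_pos (hiff.1 h) h
    refine bd_ray_unique ha (hS hx) (hS hy) ⟨t / s, hts, ?_⟩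
    rw [hs, ht]
    ext <;> simp only <;> field_simp <;> ring
  have c1 : (S.filter fun x => 0 < dt (b - a) a x).card ≤ 1 := by
    refine Finset.card_le_one.2 fun x hx y hy => ?_
    simp only [Finset.mem_filter] at hx hy
    exact uniq x hx.1 y hy.1 (iff_of_true hx.2 hy.2)
  have c2 : (S.filter fun x => ¬ 0 < dt (b - a) a x).card ≤ 1 := by
    refine Finset.card_le_one.2 fun x hx y hy => ?_
    simp only [Finset.mem_filter] at hx hy
    exact uniq x hx.1 y hy.1 (iff_of_false hx.2 hy.2)
  omega

/-- Five boundary points around the last layer contain a coside pair. -/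
theorem exists_cos (hQ : NoPent Q) (hne : (Q \ bd Q).Nonempty)
    (hbd : bd (Q \ bd Q) = Q \ bd Q) (hS : S ⊆ bd Q) (h5 : S.card = 5) :
    ∃ x ∈ S, ∃ y ∈ S, x ≠ y ∧ Cos Q x y := by
  -- If the inner set is not collinear, each of the five points is beyond one of its sides, and two
  -- of these sides agree. If it is on a line or a single point, the line through two inner points,
  -- or through the inner point and one of the five, contains at most two of the five and leaves two
  -- on one side.
  by_cases hnc : ∃ p ∈ Q \ bd Q, ∃ q ∈ Q \ bd Q, ∃ s ∈ Q \ bd Q, ori 1 p q s ≠ 0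
  · obtain ⟨p, hp, q, hq, s, hs, hnc⟩ := hnc
    choose! f g hfg using fun w (hw : w ∈ S) => exists_side_beyond hp hq hs hnc (hS hw)
    obtain ⟨x, hx, y, hy, hxy, h1, h2⟩ := hQ.sdiff_bd.exists_same_side hbd S h5 f g
      fun w hw => (hfg w hw).1
    have hu := (hfg y hy).1.exists_pos hp hq hs hnc
    refine ⟨x, hx, y, hy, hxy, cos_of_beyond (e := 1) hQ (hfg y hy).1.ha (hfg y hy).1.hb
      (hfg y hy).1.left (hS hx) (hS hy) ?_ (hfg y hy).2⟩
    have hx' := (hfg x hx).1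
    refine hx'.same_line (hfg y hy).1 h1 h2 (hx'.exists_pos hp hq hs hnc) (hfg x hx).2
  · push Not at hnc
    obtain ⟨a, ha⟩ := hne
    have sa := surr_of_mem_sdiff ha
    by_cases hone : ∃ b ∈ Q \ bd Q, b ≠ a
    · obtain ⟨b, hb, hba⟩ := hone
      have c0 := card_bd_line_le (S := S.filter fun x => ori 1 a b x = 0) sa hba
        ((Finset.filter_subset _ _).trans hS) (fun x hx => (Finset.mem_filter.1 hx).2)
      have c1 := Finset.card_filter_add_card_filter_not (s := S) fun x => ori 1 a b x = 0
      have c2 := Finset.card_filter_add_card_filter_not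
        (s := S.filter fun x => ¬ ori 1 a b x = 0) fun x => ori 1 a b x < 0
      have pair : ∀ T ⊆ S, 2 ≤ T.card → (∀ e, e ≠ 0 → (∀ x ∈ T, ori e a b x < 0) →
          ∃ x ∈ S, ∃ y ∈ S, x ≠ y ∧ Cos Q x y) := by
        intro T hT hc e he hneg
        obtain ⟨x, hx, y, hy, hxy⟩ := Finset.one_lt_card.1 (show 1 < T.card by omega)
        refine ⟨x, hT hx, y, hT hy, hxy, cos_of_beyond hQ ha hb (fun u hu => ?_) (hS (hT hx))
          (hS (hT hy)) (hneg x hx) (hneg y hy)⟩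
        have : ori e a b u = e * ori 1 a b u := by unfold ori; ring
        rw [this, hnc a ha b hb u hu, mul_zero]
      by_cases h2 : 2 ≤ ((S.filter fun x => ¬ ori 1 a b x = 0).filter fun x => ori 1 a b x < 0).card
      · refine pair _ ((Finset.filter_subset _ _).trans (Finset.filter_subset _ _)) h2 1 one_ne_zero
          fun x hx => (Finset.mem_filter.1 hx).2
      · refine pair ((S.filter fun x => ¬ ori 1 a b x = 0).filter fun x => ¬ ori 1 a b x < 0)
          ((Finset.filter_subset _ _).trans (Finset.filter_subset _ _)) (by omega) (-1) (by norm_num)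
          fun x hx => ?_
        simp only [Finset.mem_filter] at hx
        have := lt_of_le_of_ne (not_lt.1 hx.2) (Ne.symm hx.1.2)
        rw [ori_neg]; linarith
    · push Not at hone
      have hz : Q \ bd Q = {a} := by
        ext x
        rw [Finset.mem_singleton]
        exact ⟨fun hx => hone x hx, fun h => h ▸ ha⟩
      obtain ⟨w, hw⟩ : S.Nonempty := Finset.card_pos.1 (by omega)
      have hwa : w ≠ a := by rintro rfl; exact not_bd_of_surr sa (hS hw)
      have c0 := card_bd_line_le (S := S.filter fun x => ori 1 a w x = 0) sa hwa
        ((Finset.filter_subset _ _).trans hS) (fun x hx => (Finset.mem_filter.1 hx).2)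
      have c1 := Finset.card_filter_add_card_filter_not (s := S) fun x => ori 1 a w x = 0
      have c2 := Finset.card_filter_add_card_filter_not
        (s := S.filter fun x => ¬ ori 1 a w x = 0) fun x => ori 1 a w x < 0
      have pair : ∀ T ⊆ S, 2 ≤ T.card → (∀ e, e ≠ 0 → (∀ x ∈ T, 0 < ori e a w x) →
          ∃ x ∈ S, ∃ y ∈ S, x ≠ y ∧ Cos Q x y) := by
        intro T hT hc e he hpos
        obtain ⟨x, hx, y, hy, hxy⟩ := Finset.one_lt_card.1 (show 1 < T.card by omega)
        have main : ∀ x ∈ T, ∀ y ∈ T, 0 < ori e a x y → ∃ x ∈ S, ∃ y ∈ S, x ≠ y ∧ Cos Q x y := by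
          intro x hx y hy h
          rcases cos_of_single hQ hz (hS hw) (hS (hT hx)) (hS (hT hy)) (hpos x hx) (hpos y hy) h
            with h' | h'
          · exact ⟨w, hw, x, hT hx, by rintro rfl; simpa using hpos w hx, h'⟩
          · exact ⟨x, hT hx, y, hT hy, by rintro rfl; simp at h, h'⟩
        rcases lt_trichotomy 0 (ori e a x y) with h | h | h
        · exact main x hx y hy h
        · exact absurd (bd_ray_unique sa (hS (hT hx)) (hS (hT hy))
            (ray_of_ori_eq_zero' h.symm (hpos x hx) (hpos y hy))) hxy
        · exact main y hy x hx (by rw [ori_swap']; linarith)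
      by_cases h2 : 2 ≤ ((S.filter fun x => ¬ ori 1 a w x = 0).filter fun x => ori 1 a w x < 0).card
      · refine pair _ ((Finset.filter_subset _ _).trans (Finset.filter_subset _ _)) h2 (-1)
          (by norm_num) fun x hx => ?_
        have := (Finset.mem_filter.1 hx).2
        rw [ori_neg]; linarith
      · refine pair ((S.filter fun x => ¬ ori 1 a w x = 0).filter fun x => ¬ ori 1 a w x < 0)
          ((Finset.filter_subset _ _).trans (Finset.filter_subset _ _)) (by omega) 1 one_ne_zero
          fun x hx => ?_
        simp only [Finset.mem_filter] at hx
        exact lt_of_le_of_ne (not_lt.1 hx.2) (Ne.symm hx.1.2)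

/-- A point set without inner points is covered by four lines. -/
theorem card_le_of_bd_eq (hP : NoPent P) (hM : ColBound P M) (hbd : bd P = P) :
    P.card ≤ 4 * M := by
  by_cases hnc : ∃ p ∈ P, ∃ q ∈ P, ∃ s ∈ P, ori 1 p q s ≠ 0
  · obtain ⟨p, hp, q, hq, s, hs, hnc⟩ := hnc
    have hz := surr_centroid hp hq hs hnc
    have hside : ∀ a ∈ P, ∃ b, Side P a b := by
      intro a ha
      obtain ⟨b, hb⟩ := Ed.exists hz one_ne_zero (hbd.symm ▸ ha : a ∈ bd P)
      exact ⟨b, hb.side hz⟩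
    choose! g hg using hside
    obtain ⟨F, hF, hc, hcov⟩ := exists_related_cover
      (fun a a' => ori 1 a (g a) a' = 0 ∧ ori 1 a (g a) (g a') = 0) P 4 (fun T hT h5 => by
        obtain ⟨x, hx, y, hy, hxy, h⟩ := hP.exists_same_side hbd T h5 id g
          fun x hx => hg x (hT hx)
        exact ⟨x, hx, y, hy, hxy, h⟩)
    have hsub : P ⊆ F.biUnion fun a => P.filter fun x => ori 1 a (g a) x = 0 := by
      intro x hx
      simp only [Finset.mem_biUnion, Finset.mem_filter]
      rcases hcov x hx with h | ⟨a, ha, h | h⟩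
      · exact ⟨x, h, hx, by simp⟩
      · exact ⟨a, ha, hx, h.1⟩
      · refine ⟨a, ha, hx, ?_⟩
        exact ori_line' (hg x hx).ne h.1 h.2 (by simp)
    refine (Finset.card_le_card hsub).trans (Finset.card_biUnion_le.trans ?_)
    refine (Finset.sum_le_card_nsmul F _ M fun a ha => hM _ (Finset.filter_subset _ _) ?_).trans ?_
    · intro x hx y hy w hw
      simp only [Finset.mem_filter] at hx hy hw
      exact ori_line' (hg a (hF ha)).ne hx.2 hy.2 hw.2
    · rw [smul_eq_mul]; exact Nat.mul_le_mul_right _ hc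
  · push Not at hnc
    have := hM P (Finset.Subset.refl _) hnc
    omega

end

/-! ### Minimal counterexamples to the boundary bound -/

section

variable {P Q L S T : Finset (ℝ × ℝ)} {e : ℝ} {K M : ℕ}
  {z t c w b x y u a a' g g' t₁ c₁ w₁ b₁ p : ℝ × ℝ}

/-- `P` has more than `K` boundary points and no empty pentagon, and is minimal with this property
among its subsets. -/
structure Crit (P : Finset (ℝ × ℝ)) (K : ℕ) : Prop where
  noPent : NoPent P
  big : K < (bd P).card
  small : ∀ Q ⊂ P, NoPent Q → (bd Q).card ≤ K

/-- `c` is a vertex of the convex hull of `P`, with neighbours `t` and `w` on the boundary. -/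
structure Corner (P : Finset (ℝ × ℝ)) (e : ℝ) (z t c w : ℝ × ℝ) : Prop where
  left : Ed P e z t c
  right : Ed P e z c w
  turn : 0 < ori e t c w

theorem Corner.mirror (h : Corner P e z t c w) : Corner P (-e) z w c t :=
  ⟨h.right.mirror, h.left.mirror, by rw [ori_neg', ori_rot]; exact h.turn⟩

theorem surr_of_lay_two (hz : z ∈ lay P 2) : Surr (lay P 1) z ∧ Surr P z :=
  ⟨surr_of_lay_succ hz, surr_of_lay (P := P) (i := 0) (by omega) hz⟩

/-- The sum of the functionals of the edges `t c` and `c w` is positive at every other point. -/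
theorem Corner.erase_island (h : Corner P e z t c w) (hP : NoPent P) (hz : Surr P z) :
    NoPent (P.erase c) := by
  refine hP.island (Finset.erase_subset _ _) fun x hx hxc => ?_
  have hxc : x = c := by
    by_contra hn
    exact hxc (Finset.mem_erase.2 ⟨hn, hx⟩)
  subst hxc
  refine ⟨(e * (t.2 - w.2), e * (w.1 - t.1)), fun y hy => ?_⟩
  rw [Finset.mem_erase] at hy
  have h1 := h.left.ori_nonneg hz hy.2
  have h2 := h.right.ori_nonneg hz hy.2
  have hs : dt (e * (t.2 - w.2), e * (w.1 - t.1)) x y = ori e t x y + ori e x w y := by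
    unfold dt ori; ring
  rw [hs]
  rcases h1.lt_or_eq with h1' | h1'
  · linarith
  rcases h2.lt_or_eq with h2' | h2'
  · linarith
  refine absurd (eq_of_ori_eq_zero (e := e) (a := x) (b := t) (c := w) ?_ ?_ h2'.symm) hy.1
  · have := h.turn
    rw [ori_swap]; linarith
  · rw [ori_swap]; linarith

/-- All other boundary points remain on the boundary, and minimality leaves no room for new ones. -/
theorem Crit.bd_erase (hC : Crit P K) (h : Corner P e z t c w) (hz : Surr P z) :
    bd (P.erase c) = (bd P).erase c := by
  have hc := h.left.hb
  symm
  refine Finset.eq_of_subset_of_card_le (fun x hx => ?_) ?_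
  · rw [Finset.mem_erase] at hx
    exact bd_mono (Finset.erase_subset _ _) hx.2 (Finset.mem_erase.2 ⟨hx.1, mem_of_bd hx.2⟩)
  · rw [Finset.card_erase_of_mem hc]
    have := hC.small _ (Finset.erase_ssubset (mem_of_bd hc)) (h.erase_island hC.noPent hz)
    have := hC.big
    omega

theorem surr_erase (hz : z ∈ lay P 2) (hc : c ∈ bd P) : Surr (P.erase c) z := by
  refine (surr_of_lay_two hz).1.mono fun x hx => ?_
  have hx := Finset.mem_sdiff.1 (hx : x ∈ lay P 0 \ bd (lay P 0))
  exact Finset.mem_erase.2 ⟨fun h => hx.2 (h ▸ hc), hx.1⟩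

/-- No new boundary point appears when `c` is deleted, so its two neighbours become consecutive. -/
theorem Crit.ed_erase (hC : Crit P K) (h : Corner P e z t c w) (hz : z ∈ lay P 2) :
    Ed (P.erase c) e z t w := by
  obtain ⟨-, sz⟩ := surr_of_lay_two hz
  have hbd := hC.bd_erase h sz
  have htc := h.left.pos
  have hcw := h.right.pos
  have htc' : t ≠ c := by rintro rfl; simp at htc
  have hwc' : w ≠ c := by rintro rfl; simp at hcw
  have ht : t ∈ bd (P.erase c) := by rw [hbd]; exact Finset.mem_erase.2 ⟨htc', h.left.ha⟩
  have hw : w ∈ bd (P.erase c) := by rw [hbd]; exact Finset.mem_erase.2 ⟨hwc', h.right.hb⟩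
  obtain ⟨b, hb⟩ := Ed.exists (surr_erase hz h.left.hb) (ne_of_ori_pos htc) ht
  have hbP := hb.hb
  rw [hbd, Finset.mem_erase] at hbP
  have n1 : 0 ≤ ori e z c b := by
    have := h.left.next b hbP.2 hb.pos
    rw [ori_swap']; linarith
  rcases n1.lt_or_eq with n1 | n1
  · have n2 : 0 ≤ ori e z w b := by
      have := h.right.next b hbP.2 n1
      rw [ori_swap']; linarith
    rcases n2.lt_or_eq with n2 | n2
    · exfalso
      have n3 : ori e z t w ≤ 0 := by
        by_contra hn
        exact absurd (hb.next w hw (not_le.1 hn)) (not_le.2 n2)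
      have := ori_gp e z t c w b
      nlinarith [mul_pos htc n2, mul_pos hb.pos hcw, mul_nonneg (neg_nonneg.2 n3) n1.le]
    · have := bd_ray_unique sz h.right.hb hbP.2 (ray_of_ori_eq_zero' n2.symm hcw n1)
      rwa [this]
  · exact absurd (bd_ray_unique sz h.left.hb hbP.2 (ray_of_ori_eq_zero' n1.symm htc hb.pos)).symm
      hbP.1

/-- After deletion of `c` the hull is bounded by `t w`, so no point is cut off except `c` itself. -/
theorem Crit.corner_te (hC : Crit P K) (h : Corner P e z t c w) (hz : z ∈ lay P 2) :
    TE P e c w t := by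
  obtain ⟨-, sz⟩ := surr_of_lay_two hz
  have hE := hC.ed_erase h hz
  have sz' := surr_erase hz h.left.hb
  refine ⟨mem_of_bd h.left.hb, mem_of_bd h.right.hb, mem_of_bd h.left.ha, rotP h.turn,
    fun y hy y1 y2 y3 => ?_⟩
  by_cases hyc : y = c
  · exact Or.inl hyc
  right
  have hy' : y ∈ P.erase c := Finset.mem_erase.2 ⟨hyc, hy⟩
  have h1 := hE.ori_nonneg sz' hy'
  have h0 : ori e t w y = 0 := le_antisymm (by rw [ori_swap] at y2; linarith) h1
  have m1 : 0 ≤ ori e z t y := tri_nonneg (rotP h.turn) y1 y2 y3 h.left.pos.le hE.pos.le (by simp)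
  have m2 : 0 ≤ ori e w z y := tri_nonneg (rotP h.turn) y1 y2 y3 (rotP' h.right.pos).le (by simp)
    (rotP' hE.pos).le
  have := hE.eq_or_eq sz' hy' h0 m1 (rotN m2)
  tauto

theorem Crit.exists_tip (hC : Crit P K) (h : Corner P e z t c w) (hz : z ∈ lay P 2) :
    ∃ b, IsD P e c t w b := by
  obtain ⟨-, sz⟩ := surr_of_lay_two hz
  exact exists_cone_apex hC.noPent (hC.corner_te h hz) (lay_subset P 2 hz)
    (h.right.ori_pos sz sz) (rotP (h.left.ori_pos sz sz))
    ((hC.ed_erase h hz).ori_pos (surr_erase hz h.left.hb) (surr_erase hz h.left.hb))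

/-- The points of `P` off the line `c w`. -/
noncomputable def offLine (P : Finset (ℝ × ℝ)) (c w : ℝ × ℝ) : Finset (ℝ × ℝ) :=
  P.filter fun x => ori 1 c w x ≠ 0

theorem mem_offLine (he : e ≠ 0) : x ∈ offLine P c w ↔ x ∈ P ∧ ori e c w x ≠ 0 := by
  have : ori e c w x = e * ori 1 c w x := by unfold ori; ring
  simp only [offLine, Finset.mem_filter, this, ne_eq, mul_eq_zero, he, false_or]

theorem offLine_subset : offLine P c w ⊆ P := Finset.filter_subset _ _

theorem Ed.offLine_island (h : Ed P e z c w) (hP : NoPent P) (hz : Surr P z) :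
    NoPent (offLine P c w) := by
  have he := ne_of_ori_pos h.pos
  refine hP.island offLine_subset fun x hx hxs => ?_
  have hx0 : ori e c w x = 0 := by
    by_contra hn
    exact hxs ((mem_offLine he).2 ⟨hx, hn⟩)
  refine ⟨(-(e * (w.2 - c.2)), e * (w.1 - c.1)), fun y hy => ?_⟩
  rw [mem_offLine he] at hy
  have h1 := lt_of_le_of_ne (h.ori_nonneg hz hy.1) (Ne.symm hy.2)
  have hs : dt (-(e * (w.2 - c.2)), e * (w.1 - c.1)) x y = ori e c w y - ori e c w x := by
    unfold dt ori; ring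
  rw [hs]; linarith

theorem Ed.lay_one_offLine (h : Ed P e z c w) (hz : Surr P z) : lay P 1 ⊆ offLine P c w := by
  intro x hx
  rw [mem_offLine (ne_of_ori_pos h.pos)]
  exact ⟨lay_subset P 1 hx, (h.ori_pos hz (surr_of_lay_succ (P := P) (i := 0) hx)).ne'⟩

theorem Ed.surr_offLine (h : Ed P e z c w) (hz : z ∈ lay P 2) : Surr (offLine P c w) z :=
  (surr_of_lay_two hz).1.mono (h.lay_one_offLine (surr_of_lay_two hz).2)

/-- The apex at a corner `c` follows `t` on the boundary once the side `c w` is removed. -/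
theorem Crit.tip_ed (hC : Crit P K) (h : Corner P e z t c w) (hz : z ∈ lay P 2)
    (hb : IsD P e c t w b) : Ed (offLine P c w) e z t b := by
  obtain ⟨-, sz⟩ := surr_of_lay_two hz
  have he := ne_of_ori_pos h.turn
  have sz' := h.right.surr_offLine hz
  have hE := hC.ed_erase h hz
  have sze := surr_erase hz h.left.hb
  have qe := hb.qe
  have htP := mem_of_bd h.left.ha
  have htb : t ≠ b := by rintro rfl; simpa using hb.h3
  have ht' : t ∈ offLine P c w := (mem_offLine he).2 ⟨htP, (rotP h.turn).ne'⟩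
  have hb' : b ∈ offLine P c w := (mem_offLine he).2 ⟨qe.hc, hb.h1.ne'⟩
  have left : ∀ x ∈ offLine P c w, 0 ≤ ori e t b x := by
    intro x hx
    rw [mem_offLine he] at hx
    have h1 := lt_of_le_of_ne (h.right.ori_nonneg sz hx.1) (Ne.symm hx.2)
    by_contra hn
    have hbt : 0 < ori e b t x := by rw [ori_swap]; linarith
    rcases lt_or_ge 0 (ori e w x b) with k | k
    · exact hC.noPent.wedge qe.rot.rot.rot hx.1 h1 k (rotP' hbt)
    · have hxc : x ≠ c := by rintro rfl; simp at h1
      have := qe.empty x hx.1 h1.le (by rw [ori_swap']; linarith) hbt.le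
        (h.left.ori_nonneg sz hx.1)
      rcases this with rfl | rfl | rfl | rfl
      · exact hxc rfl
      · simp at h1
      · simp at hbt
      · simp at hbt
  have hpos : 0 < ori e z t b := rotP' (pos_of_side htb he left sz')
  refine ⟨bd_mono offLine_subset h.left.ha ht', mem_bd_of_side htb he hb' (by simp) left, hpos,
    fun g hg k => ?_⟩
  by_contra hn
  have hn := not_le.1 hn
  have hgQ := mem_of_bd hg
  have hgP := offLine_subset hgQ
  rcases (left g hgQ).lt_or_eq with k0 | k0
  · exact bd_not_comb (e := e) hg (Or.inl ht') (Or.inl hb') sz' (rotN hn.le) (rotN k.le) k0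
  · have hid := ori_bary e z t b w b g
    rw [← k0, zero_mul, zero_add, ori_right, mul_zero, add_zero] at hid
    have m : 0 ≤ ori e w b g := by
      have : 0 ≤ ori e z t b * ori e w b g := by
        rw [hid]; exact mul_nonneg (rotP' hn).le (qe.bcd).le
      exact nonneg_of_mul_nonneg_right this hpos
    have := qe.empty g hgP (h.right.ori_nonneg sz hgP) m (by rw [ori_swap, ← k0, neg_zero])
      (h.left.ori_nonneg sz hgP)
    rcases this with rfl | rfl | rfl | rfl
    · rw [mem_offLine he] at hgQ; simp at hgQ
    · rw [mem_offLine he] at hgQ; simp at hgQ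
    · simp at hn
    · simp at k

end

/-! ### Deleting a side of the hull -/

section

variable {P Q L S T : Finset (ℝ × ℝ)} {e : ℝ} {K M : ℕ}
  {z t c w b x y u a a' g g' t₁ c₁ w₁ b₁ p q : ℝ × ℝ}

theorem exists_line_param' (hz : 0 < ori e z p q) (h : ori e p q x = 0) :
    ∃ s : ℝ, x = (p.1 + s * (q.1 - p.1), p.2 + s * (q.2 - p.2)) := by
  refine exists_line_param (by rintro rfl; simp at hz) ?_
  have : ori e p q x = e * ori 1 p q x := by unfold ori; ring
  rw [this] at h
  exact (mul_eq_zero.1 h).resolve_left (ne_of_ori_pos hz)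

theorem exists_line_scale (hz : 0 < ori e z p q) (ha : ori e p q a = 0) (hb : ori e p q b = 0) :
    ∃ s : ℝ, ∀ x, ori e a b x = s * ori e p q x := by
  obtain ⟨s, rfl⟩ := exists_line_param' hz ha
  obtain ⟨r, rfl⟩ := exists_line_param' hz hb
  exact ⟨r - s, fun x => by unfold ori; simp only; ring⟩

theorem exists_line_scale_pos (hz : 0 < ori e z p q) (ha : ori e p q a = 0) (hb : ori e p q b = 0)
    (hab : 0 < ori e z a b) : ∃ s : ℝ, 0 < s ∧ ∀ x, ori e a b x = s * ori e p q x := by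
  obtain ⟨s, hs⟩ := exists_line_scale hz ha hb
  refine ⟨s, ?_, hs⟩
  have h := rotP hab
  rw [hs] at h
  exact pos_of_mul_pos_left h (rotP hz).le

theorem eq_of_line (hz : 0 < ori e z p q) (ha : ori e p q a = 0) (hb : ori e p q b = 0)
    (h : ori e z a b = 0) : a = b := by
  obtain ⟨s, rfl⟩ := exists_line_param' hz ha
  obtain ⟨r, rfl⟩ := exists_line_param' hz hb
  have : ori e z (p.1 + s * (q.1 - p.1), p.2 + s * (q.2 - p.2))
    (p.1 + r * (q.1 - p.1), p.2 + r * (q.2 - p.2)) = (r - s) * ori e z p q := by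
    unfold ori; simp only; ring
  rw [this] at h
  have h := (mul_eq_zero.1 h).resolve_right hz.ne'
  rw [show r = s by linarith]

/-- The last boundary point on the line of an edge is a corner. -/
theorem Ed.exists_front (h : Ed P e z a b) (hz : Surr P z) : ∃ t₁ c₁ w₁, Corner P e z t₁ c₁ w₁ ∧
    ori e a b t₁ = 0 ∧ ori e a b c₁ = 0 ∧ ∀ x ∈ P, ori e a b x = 0 → x ≠ c₁ →
      0 < ori e z x c₁ ∧ (x = t₁ ∨ 0 < ori e z x t₁) := by
  have pos := h.pos
  have he := ne_of_ori_pos pos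
  have hab : a ≠ b := by rintro rfl; simp at pos
  obtain ⟨c₁, hc, hmax⟩ := Finset.exists_max_image (P.filter fun x => ori e a b x = 0)
    (fun x => dt (b - a) a x) ⟨a, by simp [mem_of_bd h.ha]⟩
  simp only [Finset.mem_filter] at hc hmax
  obtain ⟨hcP, hc0⟩ := hc
  have hpos := sq_dist_pos hab
  have last : ∀ x ∈ P, ori e a b x = 0 → x ≠ c₁ → 0 < ori e z x c₁ := by
    intro x hx hx0 hne
    have hle := hmax x ⟨hx, hx0⟩
    refine lt_of_le_of_ne ?_ fun h0 => hne (eq_of_line pos hx0 hc0 h0.symm)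
    obtain ⟨s, rfl⟩ := exists_line_param' pos hx0
    obtain ⟨r, rfl⟩ := exists_line_param' pos hc0
    have e1 : ori e z (a.1 + s * (b.1 - a.1), a.2 + s * (b.2 - a.2))
      (a.1 + r * (b.1 - a.1), a.2 + r * (b.2 - a.2)) = (r - s) * ori e z a b := by
      unfold ori; simp only; ring
    rw [e1]
    refine mul_nonneg ?_ pos.le
    unfold dt at hle
    simp only [Prod.fst_sub, Prod.snd_sub, add_sub_cancel_left] at hle
    have : 0 ≤ (r - s) * ((b.1 - a.1) ^ 2 + (b.2 - a.2) ^ 2) := by linarith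
    exact nonneg_of_mul_nonneg_left this hpos
  have hcb : c₁ ∈ bd P := mem_bd_of_side hab he hcP hc0 fun u hu => h.ori_nonneg hz hu
  obtain ⟨t₁, ht⟩ := Ed.exists' hz he hcb
  obtain ⟨w₁, hw⟩ := Ed.exists hz he hcb
  have hac : a ≠ c₁ := by
    rintro rfl
    have := last b (mem_of_bd h.hb) (by simp) (Ne.symm hab)
    rw [ori_swap'] at this; linarith
  have l1 := last a (mem_of_bd h.ha) (by simp) hac
  have behind : ∀ x ∈ bd P, 0 < ori e z x c₁ → 0 ≤ ori e z x t₁ := by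
    intro x hx hxc
    by_contra hn
    have := ht.next x hx (by rw [ori_swap']; linarith)
    linarith
  have ht0 : ori e a b t₁ = 0 := by
    refine le_antisymm ?_ (h.ori_nonneg hz (mem_of_bd ht.ha))
    by_contra hn
    obtain ⟨s, s0, hs⟩ := exists_line_scale_pos pos (show ori e a b a = 0 by simp) hc0 l1
    refine bd_not_comb (e := e) ht.ha (Or.inl (mem_of_bd h.ha)) (Or.inl hcP) hz (rotN ht.pos.le)
      (rotN (behind a h.ha l1)) ?_
    rw [hs]; exact mul_pos s0 (not_le.1 hn)
  refine ⟨t₁, c₁, w₁, ⟨ht, hw, ?_⟩, ht0, hc0, fun x hx hx0 hne => ?_⟩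
  · obtain ⟨s, s0, hs⟩ := exists_line_scale_pos pos ht0 hc0 ht.pos
    rw [hs]
    refine mul_pos s0 (lt_of_le_of_ne (h.ori_nonneg hz (mem_of_bd hw.hb)) fun h0 => ?_)
    have hpw := hw.pos
    have := last w₁ (mem_of_bd hw.hb) h0.symm (by rintro rfl; simp at hpw)
    rw [ori_swap'] at this; linarith
  · have hxc := last x hx hx0 hne
    refine ⟨hxc, ?_⟩
    have hxb : x ∈ bd P := mem_bd_of_side hab he hx hx0 fun u hu => h.ori_nonneg hz hu
    rcases (behind x hxb hxc).lt_or_eq with h0 | h0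
    · exact Or.inr h0
    · exact Or.inl (eq_of_line pos hx0 ht0 h0.symm)

theorem Corner.ahead (h : Corner P e z t c w) (hz : Surr P z) (hx : x ∈ P)
    (h0 : ori e c w x = 0) (hxc : x ≠ c) : 0 < ori e z c x := by
  obtain ⟨s, rfl⟩ := exists_line_param' h.right.pos h0
  have h1 := h.left.ori_nonneg hz hx
  have e1 : ori e t c (c.1 + s * (w.1 - c.1), c.2 + s * (w.2 - c.2)) = s * ori e t c w := by
    unfold ori; simp only; ring
  have e2 : ori e z c (c.1 + s * (w.1 - c.1), c.2 + s * (w.2 - c.2)) = s * ori e z c w := by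
    unfold ori; simp only; ring
  rw [e1] at h1
  rw [e2]
  refine mul_pos (lt_of_le_of_ne (nonneg_of_mul_nonneg_left h1 h.turn) ?_) h.right.pos
  rintro rfl
  exact hxc (by simp)

/-- When the points of a line are removed, a window containing one of them that ends at an old
boundary point ends at the first old boundary point off the line. -/
theorem window_end (hz : Surr P z) (hQ : ∀ x ∈ Q, x ∈ P ∧ 0 < ori e p q x) (hpq : 0 < ori e z p q)
    (hE : Ed Q e z g g') (h1 : 0 < ori e z a g') (h2 : Ray z a g ∨ 0 < ori e z g a)
    (haP : a ∈ P) (ha : ori e p q a = 0) (hcP : c₁ ∈ P) (hc : ori e p q c₁ = 0)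
    (hac : a = c₁ ∨ 0 < ori e z a c₁) (hw : Ed P e z c₁ w₁) (hwQ : w₁ ∈ Q) (hg : g' ∈ bd P) :
    g' = w₁ := by
  have hgQ := hQ g' (mem_of_bd hE.hb)
  have l1 : 0 < ori e z c₁ g' := by
    rcases hac with rfl | hac
    · exact h1
    · by_contra hn
      obtain ⟨s, s0, hs⟩ := exists_line_scale_pos hpq ha hc hac
      refine bd_not_comb (e := e) hg (Or.inl haP) (Or.inl hcP) hz (rotN ?_) (rotN h1.le) ?_
      · rw [ori_swap']; linarith
      · rw [hs]; exact mul_pos s0 hgQ.2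
  have l2 := hw.next g' hg l1
  have l3 : 0 ≤ ori e z w₁ g' := by rw [ori_swap']; linarith
  rcases l3.lt_or_eq with l3 | l3
  · exfalso
    have m1 : 0 < ori e z a w₁ := by
      rcases hac with rfl | hac
      · exact hw.pos
      · have := ori_gp e z a c₁ w₁ g'
        by_contra hn
        nlinarith [mul_pos hac l3, mul_pos h1 hw.pos, mul_nonneg (neg_nonneg.2 (not_lt.1 hn)) l1.le]
    have m2 : 0 < ori e z g w₁ := by
      rcases h2 with hr | h2
      · exact hr.pos m1
      · have := ori_gp e z g a w₁ g'
        by_contra hn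
        nlinarith [mul_pos h2 l3, mul_pos hE.pos m1, mul_nonneg (neg_nonneg.2 (not_lt.1 hn)) h1.le]
    have := hE.next w₁ (bd_mono (fun x hx => (hQ x hx).1) hw.hb hwQ) m2
    linarith
  · exact (bd_ray_unique hz hw.hb hg (ray_of_ori_eq_zero' l3.symm hw.pos l1)).symm

theorem exists_half_window (hz : Surr Q z) (he : e ≠ 0) (ha : a ≠ z) :
    ∃ g g', Ed Q e z g g' ∧ 0 < ori e z a g' ∧ (Ray z a g ∨ 0 < ori e z g a) := by
  rcases ray_or_window hz he ha with ⟨g, hg, hr⟩ | ⟨g, g', h, h1, h2⟩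
  · obtain ⟨g', h⟩ := Ed.exists hz he hg
    exact ⟨g, g', h, hr.symm.pos h.pos, Or.inl hr⟩
  · exact ⟨g, g', h, h2, Or.inr h1⟩

/-- If no point of the side from `c` to `c₁` other than `c₁` is a filled zero, the apex at `c` lies
on the side of `c w`. -/
theorem Crit.side_pos (hC : Crit P K) (h : Corner P e z t c w) (hz : z ∈ lay P 2)
    (hb : IsD P e c t w b) (h₁ : Corner P e z t₁ c₁ w₁) (ht : ori e c w t₁ = 0)
    (hc : ori e c w c₁ = 0) (hF : ∀ x ∈ P, ori e c w x = 0 → x ≠ c₁ →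
      0 < ori e z x c₁ ∧ (x = t₁ ∨ 0 < ori e z x t₁))
    (nf : ∀ x ∈ bd P, ori e c w x = 0 → x ≠ c₁ → ∀ c' c'' p, ¬ FilledZero P e z 0 x c' c'' p) :
    0 < ori e z c b := by
  by_contra hn
  have hn := not_lt.1 hn
  obtain ⟨sz1, sz⟩ := surr_of_lay_two hz
  have hzP := lay_subset P 2 hz
  have pos := h.right.pos
  have he := ne_of_ori_pos pos
  have sz' := h.right.surr_offLine hz
  have hsub1 := h.right.lay_one_offLine sz
  have hQ : ∀ x ∈ offLine P c w, x ∈ P ∧ 0 < ori e c w x := fun x hx => by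
    rw [mem_offLine he] at hx
    exact ⟨hx.1, lt_of_le_of_ne (h.right.ori_nonneg sz hx.1) (Ne.symm hx.2)⟩
  have tip := hC.tip_ed h hz hb
  have htP := mem_of_bd h.left.ha
  have htw : 0 < ori e c w t := rotP h.turn
  have htQ : t ∈ offLine P c w := (mem_offLine he).2 ⟨htP, htw.ne'⟩
  -- the apex at the far corner
  obtain ⟨s₁, s₁0, hs₁⟩ := exists_line_scale_pos pos ht hc h₁.left.pos
  obtain ⟨b₁, hb₁'⟩ := hC.exists_tip h₁.mirror hz
  have tip₁ : Ed (offLine P c w) e z b₁ w₁ := by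
    have := (hC.tip_ed h₁.mirror hz hb₁').mirror
    rw [neg_neg] at this
    have hoff : offLine P c₁ t₁ = offLine P c w := by
      ext x
      rw [mem_offLine he, mem_offLine he, ori_swap, hs₁]
      simp [s₁0.ne']
    rwa [hoff] at this
  have hb₁ : IsD P e c₁ t₁ w₁ b₁ := by
    have := hb₁'.mirror
    rwa [neg_neg] at this
  have hE₁ := hC.ed_erase h₁ hz
  have sze₁ := surr_erase hz h₁.left.hb
  have far₁ : 0 ≤ ori e z t₁ b₁ := rotN' (hb₁.far z hzP (h₁.right.ori_pos sz sz)
    (rotP (h₁.left.ori_pos sz sz)) (hE₁.ori_pos sze₁ sze₁)).1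
  have hnb : b ∉ bd P := by
    intro hbd
    have h1 := h.left.next b hbd tip.pos
    have h2 : ori e z c b = 0 := by
      rw [ori_swap'] at h1
      linarith
    have := bd_ray_unique sz h.left.hb hbd (ray_of_ori_eq_zero' h2 h.left.pos tip.pos)
    have hbQ := (hQ b (mem_of_bd tip.hb)).2
    rw [← this] at hbQ
    simp at hbQ
  have hside : ∀ x ∈ P, ori e c w x = 0 → x ∈ bd P := fun x hx h0 =>
    mem_bd_of_side (by rintro rfl; simp at pos) he hx h0 fun u hu => h.right.ori_nonneg sz hu
  have ne_b : ∀ a g, a ∈ bd P → ori e c w a = 0 → Ed (offLine P c w) e z g b →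
      0 < ori e z a b → (Ray z a g ∨ 0 < ori e z g a) → False := by
    intro a g ha ha0 hE h1 h2
    have hgt := tip.left_unique sz' hE
    subst hgt
    have hac : a ≠ c := by rintro rfl; linarith
    have hca := h.ahead sz (mem_of_bd ha) ha0 hac
    rcases h2 with hr | h2
    · rw [bd_ray_unique sz ha h.left.ha hr] at ha0
      linarith
    · have := ori_gp e z t c a b
      nlinarith [mul_pos h.left.pos h1, mul_pos tip.pos hca, mul_nonneg h2.le (neg_nonneg.2 hn)]
  -- An old boundary point at the end of the window would be `w₁`, by `window_end`. Its predecessor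
  -- is the apex `b₁`, so `a = t₁` is on the ray of `b₁`, and the missing filled zero contradicts
  -- the position of `b₁`.
  have nbd' : ∀ a g g', a ∈ bd P → ori e c w a = 0 → a ≠ c₁ → Ed (offLine P c w) e z g g' →
      0 < ori e z a g' → (Ray z a g ∨ 0 < ori e z g a) → g' ∉ bd P := by
    intro a g g' ha ha0 hac hE h1 h2 hg
    obtain ⟨k1, k2⟩ := hF a (mem_of_bd ha) ha0 hac
    have hgw := window_end sz hQ pos hE h1 h2 (mem_of_bd ha) ha0 (mem_of_bd h₁.left.hb) hc
      (Or.inr k1) h₁.right (mem_of_bd tip₁.hb) hg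
    subst hgw
    have hgb := hE.left_unique sz' tip₁
    subst hgb
    have k3 : ori e z a g ≤ 0 := by
      rcases h2 with hr | h2
      · rw [hr.ori_eq]
      · rw [ori_swap']; linarith
    rcases k2 with rfl | k2
    · have hr : Ray z a g := by
        rcases h2 with hr | h2
        · exact hr
        · rw [ori_swap'] at h2; linarith
      have hgQ := mem_of_bd tip₁.ha
      have hgn : g ∉ bd P := by
        intro hgb
        have := (hQ g hgQ).2
        rw [← bd_ray_unique sz ha hgb hr] at this
        linarith
      have hg1 : g ∈ lay P 1 := Finset.mem_sdiff.2 ⟨(hQ g hgQ).1, hgn⟩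
      obtain ⟨d, hd⟩ := Ed.exists sz1 he (bd_mono hsub1 tip₁.ha hg1)
      have hgc : 0 < ori e z g c₁ := hr.pos k1
      have hcd : ori e z c₁ d ≤ 0 := by
        by_contra hpos
        exact nf a ha ha0 hac g d c₁ ⟨ha, hr, h₁.left.hb, hd, hgc, not_le.1 hpos⟩
      have hd1 := mem_of_bd hd.hb
      have sd : Surr P d := surr_of_lay_succ (P := P) (i := 0) hd1
      have hdP := lay_subset P 1 hd1
      have hdc : d ≠ c₁ := by rintro rfl; exact not_bd_of_surr sd h₁.left.hb
      have hdw : 0 < ori e z d g' := by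
        have := ori_gp e z g d c₁ g'
        have hdc' : 0 ≤ ori e z d c₁ := by rw [ori_swap']; linarith
        by_contra hneg
        nlinarith [mul_pos hd.pos h₁.right.pos, mul_nonneg tip₁.pos.le hdc',
          mul_nonneg hgc.le (neg_nonneg.2 (not_lt.1 hneg))]
      have had : 0 < ori e z a d := hr.symm.pos hd.pos
      have hde : d ∈ P.erase c₁ := Finset.mem_erase.2 ⟨hdc, hdP⟩
      have k4 : 0 < ori e a g' d := lt_of_le_of_ne (hE₁.ori_nonneg sze₁ hde) fun h0 =>
        hE₁.not_between sze₁ hde h0.symm had hdw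
      have k5 := (hb₁.far d hdP (h₁.right.ori_pos sz sd) (rotP (h₁.left.ori_pos sz sd)) k4).1
      have k6 := ray_out (P := P) (i := 0) sz ha hg1 hr hd.pos
      rw [ori_swap] at k6
      linarith
    · have := ori_gp e z a t₁ g g'
      nlinarith [mul_pos k2 tip₁.pos, mul_nonneg (neg_nonneg.2 k3) hE₁.pos.le,
        mul_nonneg h1.le far₁]
  have nbd : ∀ a g g', a ∈ bd P → ori e c w a = 0 → a ≠ c₁ → Ed (offLine P c w) e z g g' →
      0 < ori e z a g' → (Ray z a g ∨ 0 < ori e z g a) → g ∉ bd P := by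
    intro a g g' ha ha0 hac hE h1 h2 hg
    have hgQ := hQ g (mem_of_bd hE.ha)
    have h2' : 0 < ori e z g a := by
      rcases h2 with hr | h2
      · exfalso
        rw [bd_ray_unique sz ha hg hr] at ha0
        linarith [hgQ.2]
      · exact h2
    have hgt := window_end (e := -e) (p := w) (q := c) (w₁ := t) (c₁ := c) (a := a) sz
      (fun x hx => ⟨(hQ x hx).1, by rw [ori_neg']; exact (hQ x hx).2⟩)
      (by rw [ori_neg, ori_swap', neg_neg]; exact pos) hE.mirror
      (by rw [ori_neg, ori_swap', neg_neg]; exact h2')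
      (Or.inr (by rw [ori_neg, ori_swap', neg_neg]; exact h1)) (mem_of_bd ha)
      (by rw [ori_neg', ha0]) (mem_of_bd h.left.hb) (by rw [ori_neg']; simp)
      (by
        by_cases hac : a = c
        · exact Or.inl hac
        · right
          rw [ori_neg, ori_swap', neg_neg]
          exact h.ahead sz (mem_of_bd ha) ha0 hac) h.left.mirror htQ hg
    subst hgt
    have := hE.right_unique sz' tip
    subst this
    exact ne_b a g ha ha0 hE h1 h2
  have ed1 : ∀ a g g', a ∈ bd P → ori e c w a = 0 → a ≠ c₁ → Ed (offLine P c w) e z g g' →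
      0 < ori e z a g' → (Ray z a g ∨ 0 < ori e z g a) → Ed (lay P 1) e z g g' := by
    intro a g g' ha ha0 hac hE h1 h2
    have mem1 : ∀ x ∈ bd (offLine P c w), x ∉ bd P → x ∈ lay P 1 := fun x hx hxn =>
      Finset.mem_sdiff.2 ⟨(hQ x (mem_of_bd hx)).1, hxn⟩
    have hg1 := mem1 g hE.ha (nbd a g g' ha ha0 hac hE h1 h2)
    have hg1' := mem1 g' hE.hb (nbd' a g g' ha ha0 hac hE h1 h2)
    refine ⟨bd_mono hsub1 hE.ha hg1, bd_mono hsub1 hE.hb hg1', hE.pos, fun x hx k1 => ?_⟩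
    by_contra hneg
    have k2 := not_le.1 hneg
    have hxQ := hsub1 (mem_of_bd hx)
    rcases (hE.ori_nonneg sz' hxQ).lt_or_eq with k3 | k3
    · exact bd_not_comb (e := e) hx (Or.inl hg1) (Or.inl hg1') sz1 (rotN k2.le) (rotN k1.le) k3
    · exact hE.not_between sz' hxQ k3.symm k1 k2
  -- counting
  have hex : ∀ a, a ∈ bd P → ∃ g g', Ed (offLine P c w) e z g g' ∧ 0 < ori e z a g' ∧
      (Ray z a g ∨ 0 < ori e z g a) := fun a ha =>
    exists_half_window sz' he (by rintro rfl; exact not_bd_of_surr sz ha)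
  choose! G G' hG using hex
  set s := (bd P).filter fun x => ori e c w x = 0 with hs
  set A := (bd P).filter fun x => ¬ ori e c w x = 0 with hA
  have hcard : s.card + A.card = (bd P).card := Finset.card_filter_add_card_filter_not _
  have ms : ∀ x ∈ s.erase c₁, x ∈ bd P ∧ ori e c w x = 0 ∧ x ≠ c₁ := by
    intro x hx
    rw [Finset.mem_erase, hs, Finset.mem_filter] at hx
    exact ⟨hx.2.1, hx.2.2, hx.1⟩
  -- Two points with the same window end would be two points in a window of layer 1 or a filled
  -- zero.
  have hinj : Set.InjOn G' (s.erase c₁ : Finset (ℝ × ℝ)) := by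
    intro a ha a' ha' hEq
    obtain ⟨ha, ha0, hac⟩ := ms a ha
    obtain ⟨ha', ha0', hac'⟩ := ms a' ha'
    obtain ⟨hE, h1, h2⟩ := hG a ha
    obtain ⟨hE', h1', h2'⟩ := hG a' ha'
    have hE1 := ed1 a _ _ ha ha0 hac hE h1 h2
    rw [← hEq] at hE' h1'
    have hgg := hE.left_unique sz' hE'
    rw [← hgg] at h2'
    rcases h2 with hr | h2 <;> rcases h2' with hr' | h2'
    · exact bd_ray_unique sz ha ha' (hr.trans hr'.symm)
    · exact (nf a ha ha0 hac _ _ a' ⟨ha, hr, ha', hE1, h2', h1'⟩).elim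
    · exact (nf a' ha' ha0' hac' _ _ a ⟨ha', hr', ha, hE1, h2, h1⟩).elim
    · exact Win.unique (i := 0) hC.noPent hzP sz1 ⟨ha, hE1, h2, h1⟩ ⟨ha', hE1, h2', h1'⟩
  have hsubset : A ∪ insert b ((s.erase c₁).image G') ⊆ bd (offLine P c w) := by
    intro x hx
    rcases Finset.mem_union.1 hx with hx | hx
    · rw [hA, Finset.mem_filter] at hx
      exact bd_mono offLine_subset hx.1 ((mem_offLine he).2 ⟨mem_of_bd hx.1, hx.2⟩)
    · rcases Finset.mem_insert.1 hx with rfl | hx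
      · exact tip.hb
      · obtain ⟨a, ha, rfl⟩ := Finset.mem_image.1 hx
        exact (hG a (ms a ha).1).1.hb
  have hdisj : Disjoint A (insert b ((s.erase c₁).image G')) := by
    rw [Finset.disjoint_left]
    intro x hxA hx
    rw [hA, Finset.mem_filter] at hxA
    rcases Finset.mem_insert.1 hx with rfl | hx
    · exact hnb hxA.1
    · obtain ⟨a, ha, rfl⟩ := Finset.mem_image.1 hx
      obtain ⟨ha, ha0, hac⟩ := ms a ha
      obtain ⟨hE, h1, h2⟩ := hG a ha
      exact nbd' a _ _ ha ha0 hac hE h1 h2 hxA.1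
  have hbn : b ∉ (s.erase c₁).image G' := by
    intro hx
    obtain ⟨a, ha, hab⟩ := Finset.mem_image.1 hx
    obtain ⟨ha, ha0, hac⟩ := ms a ha
    obtain ⟨hE, h1, h2⟩ := hG a ha
    rw [hab] at hE h1
    exact ne_b a _ ha ha0 hE h1 h2
  have hc₁s : c₁ ∈ s := Finset.mem_filter.2 ⟨h₁.left.hb, hc⟩
  have hle := Finset.card_le_card hsubset
  rw [Finset.card_union_of_disjoint hdisj, Finset.card_insert_of_notMem hbn,
    Finset.card_image_of_injOn hinj, Finset.card_erase_of_mem hc₁s] at hle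
  have hpos : 0 < s.card := Finset.card_pos.2 ⟨_, hc₁s⟩
  have hss : offLine P c w ⊂ P := (Finset.ssubset_iff_of_subset offLine_subset).2
    ⟨c, mem_of_bd h.left.hb, fun hcQ => by simpa using (hQ c hcQ).2⟩
  have := hC.small _ hss (h.right.offLine_island hC.noPent sz)
  have := hC.big
  omega

end

/-! ### The bound on boundary points -/

section

variable {P Q L S T : Finset (ℝ × ℝ)} {e e' : ℝ} {i j k r K M : ℕ}
  {z t c w b x y u v a a' g g' t₁ c₁ w₁ b₁ p q φ φ' ψ : ℝ × ℝ}

/-- One of the two sides at a corner has a filled zero that is not its far end. -/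
theorem Crit.exists_filled (hC : Crit P K) (h : Corner P e z t c w) (hz : z ∈ lay P 2) :
    ∃ e' φ c' c'' p, FilledZero P e' z 0 φ c' c'' p ∧
      ((ori e c w φ = 0 ∧ ∃ v ∈ P, ori e c w v = 0 ∧ 0 < ori e z φ v) ∨
        (ori e c t φ = 0 ∧ ∃ v ∈ P, ori e c t v = 0 ∧ 0 < ori e z v φ)) := by
  obtain ⟨-, sz⟩ := surr_of_lay_two hz
  obtain ⟨b, hb⟩ := hC.exists_tip h hz
  obtain ⟨t₁, c₁, w₁, h₁, ht₁, hc₁, hF₁⟩ := h.right.exists_front sz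
  obtain ⟨t₂, c₂, w₂, h₂, ht₂, hc₂, hF₂⟩ := h.mirror.right.exists_front sz
  by_contra! hn
  -- Without such filled zeros the apex at `c` would be strictly on both sides of the ray of `c`.
  have p1 := hC.side_pos h hz hb h₁ ht₁ hc₁ hF₁ fun x hx hx0 hxc c' c'' p hf =>
    absurd ((hn e x c' c'' p hf).1 hx0 c₁ (mem_of_bd h₁.left.hb) hc₁)
      (not_le.2 (hF₁ x (mem_of_bd hx) hx0 hxc).1)
  have p2 := hC.side_pos h.mirror hz hb.mirror h₂ ht₂ hc₂ hF₂ fun x hx hx0 hxc c' c'' p hf => by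
    have k := (hF₂ x (mem_of_bd hx) hx0 hxc).1
    rw [ori_neg, ori_swap', neg_neg] at k
    exact absurd ((hn (-e) x c' c'' p hf).2 (by rw [ori_neg] at hx0; linarith) c₂
      (mem_of_bd h₂.left.hb) (by rw [ori_neg] at hc₂; linarith)) (not_le.2 k)
  rw [ori_neg] at p2
  linarith

theorem Cos.same_sign (he : e ≠ 0) (h : Cos P a b) :
    (∀ u ∈ P, 0 ≤ ori e a b u) ∨ ∀ u ∈ P, ori e a b u ≤ 0 := by
  obtain ⟨e', he', h⟩ := h
  have key : ∀ u, ori e' a b u = e' / e * ori e a b u := fun u => by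
    unfold ori; field_simp
  have hne : e' / e ≠ 0 := div_ne_zero he' he
  rcases lt_or_gt_of_ne hne with h0 | h0
  · right
    intro u hu
    have := h u hu
    rw [key] at this
    exact nonpos_of_mul_nonneg_right this h0
  · left
    intro u hu
    have := h u hu
    rw [key] at this
    exact nonneg_of_mul_nonneg_right this h0

/-- The points coside with a point of a side that is not its far end are on this side or on the
other side of the near corner. -/
theorem Corner.cos_line (h : Corner P e z t c w) (hz : Surr P z) (hφ : φ ∈ P) (hψ : ψ ∈ P)
    (hcos : Cos P φ ψ) (h0 : ori e c w φ = 0) (hv : v ∈ P) (hv0 : ori e c w v = 0)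
    (hφv : 0 < ori e z φ v) : ori e c w ψ = 0 ∨ ori e c t ψ = 0 := by
  have he := ne_of_ori_pos h.turn
  by_cases hφc : φ = c
  · subst hφc
    have ht := h.left.ori_nonneg hz hψ
    have hw := h.right.ori_nonneg hz hψ
    have e1 : ori e φ ψ t = ori e t φ ψ := ori_rot _ _ _ _
    have e2 : ori e φ ψ w = - ori e φ w ψ := ori_swap' _ _ _ _
    have e3 : ori e φ t ψ = - ori e t φ ψ := ori_swap _ _ _ _
    rcases hcos.same_sign he with hs | hs
    · left
      have := hs w (mem_of_bd h.right.hb)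
      linarith
    · right
      have := hs t (mem_of_bd h.left.ha)
      linarith
  · left
    have hcφ := h.ahead hz hφ h0 hφc
    obtain ⟨s, s0, hs⟩ := exists_line_scale_pos h.right.pos (show ori e c w c = 0 by simp) h0 hcφ
    obtain ⟨s', s0', hs'⟩ := exists_line_scale_pos h.right.pos h0 hv0 hφv
    have e1 : ori e φ ψ c = s * ori e c w ψ := by rw [← hs]; exact ori_rot _ _ _ _
    have e2 : ori e φ ψ v = - (s' * ori e c w ψ) := by rw [← hs']; exact ori_swap' _ _ _ _
    have hn := h.right.ori_nonneg hz hψ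
    refine le_antisymm ?_ hn
    by_contra hneg
    have m1 := mul_pos s0 (not_le.1 hneg)
    have m2 := mul_pos s0' (not_le.1 hneg)
    rcases hcos.same_sign he with hsg | hsg
    · have := hsg v hv; linarith
    · have := hsg c (mem_of_bd h.left.hb); linarith

theorem Crit.exists_filled_cos (hC : Crit P K) (h : Corner P e z t c w) (hz : z ∈ lay P 2) :
    ∃ e' φ c' c'' p, FilledZero P e' z 0 φ c' c'' p ∧
      ∀ ψ ∈ P, Cos P φ ψ → ori e c w ψ = 0 ∨ ori e c t ψ = 0 := by
  obtain ⟨-, sz⟩ := surr_of_lay_two hz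
  obtain ⟨e', φ, c', c'', p, hf, hφ⟩ := hC.exists_filled h hz
  refine ⟨e', φ, c', c'', p, hf, fun ψ hψ hcos => ?_⟩
  rcases hφ with ⟨h0, v, hv, hv0, hφv⟩ | ⟨h0, v, hv, hv0, hφv⟩
  · exact h.cos_line sz (mem_of_bd hf.hp) hψ hcos h0 hv hv0 hφv
  · have := h.mirror.cos_line sz (mem_of_bd hf.hp) hψ hcos (by rw [ori_neg, h0, neg_zero]) hv
      (by rw [ori_neg, hv0, neg_zero]) (by rw [ori_neg, ori_swap', neg_neg]; exact hφv)
    rw [ori_neg, ori_neg, neg_eq_zero, neg_eq_zero] at this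
    exact this.symm

theorem card_le_of_hub (hM : ColBound P M) (hS : S ⊆ P) (h : ∀ x ∈ S, ∀ y ∈ S, ori 1 p x y = 0) :
    S.card ≤ M :=
  hM S hS fun a ha b hb c hc => by
    rw [ori_base 1 p, h a ha b hb, h b hb c hc, h c hc a ha]; ring

theorem card_lt_of_hub (hM : ColBound P M) (hS : S ⊆ P) (hp : p ∈ P) (hpS : p ∉ S)
    (h : ∀ x ∈ S, ∀ y ∈ S, ori 1 p x y = 0) : S.card + 1 ≤ M := by
  rw [← Finset.card_insert_of_notMem hpS]
  refine card_le_of_hub (p := p) hM (Finset.insert_subset hp hS) fun x hx y hy => ?_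
  rcases Finset.mem_insert.1 hx with rfl | hx
  · simp
  · rcases Finset.mem_insert.1 hy with rfl | hy
    · simp
    · exact h x hx y hy

/-- Through `ψ` there is at most one supporting line for each orientation, and each contains at most
`M - 1` points besides `ψ`. -/
theorem card_cos_le (hM : ColBound P M) (hψ : ψ ∈ P) :
    ((bd P).filter fun a => Cos P ψ a).card ≤ 2 * (M - 1) + 1 := by
  set A := P.filter fun a => a ≠ ψ ∧ ∀ u ∈ P, 0 ≤ ori 1 ψ a u with hA
  set B := P.filter fun a => a ≠ ψ ∧ ∀ u ∈ P, ori 1 ψ a u ≤ 0 with hB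
  have hA' := card_lt_of_hub (S := A) (p := ψ) hM (Finset.filter_subset _ _) hψ
    (fun h => by rw [hA, Finset.mem_filter] at h; exact h.2.1 rfl) (fun x hx y hy => by
      rw [hA, Finset.mem_filter] at hx hy
      have h1 := hx.2.2 y hy.1
      have h2 := hy.2.2 x hx.1
      rw [ori_swap'] at h2
      linarith)
  have hB' := card_lt_of_hub (S := B) (p := ψ) hM (Finset.filter_subset _ _) hψ
    (fun h => by rw [hB, Finset.mem_filter] at h; exact h.2.1 rfl) (fun x hx y hy => by
      rw [hB, Finset.mem_filter] at hx hy
      have h1 := hx.2.2 y hy.1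
      have h2 := hy.2.2 x hx.1
      rw [ori_swap'] at h2
      linarith)
  have hsub : ((bd P).filter fun a => Cos P ψ a) ⊆ insert ψ (A ∪ B) := by
    intro a ha
    simp only [Finset.mem_filter] at ha
    by_cases haψ : a = ψ
    · rw [haψ]; exact Finset.mem_insert_self _ _
    refine Finset.mem_insert_of_mem (Finset.mem_union.2 ?_)
    rcases ha.2.same_sign one_ne_zero with h | h
    · left; rw [hA, Finset.mem_filter]; exact ⟨mem_of_bd ha.1, haψ, h⟩
    · right; rw [hB, Finset.mem_filter]; exact ⟨mem_of_bd ha.1, haψ, h⟩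
  have h1 := Finset.card_le_card hsub
  have h2 := Finset.card_insert_le ψ (A ∪ B)
  have h3 := Finset.card_union_le A B
  omega

/-- `a` is on the supporting line preceding the one from its front end to `ψ`. -/
def Before (P : Finset (ℝ × ℝ)) (a ψ : ℝ × ℝ) : Prop :=
  ∃ c ∈ P, (∀ u ∈ P, 0 ≤ ori 1 a c u) ∧ (∀ u ∈ P, 0 ≤ ori 1 c ψ u) ∧ 0 < ori 1 a c ψ

/-- The front end `c` is determined by `ψ`, so all these points are on one line through `c`, and `c`
itself is not counted. -/
theorem card_before_le (hM : ColBound P M) (h1 : 1 ≤ M) :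
    ((bd P).filter fun a => Before P a ψ).card ≤ M - 1 := by
  rcases ((bd P).filter fun a => Before P a ψ).eq_empty_or_nonempty with h0 | ⟨a₀, ha₀⟩
  · rw [h0]; simp
  simp only [Finset.mem_filter] at ha₀
  obtain ⟨hb₀, c, hc, k1, k2, k3⟩ := ha₀
  have ha₀ := mem_of_bd hb₀
  have uniq : ∀ a ∈ P, ∀ c' ∈ P, (∀ u ∈ P, 0 ≤ ori 1 a c' u) → (∀ u ∈ P, 0 ≤ ori 1 c' ψ u) →
      0 < ori 1 a c' ψ → c' = c := by
    intro a ha c' hc' l1 l2 l3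
    have hψ : c ≠ ψ := by rintro rfl; simp at k3
    have h0 : ori 1 c ψ c' = 0 := by
      have := l2 c hc
      have h' : ori 1 c' ψ c = - ori 1 c ψ c' := by unfold ori; ring
      exact le_antisymm (by linarith) (k2 c' hc')
    obtain ⟨s, hs⟩ := exists_line_param hψ h0
    have m1 := k1 c' hc'
    have e1 : ori 1 a₀ c c' = s * ori 1 a₀ c ψ := by rw [hs]; unfold ori; simp only; ring
    have m2 := l1 c hc
    have e2 : ori 1 a c' c * (1 - s) = - s * ori 1 a c' ψ := by rw [hs]; unfold ori; simp only; ring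
    have e3 := l2 a₀ ha₀
    have e4 : ori 1 c' ψ a₀ = (1 - s) * ori 1 a₀ c ψ := by rw [hs]; unfold ori; simp only; ring
    rw [e1] at m1
    rw [e4] at e3
    have s0 : 0 ≤ s := nonneg_of_mul_nonneg_left m1 k3
    have s1 : 0 ≤ 1 - s := nonneg_of_mul_nonneg_left e3 k3
    have : s = 0 := by
      by_contra hne
      have := mul_pos (lt_of_le_of_ne s0 (Ne.symm hne)) l3
      nlinarith [mul_nonneg m2 s1]
    rw [hs, this]; simp
  have hmem : ∀ a ∈ (bd P).filter fun a => Before P a ψ, a ∈ P ∧ (∀ u ∈ P, 0 ≤ ori 1 a c u) ∧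
      0 < ori 1 a c ψ := by
    intro a ha
    simp only [Finset.mem_filter] at ha
    obtain ⟨ha, c', hc', l1, l2, l3⟩ := ha
    have := uniq a (mem_of_bd ha) c' hc' l1 l2 l3
    subst this
    exact ⟨mem_of_bd ha, l1, l3⟩
  have := card_lt_of_hub (p := c) hM ((Finset.filter_subset _ _).trans (bd_subset P)) hc
    (fun h => by simpa using (hmem c h).2.2) (fun x hx y hy => by
      have h1 := (hmem x hx).2.1 y (hmem y hy).1
      have h2 := (hmem y hy).2.1 x (hmem x hx).1
      have h3 : ori 1 c x y = - ori 1 x c y := ori_swap _ _ _ _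
      have h4 : ori 1 c x y = ori 1 y c x := by unfold ori; ring
      linarith)
  omega

/-- In contrast to its use for outer layers, persistence is an asset here: it carries the ray of a
filled zero down to the layer next to the last. -/
theorem FilledZero.ray_lay (hP : NoPent P) (hz : z ∈ lay P r) (hr : 2 ≤ r)
    (h : FilledZero P e z 0 φ c g p) (hj : j < r) : ∃ x ∈ bd (lay P j), Ray z φ x := by
  rcases j with _ | j
  · exact ⟨φ, h.hp, Ray.refl _ _⟩
  · obtain ⟨x', c', y', hray, hsig⟩ := (h.sig hP (lay_anti P hr hz)).persist hP hz j (by omega)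
    rw [Nat.add_comm 1 j] at hsig
    exact ⟨x', hsig.ed.ha, h.ray.trans hray⟩

theorem Cos.to_outer (hP : NoPent P) (hz : z ∈ lay P r) (hφ : φ ∈ bd P) (hφ' : φ' ∈ bd P)
    (h : ∀ j < r, ∃ x ∈ bd (lay P j), Ray z φ x) (h' : ∀ j < r, ∃ x ∈ bd (lay P j), Ray z φ' x) :
    ∀ j < r, ∀ x ∈ bd (lay P j), ∀ x' ∈ bd (lay P j), Ray z φ x → Ray z φ' x' →
      Cos (lay P j) x x' → Cos P φ φ' := by
  intro j
  induction j with
  | zero =>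
    intro hj x hx x' hx' hr hr' hc
    have sz : Surr P z := surr_of_lay (P := P) (i := 0) hj hz
    rw [bd_ray_unique sz hφ hx hr, bd_ray_unique sz hφ' hx' hr']
    exact hc
  | succ j ih =>
    intro hj x hx x' hx' hr hr' hc
    obtain ⟨y, hy, hy1⟩ := h j (by omega)
    obtain ⟨y', hy', hy1'⟩ := h' j (by omega)
    exact ih (by omega) y hy y' hy' hy1 hy1' (Cos.outward hP (lay_anti P (by omega) hz) hc
      (mem_of_bd hx) (mem_of_bd hx') hy hy' (hy1.symm.trans hr) (hy1'.symm.trans hr'))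

theorem bd_nonempty (h : Q.Nonempty) : (bd Q).Nonempty := by
  obtain ⟨a, ha, hmin⟩ := Finset.exists_min_image Q (fun x => x.1) h
  refine ⟨a, ?_⟩
  simp only [bd, Finset.mem_filter]
  refine ⟨ha, (1, 0), by simp, fun x hx => ?_⟩
  have := hmin x hx
  unfold dt; simp; linarith

theorem exists_last_layer (h : P.Nonempty) : ∃ r, (lay P r).Nonempty ∧ lay P (r + 1) = ∅ := by
  by_contra! hn
  have hne : ∀ r, (lay P r).Nonempty := by
    intro r
    induction r with
    | zero => exact h
    | succ r ih => exact hn r ih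
  have hlt : ∀ r, (lay P r).card + r ≤ P.card := by
    intro r
    induction r with
    | zero => exact le_rfl
    | succ r ih =>
      have : (lay P (r + 1)).card < (lay P r).card := by
        refine Finset.card_lt_card ((Finset.ssubset_iff_of_subset (lay_succ_subset P r)).2 ?_)
        obtain ⟨a, ha⟩ := bd_nonempty (hne r)
        exact ⟨a, mem_of_bd ha, fun h => (Finset.mem_sdiff.1 h).2 ha⟩
      omega
  have := hlt (P.card + 1)
  omega

theorem bd_eq_of_sdiff_eq_empty (h : Q \ bd Q = ∅) : bd Q = Q :=
  Finset.Subset.antisymm (bd_subset Q) (Finset.sdiff_eq_empty_iff_subset.1 h)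

/-- Four pairwise non-coside filled zeros `F` suffice to represent all, by `exists_cos` on the layer
next to the last. For a boundary point `a`, let `c` be the front corner of its side. A filled zero
at `c` is coside with some `ψ` in `F`, and `ψ` is on one of the two sides at `c`: then `a` is coside
with `ψ` or before it. -/
theorem Crit.false_of_layers (hC : Crit P (14 * (M - 1))) (hM : ColBound P M) (h2 : 2 ≤ M)
    (hz : z ∈ lay P (k + 2)) (hlast : lay P (k + 3) = ∅) : False := by
  have hz2 := lay_anti P (show 2 ≤ k + 2 by omega) hz
  obtain ⟨sz1, sz⟩ := surr_of_lay_two hz2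
  have hP := hC.noPent
  obtain ⟨F, hF, hFc, hcov⟩ := exists_related_cover (Cos P)
    ((bd P).filter fun φ => ∃ e c g p, FilledZero P e z 0 φ c g p) 4 (fun T hT h5 => by
      have hT' : ∀ φ ∈ T, φ ∈ bd P ∧ ∀ j < k + 2, ∃ x ∈ bd (lay P j), Ray z φ x := by
        intro φ hφ
        have := hT hφ
        simp only [Finset.mem_filter] at this
        obtain ⟨hφb, e, c, g, p, hf⟩ := this
        exact ⟨hφb, fun j hj => hf.ray_lay hP hz (by omega) hj⟩
      choose! f hf using fun φ (hφ : φ ∈ T) => (hT' φ hφ).2 (k + 1) (by omega)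
      have hinj : Set.InjOn f (T : Set (ℝ × ℝ)) := fun φ hφ φ' hφ' hEq =>
        bd_ray_unique sz (hT' φ hφ).1 (hT' φ' hφ').1
          ((hf φ hφ).2.trans (hEq ▸ (hf φ' hφ').2.symm))
      obtain ⟨x, hx, y, hy, hxy, hcos⟩ := exists_cos (Q := lay P (k + 1)) (S := T.image f)
        (hP.lay _) ⟨z, hz⟩ (bd_eq_of_sdiff_eq_empty hlast) (fun x hx => by
          obtain ⟨φ, hφ, rfl⟩ := Finset.mem_image.1 hx
          exact (hf φ hφ).1) (by rw [Finset.card_image_of_injOn hinj, h5])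
      obtain ⟨φ, hφ, rfl⟩ := Finset.mem_image.1 hx
      obtain ⟨φ', hφ', rfl⟩ := Finset.mem_image.1 hy
      refine ⟨φ, hφ, φ', hφ', by rintro rfl; exact hxy rfl, ?_⟩
      exact Cos.to_outer hP hz (hT' φ hφ).1 (hT' φ' hφ').1 (hT' φ hφ).2 (hT' φ' hφ').2 (k + 1)
        (by omega) _ (hf φ hφ).1 _ (hf φ' hφ').1 (hf φ hφ).2 (hf φ' hφ').2 hcos)
  have hFb : ∀ ψ ∈ F, ψ ∈ bd P := fun ψ hψ => (Finset.mem_filter.1 (hF hψ)).1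
  -- every boundary point is related to a member of `F`
  have cover : ∀ a ∈ bd P, ∃ ψ ∈ F, Cos P ψ a ∨ Before P a ψ := by
    intro a ha
    obtain ⟨b, hab⟩ := Ed.exists (e := 1) sz one_ne_zero ha
    obtain ⟨t, c, w, hc, ht0, hc0, hFr⟩ := hab.exists_front sz
    obtain ⟨e', φ, c', c'', p, hf, hline⟩ := hC.exists_filled_cos hc hz2
    obtain ⟨ψ, hψ, hcos⟩ : ∃ ψ ∈ F, Cos P φ ψ := by
      rcases hcov φ (by simp only [Finset.mem_filter]; exact ⟨hf.hp, e', c', c'', p, hf⟩) with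
        h | ⟨ψ, hψ, h | h⟩
      · exact ⟨φ, h, Cos.refl _ _⟩
      · exact ⟨ψ, hψ, h.symm⟩
      · exact ⟨ψ, hψ, h⟩
    refine ⟨ψ, hψ, ?_⟩
    have hψP := mem_of_bd (hFb ψ hψ)
    obtain ⟨s, s0, hs⟩ := exists_line_scale_pos hab.pos ht0 hc0 hc.left.pos
    have aside : ∀ u ∈ P, 0 ≤ ori 1 a b u := fun u hu => hab.ori_nonneg sz hu
    by_cases h0 : ori 1 a b ψ = 0
    · left
      by_cases haψ : a = ψ
      · rw [haψ]; exact Cos.refl _ _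
      refine Cos.symm ?_
      obtain ⟨l, hl⟩ := exists_line_scale hab.pos (show ori 1 a b a = 0 by simp) h0
      refine ⟨l, ?_, fun u hu => ?_⟩
      · rintro rfl
        refine haψ (eq_of_line hab.pos (by simp) h0 ?_)
        rw [← ori_rot, hl, zero_mul]
      · have : ori l a ψ u = l * ori 1 a ψ u := by unfold ori; ring
        rw [this, hl, ← mul_assoc]
        exact mul_nonneg (mul_self_nonneg l) (aside u hu)
    · right
      have hcw : ori 1 c w ψ = 0 := by
        rcases hline ψ hψP hcos with h | h
        · exact h
        · exfalso
          rw [ori_swap, hs, neg_eq_zero] at h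
          exact h0 ((mul_eq_zero.1 h).resolve_left s0.ne')
      have hca : a ≠ c := by
        rintro rfl
        have hba : b ≠ a := by rintro rfl; simpa using hab.pos
        have := (hFr b (mem_of_bd hab.hb) (by simp) hba).1
        rw [ori_swap'] at this
        linarith [hab.pos]
      have hψc : ψ ≠ c := by rintro rfl; exact h0 hc0
      obtain ⟨s1, s10, hs1⟩ := exists_line_scale_pos hab.pos (show ori 1 a b a = 0 by simp) hc0
        (hFr a (mem_of_bd ha) (by simp) hca).1
      obtain ⟨s2, s20, hs2⟩ := exists_line_scale_pos hc.right.pos (show ori 1 c w c = 0 by simp) hcw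
        (hc.ahead sz hψP hcw hψc)
      refine ⟨c, mem_of_bd hc.left.hb, fun u hu => ?_, fun u hu => ?_, ?_⟩
      · rw [hs1]; exact mul_nonneg s10.le (aside u hu)
      · rw [hs2]; exact mul_nonneg s20.le (hc.right.ori_nonneg sz hu)
      · rw [hs1]; exact mul_pos s10 (lt_of_le_of_ne (aside ψ hψP) (Ne.symm h0))
  have hsub : bd P ⊆ F.biUnion fun ψ =>
      ((bd P).filter fun a => Cos P ψ a) ∪ ((bd P).filter fun a => Before P a ψ) := by
    intro a ha
    obtain ⟨ψ, hψ, h⟩ := cover a ha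
    simp only [Finset.mem_biUnion, Finset.mem_union, Finset.mem_filter]
    exact ⟨ψ, hψ, h.imp (fun h => ⟨ha, h⟩) fun h => ⟨ha, h⟩⟩
  have hcard := (Finset.card_le_card hsub).trans (Finset.card_biUnion_le.trans
    (Finset.sum_le_card_nsmul F _ (3 * (M - 1) + 1) fun ψ hψ => by
      have h1 := Finset.card_union_le ((bd P).filter fun a => Cos P ψ a)
        ((bd P).filter fun a => Before P a ψ)
      have h2 := card_cos_le hM (mem_of_bd (hFb ψ hψ))
      have h3 := card_before_le (ψ := ψ) hM (by omega)
      omega))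
  rw [smul_eq_mul] at hcard
  -- The boundary has at most `12 (M - 1) + 4` points, which exceeds `14 (M - 1)` only for `M = 2`.
  have h4 : F.card * (3 * (M - 1) + 1) ≤ 4 * (3 * (M - 1) + 1) := Nat.mul_le_mul_right _ hFc
  have hbig := hC.big
  have hM2 : M = 2 := by omega
  -- a filled zero yields three collinear points
  obtain ⟨a, ha⟩ : (bd P).Nonempty := Finset.card_pos.1 (by omega)
  obtain ⟨ψ, hψ, -⟩ := cover a ha
  have hψ' := hF hψ
  simp only [Finset.mem_filter] at hψ'
  obtain ⟨hψb, e, c, g, p, hf⟩ := hψ'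
  have hc1 := hf.win.ed.ha
  have hcz : c ≠ z := by rintro rfl; exact not_bd_of_surr sz1 hc1
  have hψz : ψ ≠ z := by rintro rfl; exact not_bd_of_surr sz hψb
  have hψc : ψ ≠ c := by
    rintro rfl
    exact not_bd_of_surr (surr_of_lay_succ (P := P) (i := 0) (mem_of_bd hc1)) hψb
  have hS : ({ψ, c} : Finset (ℝ × ℝ)).card = 2 := Finset.card_pair hψc
  have := card_lt_of_hub (p := z) (S := {ψ, c}) hM (by
      intro x hx
      rcases Finset.mem_insert.1 hx with rfl | hx
      · exact mem_of_bd hψb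
      · rw [Finset.mem_singleton.1 hx]; exact lay_subset P 1 (mem_of_bd hc1))
    (lay_subset P _ hz) (by simp [Ne.symm hψz, Ne.symm hcz]) (fun x hx y hy => by
      have h0 := hf.ray.ori_eq 1
      have h0' : ori 1 z c ψ = 0 := by rw [ori_swap', h0, neg_zero]
      simp only [Finset.mem_insert, Finset.mem_singleton] at hx hy
      rcases hx with rfl | rfl <;> rcases hy with rfl | rfl <;> simp [h0, h0'])
  omega

/-- A point set without empty pentagon and without `M + 1` collinear points has at most
`14 (M - 1)` points on the boundary of its convex hull. -/
theorem card_bd_le (hP : NoPent P) (hM : ColBound P M) (h2 : 2 ≤ M) :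
    (bd P).card ≤ 14 * (M - 1) := by
  by_contra hn
  obtain ⟨Q, hQ, hmin⟩ := Finset.exists_min_image
    (P.powerset.filter fun Q => NoPent Q ∧ 14 * (M - 1) < (bd Q).card) Finset.card
    ⟨P, by simp only [Finset.mem_filter, Finset.mem_powerset]
           exact ⟨Finset.Subset.refl _, hP, not_le.1 hn⟩⟩
  simp only [Finset.mem_filter, Finset.mem_powerset] at hQ hmin
  obtain ⟨hQP, hQn, hQb⟩ := hQ
  have hMQ := hM.mono hQP
  have hC : Crit Q (14 * (M - 1)) := ⟨hQn, hQb, fun R hR hRn => by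
    by_contra hlt
    have := hmin R ⟨hR.1.trans hQP, hRn, not_le.1 hlt⟩
    exact absurd (Finset.card_lt_card hR) (not_lt.2 this)⟩
  have hne : Q.Nonempty := by
    obtain ⟨a, ha⟩ : (bd Q).Nonempty := Finset.card_pos.1 (by omega)
    exact ⟨a, mem_of_bd ha⟩
  obtain ⟨r, ⟨z, hz⟩, hlast⟩ := exists_last_layer hne
  -- A single layer is covered by four lines, and with two layers `exists_cos` applies to the
  -- boundary directly; filled zeros are needed only from three layers on.
  rcases r with _ | _ | k
  · have hbd := bd_eq_of_sdiff_eq_empty (Q := Q) hlast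
    have := card_le_of_bd_eq hQn hMQ hbd
    rw [hbd] at hQb
    omega
  · obtain ⟨F, hF, hFc, hcov⟩ := exists_related_cover (Cos Q) (bd Q) 4 fun T hT h5 =>
      exists_cos hQn ⟨z, hz⟩ (bd_eq_of_sdiff_eq_empty hlast) hT h5
    have hsub : bd Q ⊆ F.biUnion fun ψ => (bd Q).filter fun a => Cos Q ψ a := by
      intro a ha
      simp only [Finset.mem_biUnion, Finset.mem_filter]
      rcases hcov a ha with h | ⟨ψ, hψ, h | h⟩
      · exact ⟨a, h, ha, Cos.refl _ _⟩
      · exact ⟨ψ, hψ, ha, h⟩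
      · exact ⟨ψ, hψ, ha, h.symm⟩
    have hcard := (Finset.card_le_card hsub).trans (Finset.card_biUnion_le.trans
      (Finset.sum_le_card_nsmul F _ (2 * (M - 1) + 1) fun ψ hψ =>
        card_cos_le hMQ (mem_of_bd (hF hψ))))
    rw [smul_eq_mul] at hcard
    have : F.card * (2 * (M - 1) + 1) ≤ 4 * (2 * (M - 1) + 1) := Nat.mul_le_mul_right _ hFc
    omega
  · exact hC.false_of_layers hMQ h2 hz hlast

end

/-! ### The total count -/

theorem card_lay_le {P : Finset (ℝ × ℝ)} {N : ℕ} (hN : ∀ i, (bd (lay P i)).card ≤ N) (m k : ℕ) :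
    (lay P m).card ≤ k * N + (lay P (m + k)).card := by
  induction k with
  | zero => simp
  | succ k ih =>
    have h1 := hN (m + k)
    have h2 : (lay P (m + k + 1)).card + (bd (lay P (m + k))).card = (lay P (m + k)).card :=
      Finset.card_sdiff_add_card_eq_card (bd_subset _)
    rw [Nat.succ_mul, ← Nat.add_assoc m k 1]
    omega

theorem subset_upto_union {P : Finset (ℝ × ℝ)} (m : ℕ) : P ⊆ upto P m (fun _ _ => True) ∪ lay P m := by
  intro x hx
  rw [Finset.mem_union, mem_upto]
  induction m with
  | zero => exact Or.inr hx
  | succ m ih =>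
    rcases ih with ⟨i, hi, h⟩ | h
    · exact Or.inl ⟨i, by omega, h⟩
    · rcases lay_cases h with h | h
      · exact Or.inl ⟨m, by omega, h, trivial⟩
      · exact Or.inr h

theorem card_lt_of_noPent {P : Finset (ℝ × ℝ)} {M : ℕ} (hP : NoPent P) (hM : ColBound P M)
    (h2 : 2 ≤ M) : P.card < 328 * (M + 1) ^ 2 := by
  rcases P.eq_empty_or_nonempty with rfl | hne
  · simp
  obtain ⟨r, ⟨z, hz⟩, hlast⟩ := exists_last_layer hne
  have hN : ∀ i, (bd (lay P i)).card ≤ 14 * (M - 1) := fun i =>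
    card_bd_le (hP.lay i) (hM.mono (lay_subset P i)) h2
  have hupper : (upto P (r - (3 * M + 19)) fun _ _ => True).card ≤ M * (20 * (14 * (M - 1))) := by
    by_cases hr : 3 * M + 19 ≤ r
    · exact card_upper_layers hP hM hz hN (by omega)
    · rw [show r - (3 * M + 19) = 0 by omega]
      have : (upto P 0 fun _ _ => True) = ∅ := by
        ext x; simp [mem_upto]
      rw [this]; simp
  have hlow := card_lay_le hN (r - (3 * M + 19)) (r + 1 - (r - (3 * M + 19)))
  rw [show r - (3 * M + 19) + (r + 1 - (r - (3 * M + 19))) = r + 1 by omega, hlast,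
    Finset.card_empty, add_zero] at hlow
  have hlow' : (r + 1 - (r - (3 * M + 19))) * (14 * (M - 1)) ≤ (3 * M + 20) * (14 * (M - 1)) :=
    Nat.mul_le_mul_right _ (by omega)
  have htot := (Finset.card_le_card (subset_upto_union (P := P) (r - (3 * M + 19)))).trans
    (Finset.card_union_le _ _)
  obtain ⟨n, rfl⟩ : ∃ n, M = n + 1 := ⟨M - 1, by omega⟩
  simp only [Nat.add_sub_cancel] at *
  -- With `M = n + 1` the total is at most `14 n (23 n + 43)`, that is `280 n (n + 1)` for the outer
  -- layers and `14 n (3 n + 23)` for the last ones.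
  nlinarith

/-! ### Transfer to the Euclidean plane -/

/-- The coordinates of a point of the plane. -/
def crd (x : Plane) : ℝ × ℝ := (x 0, x 1)

theorem crd_injective : Function.Injective crd := by
  intro x y h
  simp only [crd, Prod.mk.injEq] at h
  ext i
  fin_cases i
  · exact h.1
  · exact h.2

theorem convex_halfPlane (e : ℝ) (u v : ℝ × ℝ) : Convex ℝ {x : Plane | 0 ≤ ori e u v (crd x)} := by
  intro x hx y hy a b ha hb hab
  simp only [Set.mem_ofPred_eq] at *
  have : ori e u v (crd (a • x + b • y)) = a * ori e u v (crd x) + b * ori e u v (crd y) := by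
    obtain rfl : b = 1 - a := by linarith
    simp only [ori, crd, PiLp.add_apply, PiLp.smul_apply, smul_eq_mul]
    ring
  rw [this]; positivity

/-- The line through the two neighbours separates `a` from the other four points. -/
theorem Pent.isCornerOf {e : ℝ} {a b c d f : Plane} (h : Pent e (crd a) (crd b) (crd c) (crd d) (crd f)) :
    IsCornerOf {a, b, c, d, f} a := by
  refine ⟨by simp, fun hEq => ?_⟩
  have ha : a ∈ convexHull ℝ (({a, b, c, d, f} : Set Plane) \ {a}) := by
    rw [hEq]; exact subset_convexHull ℝ _ (by simp)
  have hsub : (({a, b, c, d, f} : Set Plane) \ {a}) ⊆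
      {x : Plane | 0 ≤ ori e (crd f) (crd b) (crd x)} := by
    rintro x ⟨hx, hxa⟩
    simp only [Set.mem_insert_iff, Set.mem_singleton_iff] at hx hxa
    rcases hx with rfl | rfl | rfl | rfl | rfl
    · exact absurd rfl hxa
    · simp
    · exact (rotP' h.bcf).le
    · exact (rotP' h.bdf).le
    · simp
  have := convexHull_min hsub (convex_halfPlane e _ _) ha
  simp only [Set.mem_ofPred_eq] at this
  have h1 := h.abf
  unfold ori at *
  linarith

theorem noPent_of_plane {P : Finset Plane} (h : ¬ ContainsEmptyPentagon P) :
    NoPent (P.image crd) := by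
  intro e a' ha' b' hb' c' hc' d' hd' f' hf' abc abd abf acd acf adf bcd bcf bdf cdf
  obtain ⟨a, ha, rfl⟩ := Finset.mem_image.1 ha'
  obtain ⟨b, hb, rfl⟩ := Finset.mem_image.1 hb'
  obtain ⟨c, hc, rfl⟩ := Finset.mem_image.1 hc'
  obtain ⟨d, hd, rfl⟩ := Finset.mem_image.1 hd'
  obtain ⟨f, hf, rfl⟩ := Finset.mem_image.1 hf'
  have hp : Pent e (crd a) (crd b) (crd c) (crd d) (crd f) :=
    ⟨abc, abd, abf, acd, acf, adf, bcd, bcf, bdf, cdf⟩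
  by_contra! hn
  refine h ⟨{a, b, c, d, f}, ?_, ⟨?_, ?_⟩, ?_⟩
  · intro x hx
    simp only [Finset.mem_insert, Finset.mem_singleton] at hx
    rcases hx with rfl | rfl | rfl | rfl | rfl <;> assumption
  · have nab : a ≠ b := by rintro rfl; simp at abc
    have nac : a ≠ c := by rintro rfl; simp at abc
    have nad : a ≠ d := by rintro rfl; simp at abd
    have naf : a ≠ f := by rintro rfl; simp at abf
    have nbc : b ≠ c := by rintro rfl; simp at abc
    have nbd : b ≠ d := by rintro rfl; simp at abd
    have nbf : b ≠ f := by rintro rfl; simp at abf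
    have ncd : c ≠ d := by rintro rfl; simp at acd
    have ncf : c ≠ f := by rintro rfl; simp at acf
    have ndf : d ≠ f := by rintro rfl; simp at adf
    rw [Finset.card_insert_of_notMem (by simp [nab, nac, nad, naf]),
      Finset.card_insert_of_notMem (by simp [nbc, nbd, nbf]),
      Finset.card_insert_of_notMem (by simp [ncd, ncf]), Finset.card_pair ndf]
  · have rot : ∀ a b c d f : Plane, ({a, b, c, d, f} : Set Plane) = {b, c, d, f, a} := by
      intro a b c d f
      ext x
      simp only [Set.mem_insert_iff, Set.mem_singleton_iff]
      tauto
    intro x hx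
    simp only [Finset.coe_insert, Finset.coe_singleton, Set.mem_insert_iff,
      Set.mem_singleton_iff] at hx ⊢
    rcases hx with rfl | rfl | rfl | rfl | rfl
    · exact hp.isCornerOf
    · rw [rot]; exact hp.rot.isCornerOf
    · rw [rot, rot]; exact hp.rot.rot.isCornerOf
    · rw [rot, rot, rot]; exact hp.rot.rot.rot.isCornerOf
    · rw [rot, rot, rot, rot]; exact hp.rot.rot.rot.rot.isCornerOf
  · refine Set.Subset.antisymm ?_ fun x hx => ⟨?_, subset_convexHull ℝ _ hx⟩
    · rintro x ⟨hxP, hx⟩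
      by_contra hxX
      simp only [Finset.coe_insert, Finset.coe_singleton, Set.mem_insert_iff, Set.mem_singleton_iff,
        not_or] at hxX
      have half : ∀ u v : ℝ × ℝ, 0 ≤ ori e u v (crd a) → 0 ≤ ori e u v (crd b) →
          0 ≤ ori e u v (crd c) → 0 ≤ ori e u v (crd d) → 0 ≤ ori e u v (crd f) →
          0 ≤ ori e u v (crd x) := by
        intro u v k1 k2 k3 k4 k5
        refine convexHull_min (t := {x : Plane | 0 ≤ ori e u v (crd x)}) ?_
          (convex_halfPlane e u v) hx
        intro y hy
        simp only [Finset.coe_insert, Finset.coe_singleton, Set.mem_insert_iff,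
          Set.mem_singleton_iff] at hy
        rcases hy with rfl | rfl | rfl | rfl | rfl <;> assumption
      have hne : ∀ y, ¬ x = y → crd x ≠ crd y := fun y hy h => hy (crd_injective h)
      have := hn (crd x) (Finset.mem_image_of_mem _ hxP) (hne _ hxX.1) (hne _ hxX.2.1)
        (hne _ hxX.2.2.1) (hne _ hxX.2.2.2.1) (hne _ hxX.2.2.2.2)
        (half _ _ (by simp) (by simp) abc.le abd.le abf.le)
        (half _ _ (rotP abc).le (by simp) (by simp) bcd.le bcf.le)
        (half _ _ (rotP acd).le (rotP bcd).le (by simp) (by simp) cdf.le)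
        (half _ _ (rotP adf).le (rotP bdf).le (rotP cdf).le (by simp) (by simp))
      have h5 := half (crd f) (crd a) (by simp) (rotP' abf).le (rotP' acf).le (rotP' adf).le
        (by simp)
      linarith
    · simp only [Finset.coe_insert, Finset.coe_singleton, Set.mem_insert_iff,
        Set.mem_singleton_iff] at hx
      rcases hx with rfl | rfl | rfl | rfl | rfl <;> assumption

theorem colBound_of_plane {P : Finset Plane} {M : ℕ} (h : ¬ ContainsCollinear (M + 1) P) :
    ColBound (P.image crd) M := by
  intro S hS hcol
  by_contra hlt
  obtain ⟨T, hT, hc⟩ := Finset.exists_subset_card_eq (show M + 1 ≤ S.card by omega)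
  refine h ⟨P.filter fun x => crd x ∈ T, Finset.filter_subset _ _, ?_, ?_⟩
  · rw [← hc, ← Finset.card_image_of_injective _ crd_injective]
    congr 1
    ext y
    simp only [Finset.mem_image, Finset.mem_filter]
    constructor
    · rintro ⟨x, ⟨-, hx⟩, rfl⟩; exact hx
    · intro hy
      obtain ⟨x, hx, rfl⟩ := Finset.mem_image.1 (hS (hT hy))
      exact ⟨x, ⟨hx, hy⟩, rfl⟩
  · set U := P.filter fun x => crd x ∈ T with hU
    have hmem : ∀ x ∈ U, crd x ∈ S := fun x hx => hT (Finset.mem_filter.1 hx).2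
    by_cases hsub : ∃ a ∈ U, ∃ b ∈ U, a ≠ b
    · obtain ⟨a, ha, b, hb, hab⟩ := hsub
      rw [collinear_iff_of_mem (p₀ := a) (by exact_mod_cast ha)]
      refine ⟨b - a, fun x hx => ?_⟩
      obtain ⟨t, ht⟩ := exists_line_param (crd_injective.ne hab)
        (hcol _ (hmem a ha) _ (hmem b hb) _ (hmem x (by exact_mod_cast hx)))
      refine ⟨t, crd_injective ?_⟩
      rw [ht]
      simp only [crd, vadd_eq_add, PiLp.add_apply, PiLp.smul_apply, PiLp.sub_apply, smul_eq_mul]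
      ext <;> simp only <;> ring
    · push Not at hsub
      have hU1 : (U : Set Plane).Subsingleton := fun a ha b hb =>
        hsub a (by exact_mod_cast ha) b (by exact_mod_cast hb)
      rcases hU1.eq_empty_or_singleton with h0 | ⟨a, h0⟩
      · rw [h0]; exact collinear_empty ℝ _
      · rw [h0]; exact collinear_singleton ℝ _

theorem pentagon_or_collinear (ℓ : ℕ) (P : Finset Plane) (hP : 328 * ℓ ^ 2 ≤ P.card) :
    ContainsEmptyPentagon P ∨ ContainsCollinear ℓ P := by
  -- At most two points are always collinear; the other case provides the `M ≥ 2` that the boundary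
  -- bound needs.
  rcases le_or_gt ℓ 2 with hℓ | hℓ
  · right
    obtain ⟨S, hS, hc⟩ := Finset.exists_subset_card_eq (show ℓ ≤ P.card by nlinarith)
    refine ⟨S, hS, hc, ?_⟩
    interval_cases ℓ
    · rw [Finset.card_eq_zero] at hc
      rw [hc, Finset.coe_empty]; exact collinear_empty ℝ _
    · obtain ⟨a, rfl⟩ := Finset.card_eq_one.1 hc
      rw [Finset.coe_singleton]; exact collinear_singleton ℝ _
    · obtain ⟨a, b, -, rfl⟩ := Finset.card_eq_two.1 hc
      rw [Finset.coe_pair]; exact collinear_pair ℝ _ _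
  · by_contra! hn
    obtain ⟨M, rfl⟩ : ∃ M, ℓ = M + 1 := ⟨ℓ - 1, by omega⟩
    have := card_lt_of_noPent (noPent_of_plane hn.1) (colBound_of_plane hn.2) (by omega)
    rw [Finset.card_image_of_injective _ crd_injective] at this
    omega

/-! ### The square grid -/

theorem mem_squareGrid {m : ℕ} {x : Plane} :
    x ∈ squareGrid m ↔ ∃ i < m, ∃ j < m, x 0 = i ∧ x 1 = j := by
  simp only [squareGrid, Finset.mem_image, Finset.mem_product, Finset.mem_range, Prod.exists]
  constructor
  · rintro ⟨i, j, ⟨hi, hj⟩, rfl⟩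
    exact ⟨i, hi, j, hj, by simp, by simp⟩
  · rintro ⟨i, hi, j, hj, h0, h1⟩
    refine ⟨i, j, ⟨hi, hj⟩, ?_⟩
    ext k
    fin_cases k
    · simp [h0]
    · simp [h1]

theorem card_squareGrid (m : ℕ) : (squareGrid m).card = m ^ 2 := by
  rw [squareGrid, Finset.card_image_of_injective, Finset.card_product, Finset.card_range, sq]
  intro p q h
  have h0 := congrArg (fun x : Plane => x 0) h
  have h1 := congrArg (fun x : Plane => x 1) h
  simp at h0 h1
  exact Prod.ext h0 h1

/-- Of five points two are congruent modulo 2 in both coordinates. Their midpoint is in the grid and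
in the hull, hence by emptiness one of the five, but it is not a corner. -/
theorem squareGrid_no_pentagon (m : ℕ) : ¬ ContainsEmptyPentagon (squareGrid m) := by
  rintro ⟨X, hX, ⟨hc, hpos⟩, hE⟩
  choose! f hf g hg h0 h1 using fun x (hx : x ∈ X) => mem_squareGrid.1 (hX hx)
  obtain ⟨x, hx, y, hy, hxy, hpar⟩ := Finset.exists_ne_map_eq_of_card_lt_of_maps_to
    (s := X) (t := Finset.range 2 ×ˢ Finset.range 2) (f := fun x => (f x % 2, g x % 2))
    (by rw [hc]; simp) (fun x _ => by
      simp only [Finset.coe_product, Set.mem_prod, Finset.mem_coe, Finset.mem_range]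
      exact ⟨Nat.mod_lt _ two_pos, Nat.mod_lt _ two_pos⟩)
  simp only [Prod.mk.injEq] at hpar
  have ef : ((f x + f y) / 2 : ℕ) = ((f x : ℝ) + f y) / 2 := by
    have : 2 * ((f x + f y) / 2) = f x + f y := by omega
    have : (2 : ℝ) * ((f x + f y) / 2 : ℕ) = f x + f y := by exact_mod_cast this
    linarith
  have eg : ((g x + g y) / 2 : ℕ) = ((g x : ℝ) + g y) / 2 := by
    have : 2 * ((g x + g y) / 2) = g x + g y := by omega
    have : (2 : ℝ) * ((g x + g y) / 2 : ℕ) = g x + g y := by exact_mod_cast this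
    linarith
  have hfx := hf x hx
  have hfy := hf y hy
  have hgx := hg x hx
  have hgy := hg y hy
  have hw0 : ∀ k, midpoint ℝ x y k = (x k + y k) / 2 := fun k => by
    rw [midpoint_eq_smul_add]
    simp only [PiLp.smul_apply, PiLp.add_apply, smul_eq_mul, invOf_eq_inv]
    ring
  set w := midpoint ℝ x y with hw
  have hwG : w ∈ squareGrid m := by
    refine mem_squareGrid.2 ⟨(f x + f y) / 2, by omega, (g x + g y) / 2, by omega, ?_, ?_⟩
    · rw [hw0, h0 x hx, h0 y hy, ef]
    · rw [hw0, h1 x hx, h1 y hy, eg]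
  have hseg : w ∈ segment ℝ x y := midpoint_mem_segment x y
  have hwX : w ∈ (X : Set Plane) := by
    rw [← hE]
    exact ⟨hwG, segment_subset_convexHull (by exact_mod_cast hx) (by exact_mod_cast hy) hseg⟩
  have hwx : x ≠ w := by
    intro h
    rw [hw, eq_comm, midpoint_eq_left_iff] at h
    exact hxy h
  have hwy : y ≠ w := by
    intro h
    rw [hw, eq_comm, midpoint_eq_right_iff] at h
    exact hxy h
  have hwh : w ∈ convexHull ℝ ((X : Set Plane) \ {w}) :=
    segment_subset_convexHull (s := (X : Set Plane) \ {w}) ⟨by exact_mod_cast hx, hwx⟩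
      ⟨by exact_mod_cast hy, hwy⟩ hseg
  refine (hpos w hwX).2 (Set.Subset.antisymm (convexHull_mono Set.sdiff_subset)
    (convexHull_min (fun u hu => ?_) (convex_convexHull ℝ _)))
  by_cases huw : u = w
  · rw [huw]; exact hwh
  · exact subset_convexHull ℝ _ ⟨hu, huw⟩

/-- A coordinate takes only `m` values, so two of `m + 1` points agree in it. On a line this forces
that component of the direction to vanish. -/
theorem squareGrid_no_collinear (m : ℕ) : ¬ ContainsCollinear (m + 1) (squareGrid m) := by
  rintro ⟨S, hS, hc, hcol⟩
  obtain ⟨p₀, v, hv⟩ := (collinear_iff_exists_forall_eq_smul_vadd _).1 hcol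
  have coord : ∀ k : Fin 2, (∀ x ∈ squareGrid m, ∃ i < m, x k = (i : ℝ)) → v k = 0 := by
    intro k hk
    choose! f hf hfk using fun x (hx : x ∈ S) => hk x (hS hx)
    obtain ⟨x, hx, y, hy, hxy, hEq⟩ := Finset.exists_ne_map_eq_of_card_lt_of_maps_to
      (s := S) (t := Finset.range m) (f := f) (by rw [hc, Finset.card_range]; omega)
      (fun x hx => by
        rw [Finset.mem_coe, Finset.mem_range]
        exact hf x (by exact_mod_cast hx))
    obtain ⟨r, hr⟩ := hv x (by exact_mod_cast hx)
    obtain ⟨s, hs⟩ := hv y (by exact_mod_cast hy)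
    have e : x k = y k := by rw [hfk x hx, hfk y hy, hEq]
    have e1 : x k = r * v k + p₀ k := by rw [hr]; simp
    have e2 : y k = s * v k + p₀ k := by rw [hs]; simp
    have e3 : (r - s) * v k = 0 := by linarith
    refine (mul_eq_zero.1 e3).resolve_left fun h => hxy ?_
    rw [hr, hs, show r = s by linarith]
  have v0 : v = 0 := by
    ext k
    fin_cases k
    · exact coord 0 fun x hx => by
        obtain ⟨i, hi, j, hj, h0, h1⟩ := mem_squareGrid.1 hx
        exact ⟨i, hi, h0⟩
    · exact coord 1 fun x hx => by
        obtain ⟨i, hi, j, hj, h0, h1⟩ := mem_squareGrid.1 hx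
        exact ⟨j, hj, h1⟩
  rcases Nat.eq_zero_or_pos m with rfl | hm
  · obtain ⟨a, ha⟩ := Finset.card_pos.1 (show 0 < S.card by omega)
    obtain ⟨i, hi, -⟩ := mem_squareGrid.1 (hS ha)
    omega
  · obtain ⟨x, hx, y, hy, hxy⟩ := Finset.one_lt_card.1 (show 1 < S.card by omega)
    obtain ⟨r, hr⟩ := hv x (by exact_mod_cast hx)
    obtain ⟨s, hs⟩ := hv y (by exact_mod_cast hy)
    exact hxy (by rw [hr, hs, v0]; simp)

theorem theorem1 :
    (∀ (ℓ : ℕ) (P : Finset Plane), 328 * ℓ ^ 2 ≤ P.card →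
      ContainsEmptyPentagon P ∨ ContainsCollinear ℓ P) ∧
    (∀ ℓ : ℕ, 1 ≤ ℓ →
      (squareGrid (ℓ - 1)).card = (ℓ - 1) ^ 2 ∧
      ¬ ContainsEmptyPentagon (squareGrid (ℓ - 1)) ∧
      ¬ ContainsCollinear ℓ (squareGrid (ℓ - 1))) ∧
    (∃ c : ℝ, 0 < c ∧ ∀ ℓ N : ℕ,
      (∀ P : Finset Plane, N ≤ P.card → ContainsEmptyPentagon P ∨ ContainsCollinear ℓ P) →
      c * (ℓ : ℝ) ^ 2 ≤ (N : ℝ)) := by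
  refine ⟨pentagon_or_collinear, fun ℓ hℓ => ⟨card_squareGrid _, squareGrid_no_pentagon _, ?_⟩,
    1 / 2, by norm_num, fun ℓ N h => ?_⟩
  · have := squareGrid_no_collinear (ℓ - 1)
    rwa [Nat.sub_add_cancel hℓ] at this
  · rcases ℓ with _ | m
    · simp
    have hlt : m ^ 2 < N := by
      by_contra hn
      rcases h (squareGrid m) (by rw [card_squareGrid]; omega) with h | h
      · exact squareGrid_no_pentagon m h
      · exact squareGrid_no_collinear m h
    have : ((m : ℝ) ^ 2 + 1) ≤ N := by exact_mod_cast hlt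
    push_cast
    -- The constant `1 / 2` works because `2 (m² + 1) - (m + 1)² = (m - 1)²`.
    nlinarith [sq_nonneg ((m : ℝ) - 1)]
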